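/- **Theorem.** For $n\ge 2$ let $\tilde{\mathbb C}^n=\{(z,\ell)\in\mathbb C^n\times\mathbb{CP}^{n-1}: z\in\ell\}$ be the blow-up of $\mathbb C^n$ at the origin and $H=\{z=0\}$ its exceptional divisor. Let $g_{S(n)}$ be the generalized Simanca metric on $\tilde{\mathbb C}^n$, i.e. the Kähler metric whose Kähler form $\omega_{S(n)}$ is the smooth extension to $\tilde{\mathbb C}^n$ of the form $\frac{i}{2\pi}\partial\bar\partial(|z|^2+\log|z|^2)$ on $\tilde{\mathbb C}^n\setminus H\cong\mathbb C^n\setminus\{0\}$. Let $m\ge 1$ be an integer. 1. For every $n\ge 2$, $(\tilde{\mathbb C}^n, m g_{S(n)})$ is projectively induced: there is a holomorphic map $f:\tilde{\mathbb C}^n\to\mathbb{CP}^\infty$ (the projective space of $\ell^2$) with $f^*\omega_{FS}=m\,\omega_{S(n)}$, where $\omega_{FS}=\frac{i}{2\pi}\partial\bar\partial\log\sum_j|Z_j|^2$ is the Fubini–Study form. 2. For every $n\ge 3$, $m g_{S(n)}$ is not balanced, in the following sense. Consider a holomorphic line bundle $L_m$ on $\tilde{\mathbb C}^n$ with a smooth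 Hermitian metric $h_m$ such that $-\frac{i}{2\pi}\partial\bar\partial\log h_m(\sigma,\sigma)=m\,\omega_{S(n)}$ for local trivializing holomorphic sections $\sigma$. Let $\mathcal H_m$ be the Hilbert space of global holomorphic sections $s$ of $L_m$ with $\int_{\tilde{\mathbb C}^n} h_m(s,s)\,\frac{\omega_{S(n)}^n}{n!}<\infty$, let $(s_j)$ be an orthonormal basis of $\mathcal H_m$, and let $\epsilon_{m g_{S(n)}}(x)=\sum_j h_m(s_j(x),s_j(x))$. Such $(L_m,h_m)$ and $(s_j)$ exist, and for every choice of them the function $\epsilon_{m g_{S(n)}}$ is not constant on $\tilde{\mathbb C}^n$. -/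

import Mathlib

open Set Filter Topology MeasureTheory Bundle Manifold
open scoped ContDiff ENNReal LinearAlgebra.Projectivization

noncomputable section

/-! ### The blow-up of `ℂⁿ` at the origin as a complex manifold -/

/-- The quotient topology on a projective space. -/
instance projectivizationTopology (V : Type*) [AddCommGroup V] [Module ℂ V]
    [TopologicalSpace V] : TopologicalSpace (ℙ ℂ V) :=
  TopologicalSpace.coinduced (Projectivization.mk' ℂ) inferInstance

/-- The blow-up of `ℂⁿ` at the origin: pairs `(z, ℓ)` of a point and a line through the origin
with `z ∈ ℓ`, with the topology induced from `ℂⁿ × ℂPⁿ⁻¹`. -/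
abbrev BlowUp (n : ℕ) : Type :=
  {p : (Fin n → ℂ) × ℙ ℂ (Fin n → ℂ) // p.1 ∈ p.2.submodule}

namespace BlowUp

variable {n : ℕ}

instance : MeasurableSpace (BlowUp n) := borel _

instance : BorelSpace (BlowUp n) := ⟨rfl⟩

/-- The quotient `t j / t i` of homogeneous coordinates of `ℓ = [t]`. -/
def ratio (i j : Fin n) (l : ℙ ℂ (Fin n → ℂ)) : ℂ := l.rep j / l.rep i

theorem rep_mk_eq (v : Fin n → ℂ) (hv : v ≠ 0) :
    ∃ a : ℂ, a ≠ 0 ∧ (Projectivization.mk ℂ v hv).rep = a • v := by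
  obtain ⟨a, ha⟩ := Projectivization.exists_smul_eq_mk_rep ℂ v hv
  exact ⟨a, a.ne_zero, ha.symm⟩

theorem rep_mk_ne_zero (v : Fin n → ℂ) (hv : v ≠ 0) (i : Fin n) :
    (Projectivization.mk ℂ v hv).rep i ≠ 0 ↔ v i ≠ 0 := by
  obtain ⟨a, ha, h⟩ := rep_mk_eq v hv
  simp [h, ha]

theorem ratio_mk (v : Fin n → ℂ) (hv : v ≠ 0) (i j : Fin n) :
    ratio i j (Projectivization.mk ℂ v hv) = v j / v i := by
  obtain ⟨a, ha, h⟩ := rep_mk_eq v hv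
  simp only [ratio, h, Pi.smul_apply, smul_eq_mul]
  exact mul_div_mul_left _ _ ha

theorem isQuotientMap_mk' : IsQuotientMap (Projectivization.mk' ℂ (V := Fin n → ℂ)) :=
  ⟨⟨rfl⟩, fun l => by
    induction l with
    | h v hv => exact ⟨⟨v, hv⟩, rfl⟩⟩

/-- The domain `t i ≠ 0` of the `i`-th affine chart of projective space. -/
def affine (i : Fin n) : Set (ℙ ℂ (Fin n → ℂ)) := {l | l.rep i ≠ 0}

theorem preimage_affine (i : Fin n) :
    Projectivization.mk' ℂ ⁻¹' affine i = {v : {v : Fin n → ℂ // v ≠ 0} | v.1 i ≠ 0} := by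
  ext ⟨v, hv⟩
  exact rep_mk_ne_zero v hv i

theorem isOpen_affine (i : Fin n) : IsOpen (affine i) := by
  rw [← isQuotientMap_mk'.isOpen_preimage, preimage_affine]
  exact isOpen_ne_fun ((continuous_apply i).comp continuous_subtype_val) continuous_const

theorem continuousOn_ratio (i j : Fin n) : ContinuousOn (ratio i j) (affine i) := by
  rw [isQuotientMap_mk'.continuousOn_isOpen_iff (isOpen_affine i), preimage_affine]
  have : ratio i j ∘ Projectivization.mk' ℂ
      = fun v : {v : Fin n → ℂ // v ≠ 0} => v.1 j / v.1 i := by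
    ext ⟨v, hv⟩
    exact ratio_mk v hv i j
  rw [this]
  exact ContinuousOn.div ((continuous_apply j).comp continuous_subtype_val).continuousOn
    ((continuous_apply i).comp continuous_subtype_val).continuousOn fun v hv => hv

/-- Homogeneous coordinates, equal to `1` in position `i`, of the line with affine
coordinates `w j`, `j ≠ i`. -/
def dir (i : Fin n) (w : Fin n → ℂ) : Fin n → ℂ := Function.update w i 1

theorem dir_same (i : Fin n) (w : Fin n → ℂ) : dir i w i = 1 := by simp [dir]

theorem dir_ne_zero (i : Fin n) (w : Fin n → ℂ) : dir i w ≠ 0 := fun h => by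
  have := congrFun h i
  simp [dir_same] at this

/-- The parametrization `w ↦ (w i • t, [t])`, where `t j = w j` for `j ≠ i` and `t i = 1`. -/
def param (i : Fin n) (w : Fin n → ℂ) : BlowUp n :=
  ⟨(w i • dir i w, Projectivization.mk ℂ (dir i w) (dir_ne_zero i w)), by
    rw [Projectivization.submodule_mk]
    exact Submodule.smul_mem _ _ (Submodule.mem_span_singleton_self _)⟩

/-- The coordinates `(z, [t]) ↦ w`, where `w i = z i` and `w j = t j / t i` for `j ≠ i`. -/
def coord (i : Fin n) (p : BlowUp n) : Fin n → ℂ :=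
  Function.update (fun j => ratio i j p.1.2) i (p.1.1 i)

theorem continuous_dir (i : Fin n) : Continuous (dir i) := by
  unfold dir
  fun_prop

theorem continuous_param (i : Fin n) : Continuous (param i) := by
  refine Continuous.subtype_mk (Continuous.prodMk ?_ ?_) _
  · exact (continuous_apply i).smul (continuous_dir i)
  · exact isQuotientMap_mk'.continuous.comp ((continuous_dir i).subtype_mk (dir_ne_zero i))

theorem continuousOn_coord (i : Fin n) :
    ContinuousOn (coord i) {p : BlowUp n | p.1.2 ∈ affine i} := by
  rw [continuousOn_pi]
  intro j
  by_cases h : j = i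
  · subst h
    simp only [coord, Function.update_self]
    fun_prop
  · simp only [coord, Function.update_of_ne h]
    exact (continuousOn_ratio i j).comp (by fun_prop) fun p hp => hp

theorem coord_param (i : Fin n) (w : Fin n → ℂ) : coord i (param i w) = w := by
  ext j
  by_cases h : j = i
  · subst h
    simp [coord, param, dir_same]
  · simp [coord, param, h, ratio_mk, dir]

theorem smul_ratio (i : Fin n) (p : BlowUp n) (hp : p.1.2 ∈ affine i) (j : Fin n) :
    p.1.1 i * ratio i j p.1.2 = p.1.1 j := by
  obtain ⟨⟨z, l⟩, hz⟩ := p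
  have hl : l.rep i ≠ 0 := hp
  simp only [Projectivization.submodule_eq, Submodule.mem_span_singleton] at hz
  obtain ⟨a, rfl⟩ := hz
  simp only [ratio, Pi.smul_apply, smul_eq_mul]
  field_simp

theorem param_coord (i : Fin n) (p : BlowUp n) (hp : p.1.2 ∈ affine i) :
    param i (coord i p) = p := by
  have hd : dir i (coord i p) = fun j => ratio i j p.1.2 := by
    ext j
    by_cases h : j = i
    · subst h
      rw [dir_same, ratio, div_self]
      exact hp
    · simp [dir, coord, h]
  refine Subtype.ext (Prod.ext ?_ ?_)
  · ext j
    simp only [param, hd]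
    simpa [coord] using smul_ratio i p hp j
  · simp only [param]
    conv_rhs => rw [← Projectivization.mk_rep p.1.2]
    rw [Projectivization.mk_eq_mk_iff']
    refine ⟨(p.1.2.rep i)⁻¹, ?_⟩
    ext j
    simp [hd, ratio, div_eq_inv_mul]

/-- The `i`-th affine chart of the blow-up, defined where `t i ≠ 0`. -/
def chart (i : Fin n) : OpenPartialHomeomorph (BlowUp n) (Fin n → ℂ) where
  toFun := coord i
  invFun := param i
  source := {p | p.1.2 ∈ affine i}
  target := univ
  map_source' _p _ := mem_univ _
  map_target' w _ := (rep_mk_ne_zero _ (dir_ne_zero i w) i).2 (by simp [dir_same])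
  left_inv' p hp := param_coord i p hp
  right_inv' w _ := coord_param i w
  open_source := (isOpen_affine i).preimage (by fun_prop)
  open_target := isOpen_univ
  continuousOn_toFun := continuousOn_coord i
  continuousOn_invFun := (continuous_param i).continuousOn

theorem exists_mem_affine (p : BlowUp n) : ∃ i, p.1.2 ∈ affine i :=
  Function.ne_iff.1 p.1.2.rep_nonzero

/-- The index of the preferred chart at a point. -/
def idx (p : BlowUp n) : Fin n := (exists_mem_affine p).choose

theorem mem_affine_idx (p : BlowUp n) : p.1.2 ∈ affine (idx p) := (exists_mem_affine p).choose_spec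

instance : ChartedSpace (Fin n → ℂ) (BlowUp n) where
  atlas := range chart
  chartAt p := chart (idx p)
  mem_chart_source p := mem_affine_idx p
  chart_mem_atlas _ := mem_range_self _

/-- The blow-up is a complex manifold. -/
instance : IsManifold 𝓘(ℂ, Fin n → ℂ) ω (BlowUp n) := by
  refine isManifold_of_contDiffOn _ _ _ ?_
  rintro _ _ ⟨i, rfl⟩ ⟨j, rfl⟩
  have hdir : ∀ k, ContDiff ℂ ω fun w : Fin n → ℂ => dir i w k := by
    intro k
    by_cases h : k = i
    · subst h
      simp only [dir_same]
      exact contDiff_const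
    · simp only [dir, Function.update_of_ne h]
      fun_prop
  have hmem : ∀ w, param i w ∈ (chart j).source ↔ dir i w j ≠ 0 := fun w =>
    rep_mk_ne_zero _ (dir_ne_zero i w) j
  rw [contDiffOn_pi]
  intro k
  have : ∀ w, (chart j) ((chart i).symm w) k
      = if k = j then w i * dir i w j else dir i w k / dir i w j := by
    intro w
    change coord j (param i w) k = _
    by_cases h : k = j
    · subst h
      simp [coord, param]
    · simp [coord, param, h, ratio_mk]
  refine ContDiffOn.congr (f := fun w => if k = j then w i * dir i w j
    else dir i w k / dir i w j) ?_ fun w _ => this w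
  split_ifs
  · exact ((contDiff_apply ℂ ℂ i).mul (hdir j)).contDiffOn
  · refine (hdir k).contDiffOn.div (hdir j).contDiffOn fun w hw => ?_
    have hw' := hw.1
    simp only [mfld_simps] at hw'
    exact (hmem w).1 hw'.2

end BlowUp

/-! ### Complex Hessians, Hermitian tensors and Kähler immersions into `ℂP^∞` -/

/-- The complex Hessian of a real function `u` on `ℂⁿ` at `a`, as a sesquilinear form, linear in
the first argument: `levi u a v w = ∑ⱼₖ (∂²u/∂zⱼ∂z̄ₖ)(a) vⱼ w̄ₖ`. -/
def levi {n : ℕ} (u : (Fin n → ℂ) → ℝ) (a v w : Fin n → ℂ) : ℂ :=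
  let D := fderiv ℝ (fderiv ℝ u) a
  (((D v w + D (Complex.I • v) (Complex.I • w) : ℝ) : ℂ) +
    Complex.I * ((D v (Complex.I • w) - D (Complex.I • v) w : ℝ) : ℂ)) / 4

section Manifold

variable (n : ℕ) (M : Type) [TopologicalSpace M] [ChartedSpace (Fin n → ℂ) M]

/-- Fields of complex-valued forms `g(v, w)` on the (holomorphic) tangent spaces of `M`.
A form `g`, with components `gⱼₖ` in a chart, stands for the `(1,1)`-form
`(i/2π) ∑ gⱼₖ dzⱼ ∧ dz̄ₖ`. -/
abbrev TangentForm : Type :=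
  ∀ x : M, TangentSpace 𝓘(ℂ, Fin n → ℂ) x → TangentSpace 𝓘(ℂ, Fin n → ℂ) x → ℂ

variable {n M}

/-- The form `∂∂̄u` of a real function `u` on `M`, as a form on the tangent spaces, which Mathlib
identifies with the model space through the preferred charts. -/
def ddbar (u : M → ℝ) : TangentForm n M := fun x =>
  levi (u ∘ (chartAt (Fin n → ℂ) x).symm) (chartAt (Fin n → ℂ) x x)

/-- The Hilbert space whose projective space is `ℂP^∞`. -/
abbrev EllTwo : Type := lp (fun _ : ℕ => ℂ) 2

/-- `f` is a Kähler immersion of `(M, g)` into `ℂP^∞` with the Fubini-Study metric: it is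
holomorphic, i.e. it has local holomorphic lifts `F` to `ℓ² \ {0}`, and it pulls the Fubini-Study
form `(i/2π) ∂∂̄ log ‖Z‖²` back to the form of `g`. -/
def IsKahlerImmersion (g : TangentForm n M) (f : M → ℙ ℂ EllTwo) : Prop :=
  ∀ x : M, ∃ U : Set M, IsOpen U ∧ x ∈ U ∧ ∃ F : M → EllTwo,
    ContMDiffOn 𝓘(ℂ, Fin n → ℂ) 𝓘(ℂ, EllTwo) ω F U ∧
    (∀ y ∈ U, ∃ hy : F y ≠ 0, f y = Projectivization.mk ℂ (F y) hy) ∧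
    ∀ y ∈ U, ddbar (fun y' => Real.log (‖F y'‖ ^ 2)) y = g y

/-- `(M, g)` is projectively induced. -/
def ProjectivelyInduced (g : TangentForm n M) : Prop :=
  ∃ f : M → ℙ ℂ EllTwo, IsKahlerImmersion g f

/-! ### Geometric quantizations and the epsilon function -/

variable (n M) in
/-- A holomorphic line bundle over `M`. -/
structure HolomorphicLineBundle where
  /-- the fibres -/
  Fiber : M → Type
  [addCommGroup : ∀ x, AddCommGroup (Fiber x)]
  [module : ∀ x, Module ℂ (Fiber x)]
  [fiberTopology : ∀ x, TopologicalSpace (Fiber x)]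
  [totalTopology : TopologicalSpace (TotalSpace ℂ Fiber)]
  [fiberBundle : FiberBundle ℂ Fiber]
  [vectorBundle : VectorBundle ℂ ℂ Fiber]
  [holomorphic : ContMDiffVectorBundle ω ℂ Fiber 𝓘(ℂ, Fin n → ℂ)]

attribute [instance] HolomorphicLineBundle.addCommGroup HolomorphicLineBundle.module
  HolomorphicLineBundle.fiberTopology HolomorphicLineBundle.totalTopology
  HolomorphicLineBundle.fiberBundle HolomorphicLineBundle.vectorBundle
  HolomorphicLineBundle.holomorphic

/-- A smooth Hermitian metric on a holomorphic line bundle, linear in the first argument. -/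
structure HermitianMetric (L : HolomorphicLineBundle n M) where
  /-- the Hermitian product on the fibre over `x` -/
  form : ∀ x, L.Fiber x → L.Fiber x → ℂ
  add_left : ∀ x a b c, form x (a + b) c = form x a c + form x b c
  smul_left : ∀ x (r : ℂ) a b, form x (r • a) b = r * form x a b
  conj_symm : ∀ x a b, form x b a = (starRingEnd ℂ) (form x a b)
  pos : ∀ x a, a ≠ 0 → 0 < (form x a a).re
  smooth : ∀ (e : Trivialization ℂ (π ℂ L.Fiber)) [MemTrivializationAtlas e],
    ContMDiffOn 𝓘(ℝ, Fin n → ℂ) 𝓘(ℝ, ℝ) ∞ (fun x => (form x (e.symm x 1) (e.symm x 1)).re) e.baseSet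

/-- A geometric quantization of the form `(i/2π) ∑ gⱼₖ dzⱼ ∧ dz̄ₖ` of `g`: a holomorphic line bundle
with a Hermitian metric `h` whose curvature `-(i/2π) ∂∂̄ log h(σ, σ)` is this form, for
the trivializing holomorphic sections `σ` that belong to the trivializations of the bundle. -/
structure GeometricQuantization (g : TangentForm n M) where
  /-- the line bundle -/
  L : HolomorphicLineBundle n M
  /-- the Hermitian metric -/
  h : HermitianMetric L
  curvature : ∀ (e : Trivialization ℂ (π ℂ L.Fiber)) [MemTrivializationAtlas e],
    ∀ x ∈ e.baseSet,
      -ddbar (fun y => Real.log (h.form y (e.symm y 1) (e.symm y 1)).re) x = g x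

namespace GeometricQuantization

variable {g : TangentForm n M} (Q : GeometricQuantization g)

/-- Global holomorphic sections. -/
abbrev Sections : Type := ContMDiffSection 𝓘(ℂ, Fin n → ℂ) ℂ ω Q.L.Fiber

variable [MeasurableSpace M] (μ : Measure M)

/-- The squared norm `∫ h(s, s) dμ` of a section. -/
def normSq (s : Q.Sections) : ℝ≥0∞ := ∫⁻ x, ENNReal.ofReal (Q.h.form x (s x) (s x)).re ∂μ

/-- The scalar product `∫ h(s, t) dμ` of sections. -/
def scalarProduct (s t : Q.Sections) : ℂ := ∫ x, Q.h.form x (s x) (t x) ∂μ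

/-- `s` is an orthonormal basis of the Hilbert space of the global holomorphic sections with
`∫ h(s, s) dμ < ∞`: it is orthonormal, and its linear span is dense. -/
structure IsOrthonormalBasis {ι : Type} (s : ι → Q.Sections) : Prop where
  normSq_lt_top : ∀ j, Q.normSq μ (s j) < ⊤
  normSq_eq_one : ∀ j, Q.scalarProduct μ (s j) (s j) = 1
  orthogonal : ∀ j k, j ≠ k → Q.scalarProduct μ (s j) (s k) = 0
  dense : ∀ t : Q.Sections, Q.normSq μ t < ⊤ → ∀ δ : ℝ≥0∞, 0 < δ →
    ∃ c : ι →₀ ℂ, Q.normSq μ (t - c.sum fun j a => a • s j) < δ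

/-- The epsilon function `∑ⱼ h(sⱼ(x), sⱼ(x))` computed with a family `s`. -/
def epsilon {ι : Type} (s : ι → Q.Sections) (x : M) : ℝ≥0∞ :=
  ∑' j, ENNReal.ofReal (Q.h.form x (s j x) (s j x)).re

end GeometricQuantization

end Manifold

/-! ### The generalized Simanca metric -/

namespace BlowUp

variable {n : ℕ}

/-- The potential `|z|² + log |z|²` outside the exceptional divisor `z = 0`. -/
def simancaPotential (p : BlowUp n) : ℝ :=
  (∑ j, ‖p.1.1 j‖ ^ 2) + Real.log (∑ j, ‖p.1.1 j‖ ^ 2)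

/-- The potential of the generalized Simanca metric in the `i`-th chart,
`|wᵢ|² (1 + ∑_{j ≠ i} |wⱼ|²) + log (1 + ∑_{j ≠ i} |wⱼ|²)`. It differs from `|z|² + log |z|²` by
`log |wᵢ|²`, whose complex Hessian vanishes. -/
def localPotential (i : Fin n) (w : Fin n → ℂ) : ℝ :=
  ‖w i‖ ^ 2 * (∑ j, ‖dir i w j‖ ^ 2) + Real.log (∑ j, ‖dir i w j‖ ^ 2)

variable (n) in
/-- The generalized Simanca metric on the blow-up of `ℂⁿ` at the origin. -/
def simanca : TangentForm n (BlowUp n) := fun p => levi (localPotential (idx p)) (coord (idx p) p)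

/-- The density, with respect to Lebesgue measure on `ℂⁿ`, of the volume form `ωⁿ / n!` in the
`i`-th chart, for `ω = (i/2π) ∑ gⱼₖ dwⱼ ∧ dw̄ₖ`: it is `π⁻ⁿ det (gⱼₖ)`. -/
def volumeDensity (i : Fin n) (w : Fin n → ℂ) : ℝ≥0∞ :=
  ENNReal.ofReal ((Matrix.of fun j k : Fin n =>
    levi (localPotential i) w (Pi.single j 1) (Pi.single k 1)).det.re / Real.pi ^ n)

theorem levi_congr {u v : (Fin n → ℂ) → ℝ} {a : Fin n → ℂ} (h : u =ᶠ[𝓝 a] v) :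
    levi u a = levi v a := by
  have h2 : fderiv ℝ (fderiv ℝ u) a = fderiv ℝ (fderiv ℝ v) a := h.fderiv.fderiv_eq
  funext x y
  simp only [levi, h2]

theorem levi_add_re {u : (Fin n → ℂ) → ℝ} {F : (Fin n → ℂ) → ℂ} {a : Fin n → ℂ}
    (hu : ContDiffAt ℝ 2 u a) (hF : ContDiffAt ℂ 2 F a) :
    levi (fun w => u w + (F w).re) a = levi u a := by
  have hF1 : ∀ᶠ w in 𝓝 a, DifferentiableAt ℂ F w :=
    (hF.eventually (by simp)).mono fun w hw => hw.differentiableAt (by simp)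
  have hu1 : ∀ᶠ w in 𝓝 a, DifferentiableAt ℝ u w :=
    (hu.eventually (by simp)).mono fun w hw => hw.differentiableAt (by simp)
  have hF2 : DifferentiableAt ℂ (fderiv ℂ F) a :=
    (hF.fderiv_right (m := 1) (by norm_num)).differentiableAt (by simp)
  have hu2 : DifferentiableAt ℝ (fderiv ℝ u) a :=
    (hu.fderiv_right (m := 1) (by norm_num)).differentiableAt (by simp)
  let T : ((Fin n → ℂ) →L[ℂ] ℂ) →L[ℝ] ((Fin n → ℂ) →L[ℝ] ℝ) :=
    (ContinuousLinearMap.compL ℝ (Fin n → ℂ) ℂ ℝ Complex.reCLM).comp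
      (ContinuousLinearMap.restrictScalarsL ℂ (Fin n → ℂ) ℂ ℝ ℝ)
  have h1 : fderiv ℝ (fun w => u w + (F w).re) =ᶠ[𝓝 a]
      fun w => fderiv ℝ u w + T (fderiv ℂ F w) := by
    filter_upwards [hF1, hu1] with w hw hw'
    exact (hw'.hasFDerivAt.add
      (Complex.reCLM.hasFDerivAt.comp w (hw.hasFDerivAt.restrictScalars ℝ))).fderiv
  have h2 : fderiv ℝ (fderiv ℝ (fun w => u w + (F w).re)) a = fderiv ℝ (fderiv ℝ u) a +
      T.comp ((fderiv ℂ (fderiv ℂ F) a).restrictScalars ℝ) := by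
    rw [h1.fderiv_eq]
    exact (hu2.hasFDerivAt.add
      (T.hasFDerivAt.comp a (hF2.hasFDerivAt.restrictScalars ℝ))).fderiv
  have hT : ∀ v w, (T.comp ((fderiv ℂ (fderiv ℂ F) a).restrictScalars ℝ)) v w
      = (fderiv ℂ (fderiv ℂ F) a v w).re := fun v w => rfl
  funext x y
  simp only [levi, h2, _root_.add_apply, hT, map_smul, _root_.smul_apply,
    smul_eq_mul]
  congr 2
  · congr 1
    rw [← mul_assoc, Complex.I_mul_I]
    simp only [neg_mul, one_mul, Complex.neg_re]
    ring
  · congr 2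
    ring

theorem contDiff_localPotential (i : Fin n) : ContDiff ℝ 2 (localPotential i) := by
  have hd : ∀ k, ContDiff ℝ 2 fun w : Fin n → ℂ => ‖dir i w k‖ ^ 2 := by
    intro k
    by_cases h : k = i
    · subst h
      simp only [dir_same]
      exact contDiff_const
    · simp only [dir, Function.update_of_ne h]
      exact (contDiff_apply ℝ ℂ k).norm_sq ℝ
  have hs : ContDiff ℝ 2 fun w : Fin n → ℂ => ∑ k, ‖dir i w k‖ ^ 2 :=
    ContDiff.sum fun k _ => hd k
  refine (((contDiff_apply ℝ ℂ i).norm_sq ℝ).mul hs).add (hs.log fun w => ne_of_gt ?_)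
  refine Finset.sum_pos' (fun k _ => by positivity) ⟨i, Finset.mem_univ i, ?_⟩
  simp [dir_same]

/-- Outside the exceptional divisor, the form of the generalized Simanca metric is
`∂∂̄ (|z|² + log |z|²)`. -/
theorem simanca_eq (p : BlowUp n) (hp : p.1.1 ≠ 0) : simanca n p = ddbar simancaPotential p := by
  set i := idx p with hi
  have hpi := mem_affine_idx p
  set a := coord i p with ha
  have hai : a i ≠ 0 := by
    intro h
    apply hp
    ext j
    rw [← smul_ratio i p hpi j]
    have : p.1.1 i = 0 := by simpa [ha, coord] using h
    simp [this]
  change levi (localPotential i) a = levi (simancaPotential ∘ param i) a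
  have hF : ContDiffAt ℂ 2
      (fun w : Fin n → ℂ => 2 * Complex.log (w i / a i) + Complex.log ((‖a i‖ ^ 2 : ℝ) : ℂ)) a := by
    have hlog : ContDiffAt ℂ 2 Complex.log (a i / a i) :=
      Complex.contDiffAt_log (by simp [div_self hai])
    have hq : ContDiffAt ℂ 2 (fun w : Fin n → ℂ => w i / a i) a :=
      (contDiff_apply ℂ ℂ i).contDiffAt.div_const _
    exact (contDiffAt_const.mul (ContDiffAt.comp a hlog hq)).add contDiffAt_const
  rw [← levi_add_re (contDiff_localPotential i).contDiffAt hF]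
  apply levi_congr
  have hne : ∀ᶠ w : Fin n → ℂ in 𝓝 a, w i ≠ 0 :=
    (continuous_apply i).continuousAt.eventually_ne hai
  filter_upwards [hne] with w hw
  have hs : 0 < ∑ k, ‖dir i w k‖ ^ 2 :=
    Finset.sum_pos' (fun k _ => by positivity) ⟨i, Finset.mem_univ i, by simp [dir_same]⟩
  have hw' : 0 < ‖w i‖ := norm_pos_iff.2 hw
  have ha' : 0 < ‖a i‖ := norm_pos_iff.2 hai
  have hz : ∑ j, ‖(param i w).1.1 j‖ ^ 2 = ‖w i‖ ^ 2 * ∑ k, ‖dir i w k‖ ^ 2 := by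
    simp only [param, Pi.smul_apply, smul_eq_mul, norm_mul, mul_pow, Finset.mul_sum]
  simp only [Function.comp, simancaPotential, localPotential, hz, ← Complex.ofReal_log (sq_nonneg _),
    Complex.add_re, Complex.ofReal_re]
  rw [show (2 : ℂ) = ((2 : ℝ) : ℂ) by norm_num, Complex.re_ofReal_mul, Complex.log_re, norm_div,
    Real.log_mul (by positivity) hs.ne', Real.log_div hw'.ne' ha'.ne', Real.log_pow, Real.log_pow]
  push_cast
  ring

variable (n) in
/-- The measure given by the volume form `ωⁿ / n!` of the generalized Simanca metric. It is put
together from the charts, the `i`-th one being used on the part of its domain that the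
earlier ones do not cover. -/
def simancaVolume : Measure (BlowUp n) :=
  ∑ i : Fin n, (Measure.map (chart i).symm (volume.withDensity (volumeDensity i))).restrict
    ((chart i).source \ ⋃ j : Fin n, ⋃ _ : j < i, (chart j).source)

end BlowUp

end

noncomputable section

/-! ### Holomorphic maps between normed spaces are analytic -/

section HolomorphicAnalytic

variable {E F : Type*} [NormedAddCommGroup E] [NormedSpace ℂ E] [NormedAddCommGroup F]
  [NormedSpace ℂ F]

theorem norm_fderiv_le_of_closedBall {G : E → F} {U : Set E} (hU : IsOpen U)
    (hG : DifferentiableOn ℂ G U) {C : ℝ} (hC0 : 0 ≤ C) (hC : ∀ y ∈ U, ‖G y‖ ≤ C) {δ : ℝ}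
    (hδ : 0 < δ) {y : E} (hy : Metric.closedBall y δ ⊆ U) : ‖fderiv ℂ G y‖ ≤ C / δ := by
  refine ContinuousLinearMap.opNorm_le_bound _ (by positivity) fun v => ?_
  rcases eq_or_ne v 0 with rfl | hv
  · simp
  have hv' : 0 < ‖v‖ := norm_pos_iff.2 hv
  have hyU : y ∈ U := hy (Metric.mem_closedBall_self hδ.le)
  have hmaps : ∀ z ∈ Metric.closedBall (0 : ℂ) (δ / ‖v‖), y + z • v ∈ U := by
    intro z hz
    apply hy
    rw [mem_closedBall_zero_iff] at hz
    rw [Metric.mem_closedBall, dist_eq_norm, add_sub_cancel_left, norm_smul]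
    exact (le_div_iff₀ hv').1 hz
  have hline : ∀ z : ℂ, HasDerivAt (fun z : ℂ => y + z • v) v z := fun z => by
    simpa using ((hasDerivAt_id z).smul_const v).const_add y
  have hd : DifferentiableOn ℂ (fun z : ℂ => G (y + z • v)) (Metric.closedBall 0 (δ / ‖v‖)) := by
    refine hG.comp (fun z _ => (hline z).differentiableAt.differentiableWithinAt) hmaps
  have h1 : deriv (fun z : ℂ => G (y + z • v)) 0 = fderiv ℂ G y v := by
    have hGy : HasFDerivAt G (fderiv ℂ G y) (y + (0 : ℂ) • v) := by
      rw [zero_smul, add_zero]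
      exact (hG.differentiableAt (hU.mem_nhds hyU)).hasFDerivAt
    exact (hGy.comp_hasDerivAt 0 (hline 0)).deriv
  have := Complex.norm_deriv_le_of_forall_mem_sphere_norm_le (c := 0) (div_pos hδ hv')
    (hd.diffContOnCl_ball subset_rfl)
    fun z hz => hC _ (hmaps z (Metric.sphere_subset_closedBall hz))
  rw [h1] at this
  calc _ ≤ _ := this
    _ = _ := by field_simp

theorem norm_iteratedFDeriv_le_of_ball {f : E → F} {x : E} {R : ℝ}
    (hf : ContDiffOn ℂ ∞ f (Metric.ball x R)) {C : ℝ} (hC0 : 0 ≤ C)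
    (hC : ∀ y ∈ Metric.ball x R, ‖f y‖ ≤ C) {δ : ℝ} (hδ : 0 < δ) (k : ℕ) :
    ∀ y ∈ Metric.ball x (R - k * δ), ‖iteratedFDeriv ℂ k f y‖ ≤ C / δ ^ k := by
  induction k with
  | zero => simpa using hC
  | succ k ih =>
    intro y hy
    rw [← norm_fderiv_iteratedFDeriv, pow_succ, ← div_div]
    have hsub : Metric.ball x (R - k * δ) ⊆ Metric.ball x R :=
      Metric.ball_subset_ball (by nlinarith [(Nat.cast_nonneg k : (0 : ℝ) ≤ k)])
    refine norm_fderiv_le_of_closedBall Metric.isOpen_ball (fun z hz => ?_) (by positivity) ih hδ ?_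
    · refine DifferentiableAt.differentiableWithinAt ?_
      exact (hf.contDiffAt (Metric.isOpen_ball.mem_nhds (hsub hz))).differentiableAt_iteratedFDeriv
        (by exact_mod_cast (WithTop.coe_lt_top k))
    · refine Metric.closedBall_subset_ball' ?_
      rw [Metric.mem_ball] at hy
      push_cast at hy
      linarith

theorem iteratedDeriv_comp_line {f : E → F} {U : Set E} (hU : IsOpen U) (hf : ContDiffOn ℂ ∞ f U)
    (x v : E) (k : ℕ) : ∀ z : ℂ, x + z • v ∈ U →
    iteratedDeriv k (fun z : ℂ => f (x + z • v)) z = iteratedFDeriv ℂ k f (x + z • v) fun _ => v := by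
  induction k with
  | zero => simp
  | succ k ih =>
    intro z hz
    have hline : HasDerivAt (fun z : ℂ => x + z • v) v z := by
      simpa using ((hasDerivAt_id z).smul_const v).const_add x
    have hev : iteratedDeriv k (fun z : ℂ => f (x + z • v)) =ᶠ[𝓝 z]
        fun z => iteratedFDeriv ℂ k f (x + z • v) fun _ => v :=
      (hline.continuousAt.eventually (hU.mem_nhds hz)).mono ih
    rw [iteratedDeriv_succ, hev.deriv_eq]
    have hd : DifferentiableAt ℂ (iteratedFDeriv ℂ k f) (x + z • v) :=
      (hf.contDiffAt (hU.mem_nhds hz)).differentiableAt_iteratedFDeriv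
        (by exact_mod_cast (WithTop.coe_lt_top k))
    have h := hd.hasFDerivAt.comp_hasDerivAt z hline
    have h2 := ((ContinuousMultilinearMap.apply ℂ (fun _ : Fin k => E) F
      (fun _ => v)).hasFDerivAt).comp_hasDerivAt z h
    refine h2.deriv.trans ?_
    rw [iteratedFDeriv_succ_apply_left]
    rfl

theorem analyticAt_of_contDiffOn_ball [CompleteSpace F] {f : E → F} {x : E} {R : ℝ} (hR : 0 < R)
    (hf : ContDiffOn ℂ ∞ f (Metric.ball x R)) {C : ℝ} (hC : ∀ y ∈ Metric.ball x R, ‖f y‖ ≤ C) :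
    AnalyticAt ℂ f x := by
  have hC0 : 0 ≤ C := (norm_nonneg _).trans (hC x (Metric.mem_ball_self hR))
  let p : FormalMultilinearSeries ℂ E F := fun k =>
    ((k.factorial : ℂ)⁻¹) • iteratedFDeriv ℂ k f x
  have hbound : ∀ k : ℕ, ‖p k‖ ≤ C * Real.exp 1 * (Real.exp 1 / R) ^ k := by
    intro k
    have hk : (0 : ℝ) < k + 1 := by positivity
    have h1 := norm_iteratedFDeriv_le_of_ball hf hC0 hC (δ := R / (k + 1)) (by positivity) k x
      (Metric.mem_ball_self (by
        have : (k : ℝ) * (R / (k + 1)) = R * (k / (k + 1)) := by ring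
        have h2 : (k : ℝ) / (k + 1) < 1 := (div_lt_one hk).2 (by linarith)
        nlinarith))
    have h2 : ((k : ℝ) + 1) ^ k / k.factorial ≤ Real.exp (k + 1) :=
      Real.pow_div_factorial_le_exp _ hk.le k
    have hfac : (0 : ℝ) < k.factorial := by exact_mod_cast k.factorial_pos
    calc ‖p k‖ = (k.factorial : ℝ)⁻¹ * ‖iteratedFDeriv ℂ k f x‖ := by
          simp [p, norm_smul]
      _ ≤ (k.factorial : ℝ)⁻¹ * (C / (R / (k + 1)) ^ k) := by gcongr
      _ = C * (((k : ℝ) + 1) ^ k / k.factorial) / R ^ k := by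
          rw [div_pow]
          field_simp
      _ ≤ C * Real.exp (k + 1) / R ^ k := by gcongr
      _ = _ := by
          rw [Real.exp_add, div_pow, ← Real.exp_nat_mul, mul_one]
          ring
  have he := Real.exp_pos 1
  let r : NNReal := ⟨R / (2 * Real.exp 1), by positivity⟩
  have hr : (r : ℝ) = R / (2 * Real.exp 1) := rfl
  have hrad : (r : ℝ≥0∞) ≤ p.radius := by
    refine p.le_radius_of_bound (C * Real.exp 1) fun k => ?_
    calc _ ≤ C * Real.exp 1 * (Real.exp 1 / R) ^ k * (r : ℝ) ^ k := by gcongr; exact hbound k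
      _ = C * Real.exp 1 * (1 / 2) ^ k := by
          rw [mul_assoc, ← mul_pow, hr]
          congr 2
          field_simp
      _ ≤ _ := by
          have : (1 / 2 : ℝ) ^ k ≤ 1 := pow_le_one₀ (by norm_num) (by norm_num)
          nlinarith [mul_nonneg hC0 he.le]
  refine ⟨p, r, hrad, ?_, ?_⟩
  · have : 0 < r := by rw [← NNReal.coe_pos, hr]; positivity
    exact_mod_cast this
  · intro v hv
    have hv' : ‖v‖ < R / 2 := by
      have h1 : ‖v‖ < r := by
        simpa [Metric.mem_eball, edist_zero_right, ← ofReal_norm, ENNReal.ofReal_lt_iff_lt_toReal] using hv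
      refine h1.trans_le ?_
      rw [hr]
      have : (1 : ℝ) ≤ Real.exp 1 := Real.one_le_exp (by norm_num)
      gcongr
      linarith
    have hmaps : ∀ z ∈ Metric.ball (0 : ℂ) 2, x + z • v ∈ Metric.ball x R := by
      intro z hz
      rw [mem_ball_zero_iff] at hz
      rw [Metric.mem_ball, dist_eq_norm, add_sub_cancel_left, norm_smul]
      nlinarith [norm_nonneg v, norm_nonneg z]
    have hd : DifferentiableOn ℂ (fun z : ℂ => f (x + z • v)) (Metric.ball 0 2) :=
      (hf.differentiableOn (by simp)).comp (by fun_prop) hmaps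
    have hs := Complex.hasSum_taylorSeries_on_ball hd (z := 1) (by simp)
    have hit := fun k => iteratedDeriv_comp_line Metric.isOpen_ball hf x v k 0
      (hmaps 0 (by simp))
    simpa [hit, p] using hs

end HolomorphicAnalytic

section RealSmooth

/-- The complex linear part of a real linear map. -/
def complexPart {E F : Type*} [NormedAddCommGroup E] [NormedSpace ℂ E]
    [NormedAddCommGroup F] [NormedSpace ℂ F] (A : E →L[ℝ] F) : E →L[ℂ] F where
  toFun v := (2 : ℂ)⁻¹ • (A v - Complex.I • A (Complex.I • v))
  map_add' v w := by simp only [smul_add, map_add]; module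
  map_smul' c v := by
    have h1 : ∀ u : E, A (c • u) = (c.re : ℂ) • A u + (c.im : ℂ) • A (Complex.I • u) := by
      intro u
      conv_lhs => rw [← Complex.re_add_im c]
      rw [add_smul, mul_smul, map_add, Complex.coe_smul, Complex.coe_smul, map_smul,
        map_smul, Complex.coe_smul, Complex.coe_smul]
    have h2 : A (Complex.I • Complex.I • v) = -A v := by
      rw [smul_smul, Complex.I_mul_I, neg_one_smul, map_neg]
    have h3 : ∀ u : F, c • u = (c.re : ℂ) • u + (c.im : ℂ) • Complex.I • u := by
      intro u
      conv_lhs => rw [← Complex.re_add_im c]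
      rw [add_smul, mul_smul]
    have h4 : ∀ u : F, Complex.I • Complex.I • u = -u := fun u => by
      rw [smul_smul, Complex.I_mul_I, neg_one_smul]
    rw [smul_comm Complex.I c v, h1, h1, h2, RingHom.id_apply, h3]
    generalize A v = x
    generalize A (Complex.I • v) = y
    have h5 : Complex.I • (2 : ℂ)⁻¹ • (x - Complex.I • y) = (2 : ℂ)⁻¹ • (Complex.I • x + y) := by
      rw [smul_comm, smul_sub, h4, sub_neg_eq_add]
    rw [h5, smul_add Complex.I, smul_comm Complex.I _ y, smul_comm Complex.I _ (-x)]
    module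
  cont := by fun_prop

/-- The complex linear part, as a continuous linear map. -/
def complexLinearPart (E F : Type*) [NormedAddCommGroup E] [NormedSpace ℂ E]
    [NormedAddCommGroup F] [NormedSpace ℂ F] : (E →L[ℝ] F) →L[ℝ] (E →L[ℂ] F) :=
  LinearMap.mkContinuous
    { toFun := complexPart
      map_add' := fun A B => by
        ext v
        change (2 : ℂ)⁻¹ • ((A v + B v) - Complex.I • (A (Complex.I • v) + B (Complex.I • v))) =
          (2 : ℂ)⁻¹ • (A v - Complex.I • A (Complex.I • v)) +
          (2 : ℂ)⁻¹ • (B v - Complex.I • B (Complex.I • v))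
        module
      map_smul' := fun c A => by
        ext v
        change (2 : ℂ)⁻¹ • ((c • A v) - Complex.I • (c • A (Complex.I • v))) =
          c • ((2 : ℂ)⁻¹ • (A v - Complex.I • A (Complex.I • v)))
        rw [smul_comm Complex.I c, ← smul_sub, smul_comm] }
    1 fun A => by
      rw [one_mul]
      refine ContinuousLinearMap.opNorm_le_bound _ (norm_nonneg _) fun v => ?_
      change ‖(2 : ℂ)⁻¹ • (A v - Complex.I • A (Complex.I • v))‖ ≤ _
      have h1 : ‖A v‖ ≤ ‖A‖ * ‖v‖ := A.le_opNorm v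
      have h2 : ‖Complex.I • A (Complex.I • v)‖ ≤ ‖A‖ * ‖v‖ := by
        rw [norm_smul, Complex.norm_I, one_mul]
        refine (A.le_opNorm _).trans_eq ?_
        rw [norm_smul, Complex.norm_I, one_mul]
      have h3 := (norm_sub_le (A v) (Complex.I • A (Complex.I • v))).trans (add_le_add h1 h2)
      rw [norm_smul, norm_inv, Complex.norm_ofNat]
      linarith

theorem complexLinearPart_apply {E F : Type*} [NormedAddCommGroup E] [NormedSpace ℂ E]
    [NormedAddCommGroup F] [NormedSpace ℂ F] (A : E →L[ℝ] F) (v : E) :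
    complexLinearPart E F A v = (2 : ℂ)⁻¹ • (A v - Complex.I • A (Complex.I • v)) := rfl

theorem complexLinearPart_restrictScalars {E F : Type*} [NormedAddCommGroup E] [NormedSpace ℂ E]
    [NormedAddCommGroup F] [NormedSpace ℂ F] (A : E →L[ℂ] F) :
    complexLinearPart E F (A.restrictScalars ℝ) = A := by
  ext v
  rw [complexLinearPart_apply]
  simp only [ContinuousLinearMap.coe_restrictScalars', map_smul, smul_smul, Complex.I_mul_I]
  module

universe u

variable {E : Type u} [NormedAddCommGroup E] [NormedSpace ℂ E]

theorem differentiableAt_fderiv_of_real {F : Type u} [NormedAddCommGroup F] [NormedSpace ℂ F]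
    {f : E → F} {a : E} (hf : ∀ᶠ x in 𝓝 a, DifferentiableAt ℂ f x)
    (h : DifferentiableAt ℝ (fderiv ℂ f) a) : DifferentiableAt ℂ (fderiv ℂ f) a := by
  have hD := h.hasFDerivAt
  set D := fderiv ℝ (fderiv ℂ f) a
  have hsymm : ∀ v w, D v w = D w v := fun v w =>
    second_derivative_symmetric_of_eventually (f := f)
      (f' := fun y => (fderiv ℂ f y).restrictScalars ℝ)
      (hf.mono fun y hy => hy.hasFDerivAt.restrictScalars ℝ)
      ((ContinuousLinearMap.restrictScalarsL ℂ E F ℝ ℝ).hasFDerivAt.comp a hD) v w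
  let D' : E →L[ℂ] (E →L[ℂ] F) :=
    { toFun := D
      map_add' := map_add D
      map_smul' := fun c v => by
        ext w
        rw [hsymm, map_smul, hsymm]
        rfl
      cont := D.continuous }
  exact (hasFDerivAt_of_restrictScalars ℝ (f' := D') hD rfl).differentiableAt

theorem contDiffOn_nat_of_real (k : ℕ) : ∀ {F : Type u} [NormedAddCommGroup F] [NormedSpace ℂ F]
    {f : E → F} {U : Set E}, IsOpen U → ContDiffOn ℝ ∞ f U → DifferentiableOn ℂ f U →
    ContDiffOn ℂ k f U := by
  induction k with
  | zero =>
    intro F _ _ f U _ hf _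
    exact contDiffOn_zero.2 hf.continuousOn
  | succ k ih =>
    intro F _ _ f U hU hf hd
    push_cast
    rw [contDiffOn_succ_iff_fderiv_of_isOpen hU]
    refine ⟨hd, by simp, ?_⟩
    have hda : ∀ x ∈ U, DifferentiableAt ℂ f x := fun x hx => hd.differentiableAt (hU.mem_nhds hx)
    have hfd : ContDiffOn ℝ ∞ (fderiv ℂ f) U := by
      have h1 : ContDiffOn ℝ ∞ (fun x => complexLinearPart E F (fderiv ℝ f x)) U :=
        (complexLinearPart E F).contDiff.comp_contDiffOn
          (hf.fderiv_of_isOpen hU (m := ∞) (by simp))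
      refine h1.congr fun x hx => ?_
      rw [((hda x hx).hasFDerivAt.restrictScalars ℝ).fderiv, complexLinearPart_restrictScalars]
    refine ih hU hfd fun x hx => ?_
    refine (differentiableAt_fderiv_of_real ?_ ?_).differentiableWithinAt
    · filter_upwards [hU.mem_nhds hx] with y hy using hda y hy
    · exact (hfd.contDiffAt (hU.mem_nhds hx)).differentiableAt (by simp)

/-- A real smooth, complex differentiable map is analytic. -/
theorem contDiffOn_omega_of_real {F : Type u} [NormedAddCommGroup F] [NormedSpace ℂ F]
    [CompleteSpace F] {f : E → F} {U : Set E} (hU : IsOpen U) (hf : ContDiffOn ℝ ∞ f U)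
    (hd : DifferentiableOn ℂ f U) : ContDiffOn ℂ ω f U := by
  have hinf : ContDiffOn ℂ ∞ f U :=
    contDiffOn_infty.2 fun k => contDiffOn_nat_of_real k hU hf hd
  intro x hx
  have hb : ∀ᶠ y in 𝓝 x, ‖f y‖ ≤ ‖f x‖ + 1 := by
    have := (hf.continuousOn.continuousAt (hU.mem_nhds hx)).norm
    filter_upwards [this.eventually (gt_mem_nhds (lt_add_one ‖f x‖))] with y hy using hy.le
  obtain ⟨R, hR, hball⟩ := Metric.mem_nhds_iff.1 (inter_mem (hU.mem_nhds hx) hb)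
  exact (analyticAt_of_contDiffOn_ball hR (hinf.mono fun y hy => (hball hy).1)
    fun y hy => (hball hy).2).contDiffAt.contDiffWithinAt

end RealSmooth

end

noncomputable section

/-! ### Calculus of complex Hessians -/

section Levi

variable {n : ℕ}

theorem levi_eq_of_hasFDerivAt {u : (Fin n → ℂ) → ℝ} {a : Fin n → ℂ}
    {g : (Fin n → ℂ) → (Fin n → ℂ) →L[ℝ] ℝ} {D : (Fin n → ℂ) →L[ℝ] (Fin n → ℂ) →L[ℝ] ℝ}
    (hg : ∀ᶠ x in 𝓝 a, HasFDerivAt u (g x) x) (hD : HasFDerivAt g D a) (v w : Fin n → ℂ) :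
    levi u a v w = (((D v w + D (Complex.I • v) (Complex.I • w) : ℝ) : ℂ) +
      Complex.I * ((D v (Complex.I • w) - D (Complex.I • v) w : ℝ) : ℂ)) / 4 := by
  have h : fderiv ℝ u =ᶠ[𝓝 a] g := hg.mono fun x hx => hx.fderiv
  simp only [levi, h.fderiv_eq, hD.fderiv]

theorem eventually_hasFDerivAt {E F : Type*} [NormedAddCommGroup E] [NormedSpace ℝ E]
    [NormedAddCommGroup F] [NormedSpace ℝ F] {u : E → F} {a : E}
    (hu : ContDiffAt ℝ 2 u a) : ∀ᶠ x in 𝓝 a, HasFDerivAt u (fderiv ℝ u x) x :=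
  (hu.eventually (by simp)).mono fun _ hx => (hx.differentiableAt (by simp)).hasFDerivAt

theorem hasFDerivAt_fderiv {E F : Type*} [NormedAddCommGroup E] [NormedSpace ℝ E]
    [NormedAddCommGroup F] [NormedSpace ℝ F] {u : E → F} {a : E}
    (hu : ContDiffAt ℝ 2 u a) : HasFDerivAt (fderiv ℝ u) (fderiv ℝ (fderiv ℝ u) a) a :=
  ((hu.fderiv_right (m := 1) (by norm_num)).differentiableAt (by simp)).hasFDerivAt

theorem eventually_hasFDerivAt_complex {E F : Type*} [NormedAddCommGroup E] [NormedSpace ℂ E]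
    [NormedAddCommGroup F] [NormedSpace ℂ F] {u : E → F} {a : E}
    (hu : ContDiffAt ℂ 2 u a) : ∀ᶠ x in 𝓝 a, HasFDerivAt u (fderiv ℂ u x) x :=
  (hu.eventually (by simp)).mono fun _ hx => (hx.differentiableAt (by simp)).hasFDerivAt

theorem hasFDerivAt_fderiv_complex {E F : Type*} [NormedAddCommGroup E] [NormedSpace ℂ E]
    [NormedAddCommGroup F] [NormedSpace ℂ F] {u : E → F} {a : E}
    (hu : ContDiffAt ℂ 2 u a) : HasFDerivAt (fderiv ℂ u) (fderiv ℂ (fderiv ℂ u) a) a :=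
  ((hu.fderiv_right (m := 1) (by norm_num)).differentiableAt (by simp)).hasFDerivAt

theorem levi_add {u v : (Fin n → ℂ) → ℝ} {a : Fin n → ℂ}
    (hu : ContDiffAt ℝ 2 u a) (hv : ContDiffAt ℝ 2 v a) :
    levi (fun x => u x + v x) a = levi u a + levi v a := by
  funext x y
  have h1 : ∀ᶠ x in 𝓝 a, HasFDerivAt (fun x => u x + v x) (fderiv ℝ u x + fderiv ℝ v x) x := by
    filter_upwards [eventually_hasFDerivAt hu, eventually_hasFDerivAt hv] with x h1 h2
    exact h1.add h2
  rw [levi_eq_of_hasFDerivAt h1 ((hasFDerivAt_fderiv hu).add (hasFDerivAt_fderiv hv))]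
  simp only [Pi.add_apply, levi, add_apply]
  push_cast
  ring

theorem levi_const_mul (c : ℝ) {u : (Fin n → ℂ) → ℝ} {a : Fin n → ℂ}
    (hu : ContDiffAt ℝ 2 u a) : levi (fun x => c * u x) a = (c : ℂ) • levi u a := by
  funext x y
  rw [levi_eq_of_hasFDerivAt
    ((eventually_hasFDerivAt hu).mono fun x h1 => h1.const_mul c)
    ((hasFDerivAt_fderiv hu).const_smul c)]
  simp only [Pi.smul_apply, levi, smul_apply, smul_eq_mul]
  push_cast
  ring

theorem levi_const (c : ℝ) (a : Fin n → ℂ) : levi (fun _ => c) a = 0 := by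
  funext x y
  rw [levi_eq_of_hasFDerivAt (g := fun _ => 0) (D := 0)
    (Eventually.of_forall fun x => hasFDerivAt_const c x) (hasFDerivAt_const _ _)]
  simp

theorem levi_sum {ι : Type*} (s : Finset ι) {u : ι → (Fin n → ℂ) → ℝ} {a : Fin n → ℂ}
    (hu : ∀ i ∈ s, ContDiffAt ℝ 2 (u i) a) :
    levi (fun x => ∑ i ∈ s, u i x) a = ∑ i ∈ s, levi (u i) a := by
  classical
  induction s using Finset.induction_on with
  | empty => simpa using levi_const 0 a
  | insert i s hi ih =>
    simp only [Finset.sum_insert hi]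
    rw [levi_add (hu i (Finset.mem_insert_self _ _))
      (ContDiffAt.sum fun j hj => hu j (Finset.mem_insert_of_mem hj)),
      ih fun j hj => hu j (Finset.mem_insert_of_mem hj)]

theorem levi_comp {u : (Fin n → ℂ) → ℝ} {f : (Fin n → ℂ) → (Fin n → ℂ)} {a : Fin n → ℂ}
    (hu : ContDiffAt ℝ 2 u (f a)) (hf : ContDiffAt ℂ 2 f a) (v w : Fin n → ℂ) :
    levi (u ∘ f) a v w = levi u (f a) (fderiv ℂ f a v) (fderiv ℂ f a w) := by
  have hfa : HasFDerivAt f (fderiv ℂ f a) a := (hf.differentiableAt (by simp)).hasFDerivAt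
  have h1 : ∀ᶠ x in 𝓝 a, HasFDerivAt (u ∘ f)
      ((fderiv ℝ u (f x)).comp ((fderiv ℂ f x).restrictScalars ℝ)) x := by
    filter_upwards [hf.continuousAt.eventually (eventually_hasFDerivAt hu),
      eventually_hasFDerivAt_complex hf] with x h1 h2
    exact h1.comp x (h2.restrictScalars ℝ)
  have h2 := ((hasFDerivAt_fderiv hu).comp a (hfa.restrictScalars ℝ)).clm_comp
    ((ContinuousLinearMap.restrictScalarsL ℂ (Fin n → ℂ) (Fin n → ℂ) ℝ ℝ).hasFDerivAt.comp a
      ((hasFDerivAt_fderiv_complex hf).restrictScalars ℝ))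
  rw [levi_eq_of_hasFDerivAt h1 h2]
  have hB : ∀ v w : Fin n → ℂ, fderiv ℂ (fderiv ℂ f) a (Complex.I • v) w
      = Complex.I • fderiv ℂ (fderiv ℂ f) a v w := fun v w => by
    rw [map_smul, smul_apply]
  have hR : ∀ (L : (Fin n → ℂ) →L[ℂ] (Fin n → ℂ)) w,
      ContinuousLinearMap.restrictScalarsL ℂ (Fin n → ℂ) (Fin n → ℂ) ℝ ℝ L w = L w :=
    fun L w => rfl
  simp only [levi, add_apply, ContinuousLinearMap.comp_apply, Function.comp,
    ContinuousLinearMap.compL_apply, ContinuousLinearMap.flip_apply,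
    ContinuousLinearMap.coe_restrictScalars', hR, hB, map_smul (fderiv ℂ f a), map_smul (fderiv ℂ (fderiv ℂ f) a _)]
  have h3 : Complex.I • Complex.I • fderiv ℂ (fderiv ℂ f) a v w
      = -fderiv ℂ (fderiv ℂ f) a v w := by
    rw [smul_smul, Complex.I_mul_I, neg_one_smul]
  rw [h3, map_neg]
  push_cast
  ring

/-- The `(1,0)`-derivative of a real function. -/
def dbarConj (u : (Fin n → ℂ) → ℝ) (a v : Fin n → ℂ) : ℂ :=
  ((fderiv ℝ u a v : ℝ) - Complex.I * (fderiv ℝ u a (Complex.I • v) : ℝ)) / 2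

theorem levi_log {u : (Fin n → ℂ) → ℝ} {a : Fin n → ℂ}
    (hu : ContDiffAt ℝ 2 u a) (h0 : u a ≠ 0) (v w : Fin n → ℂ) :
    levi (fun x => Real.log (u x)) a v w = levi u a v w / u a
      - dbarConj u a v * (starRingEnd ℂ) (dbarConj u a w) / u a ^ 2 := by
  have hua : HasFDerivAt u (fderiv ℝ u a) a := (hu.differentiableAt (by simp)).hasFDerivAt
  have h1 : ∀ᶠ x in 𝓝 a, HasFDerivAt (fun x => Real.log (u x)) ((u x)⁻¹ • fderiv ℝ u x) x := by
    filter_upwards [eventually_hasFDerivAt hu, hu.continuousAt.eventually_ne h0] with x h1 h2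
    exact h1.log h2
  have h2 := ((hasDerivAt_inv h0).comp_hasFDerivAt a hua).smul (hasFDerivAt_fderiv hu)
  rw [levi_eq_of_hasFDerivAt h1 h2]
  have h0' : (u a : ℂ) ≠ 0 := by exact_mod_cast h0
  simp only [levi, dbarConj, add_apply, smul_apply, ContinuousLinearMap.smulRight_apply,
    Function.comp, smul_eq_mul, map_div₀, map_sub, map_mul, Complex.conj_I, Complex.conj_ofReal,
    map_ofNat]
  push_cast
  field_simp
  ring_nf
  simp only [Complex.I_sq]
  ring

theorem hasFDerivAt_normSq {f : (Fin n → ℂ) → ℂ} {f' : (Fin n → ℂ) →L[ℂ] ℂ} {a : Fin n → ℂ}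
    (hf : HasFDerivAt f f' a) : HasFDerivAt (fun x => ‖f x‖ ^ 2)
      ((2 : ℝ) • (Complex.reCLM.comp
        ((starRingEnd ℂ (f a) • f').restrictScalars ℝ))) a := by
  have h := (hf.restrictScalars ℝ).norm_sq
  refine h.congr_fderiv ?_
  ext v
  simp [mul_comm, mul_add]

theorem dbarConj_normSq {f : (Fin n → ℂ) → ℂ} {f' : (Fin n → ℂ) →L[ℂ] ℂ} {a : Fin n → ℂ}
    (hf : HasFDerivAt f f' a) (v : Fin n → ℂ) :
    dbarConj (fun x => ‖f x‖ ^ 2) a v = starRingEnd ℂ (f a) * f' v := by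
  rw [dbarConj, (hasFDerivAt_normSq hf).fderiv]
  apply Complex.ext <;> simp <;> ring

theorem dbarConj_sum {ι : Type*} (s : Finset ι) {u : ι → (Fin n → ℂ) → ℝ} {a : Fin n → ℂ}
    (hu : ∀ i ∈ s, DifferentiableAt ℝ (u i) a) (v : Fin n → ℂ) :
    dbarConj (fun x => ∑ i ∈ s, u i x) a v = ∑ i ∈ s, dbarConj (u i) a v := by
  simp only [dbarConj]
  rw [fderiv_fun_sum hu]
  simp only [sum_apply, Complex.ofReal_sum, Finset.mul_sum,
    ← Finset.sum_sub_distrib, Finset.sum_div]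

theorem levi_normSq {f : (Fin n → ℂ) → ℂ} {a : Fin n → ℂ} (hf : ContDiffAt ℂ 2 f a)
    (v w : Fin n → ℂ) :
    levi (fun x => ‖f x‖ ^ 2) a v w = fderiv ℂ f a v * starRingEnd ℂ (fderiv ℂ f a w) := by
  have hfa : HasFDerivAt f (fderiv ℂ f a) a := (hf.differentiableAt (by simp)).hasFDerivAt
  have hg : ∀ᶠ x in 𝓝 a, HasFDerivAt (fun x => ‖f x‖ ^ 2)
      ((2 : ℝ) • (Complex.reCLM.comp
        ((starRingEnd ℂ (f x) • fderiv ℂ f x).restrictScalars ℝ))) x :=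
    (eventually_hasFDerivAt_complex hf).mono fun x hx => hasFDerivAt_normSq hx
  have hc : HasFDerivAt (fun x => starRingEnd ℂ (f x))
      ((Complex.conjCLE : ℂ →L[ℝ] ℂ).comp ((fderiv ℂ f a).restrictScalars ℝ)) a :=
    Complex.conjCLE.hasFDerivAt.comp a (hfa.restrictScalars ℝ)
  let T : ((Fin n → ℂ) →L[ℂ] ℂ) →L[ℝ] ((Fin n → ℂ) →L[ℝ] ℝ) :=
    (2 : ℝ) • (ContinuousLinearMap.compL ℝ (Fin n → ℂ) ℂ ℝ Complex.reCLM).comp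
      (ContinuousLinearMap.restrictScalarsL ℂ (Fin n → ℂ) ℂ ℝ ℝ)
  have hD := T.hasFDerivAt.comp a (hc.smul ((hasFDerivAt_fderiv_complex hf).restrictScalars ℝ))
  rw [levi_eq_of_hasFDerivAt hg hD]
  have hB : ∀ v w : Fin n → ℂ, fderiv ℂ (fderiv ℂ f) a (Complex.I • v) w
      = Complex.I * fderiv ℂ (fderiv ℂ f) a v w := fun v w => by
    rw [map_smul, smul_apply, smul_eq_mul]
  have hT : ∀ (L : (Fin n → ℂ) →L[ℂ] ℂ) w, T L w = 2 * (L w).re := fun L w => rfl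
  simp only [ContinuousLinearMap.comp_apply, hT, add_apply, smul_apply,
    ContinuousLinearMap.smulRight_apply, ContinuousLinearMap.coe_restrictScalars', smul_eq_mul,
    ContinuousLinearEquiv.coe_coe, Complex.conjCLE_apply, hB, map_smul (fderiv ℂ f a),
    map_smul (fderiv ℂ (fderiv ℂ f) a _)]
  apply Complex.ext <;> simp <;> ring

/-- A smooth function on a convex open set whose complex Hessian vanishes is the real part of an
analytic function. -/
theorem exists_re_eq_of_levi_eq_zero {u : (Fin n → ℂ) → ℝ} {U : Set (Fin n → ℂ)} (hU : IsOpen U)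
    (hc : Convex ℝ U) (hu : ContDiffOn ℝ ∞ u U) (h0 : ∀ a ∈ U, levi u a = 0) :
    ∃ F : (Fin n → ℂ) → ℂ, ContDiffOn ℂ ω F U ∧ ∀ a ∈ U, u a = (F a).re := by
  rcases U.eq_empty_or_nonempty with rfl | ⟨a₀, ha₀⟩
  · exact ⟨0, by simp [ContDiffOn], by simp⟩
  have hua : ∀ a ∈ U, ContDiffAt ℝ 2 u a := fun a ha =>
    (hu.contDiffAt (hU.mem_nhds ha)).of_le (by norm_cast)
  let T : ((Fin n → ℂ) →L[ℝ] ℝ) →L[ℝ] ((Fin n → ℂ) →L[ℂ] ℂ) :=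
    (2 : ℝ) • (complexLinearPart (Fin n → ℂ) ℂ).comp
      (ContinuousLinearMap.compL ℝ (Fin n → ℂ) ℝ ℂ Complex.ofRealCLM)
  have hT : ∀ (A : (Fin n → ℂ) →L[ℝ] ℝ) v, T A v = A v - Complex.I * A (Complex.I • v) := by
    intro A v
    change (2 : ℝ) • ((2 : ℂ)⁻¹ • ((A v : ℂ) - Complex.I • (A (Complex.I • v) : ℂ))) = _
    rw [Complex.real_smul, smul_eq_mul, smul_eq_mul]
    push_cast
    ring
  have hfd : ContDiffOn ℝ ∞ (fun x => T (fderiv ℝ u x)) U :=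
    T.contDiff.comp_contDiffOn (hu.fderiv_of_isOpen hU (m := ∞) (by simp))
  obtain ⟨F, hF⟩ := hc.exists_forall_hasFDerivAt_of_fderiv_symmetric hU
    (hfd.differentiableOn (by simp)) (by
      intro a ha x y
      have hTd : HasFDerivAt (fun x => T (fderiv ℝ u x)) (T.comp (fderiv ℝ (fderiv ℝ u) a)) a :=
        T.hasFDerivAt.comp a (hasFDerivAt_fderiv (hua a ha))
      rw [hTd.fderiv]
      have hsymm : ∀ v w, fderiv ℝ (fderiv ℝ u) a v w = fderiv ℝ (fderiv ℝ u) a w v := fun v w =>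
        ((hua a ha).isSymmSndFDerivAt (by simp)).eq v w
      have him : ∀ v w, fderiv ℝ (fderiv ℝ u) a v (Complex.I • w)
          = fderiv ℝ (fderiv ℝ u) a (Complex.I • v) w := by
        intro v w
        have := congrArg Complex.im (congrFun (congrFun (h0 a ha) v) w)
        simp [levi] at this
        linarith
      simp only [ContinuousLinearMap.comp_apply, hT]
      rw [hsymm x y, him x y, hsymm _ y])
  have hFd : DifferentiableOn ℂ F U := fun a ha => (hF a ha).differentiableAt.differentiableWithinAt
  have hFs : ContDiffOn ℝ ∞ F U := by
    rw [contDiffOn_infty_iff_fderiv_of_isOpen hU]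
    refine ⟨fun a ha =>
      ((hF a ha).restrictScalars ℝ).differentiableAt.differentiableWithinAt, ?_⟩
    refine ((ContinuousLinearMap.restrictScalarsL ℂ (Fin n → ℂ) ℂ ℝ ℝ).contDiff.comp_contDiffOn
      hfd).congr fun a ha => ?_
    exact ((hF a ha).restrictScalars ℝ).fderiv
  have hFw := contDiffOn_omega_of_real hU hFs hFd
  have hdiff : ∀ a ∈ U, HasFDerivAt (fun x => u x - (F x).re) (0 : (Fin n → ℂ) →L[ℝ] ℝ) a := by
    intro a ha
    have h1 := ((hua a ha).differentiableAt (by simp)).hasFDerivAt.sub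
      (Complex.reCLM.hasFDerivAt.comp a ((hF a ha).restrictScalars ℝ))
    refine h1.congr_fderiv ?_
    ext v
    simp [hT]
  refine ⟨fun x => F x + ((u a₀ - (F a₀).re : ℝ) : ℂ), hFw.add contDiffOn_const, fun a ha => ?_⟩
  have := hc.is_const_of_fderivWithin_eq_zero (𝕜 := ℝ) (f := fun x => u x - (F x).re)
    (fun x hx => (hdiff x hx).differentiableAt.differentiableWithinAt)
    (fun x hx => by
      rw [fderivWithin_of_isOpen hU hx, (hdiff x hx).fderiv]) ha ha₀
  simp only [Complex.add_re, Complex.ofReal_re]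
  linarith

end Levi

end

noncomputable section

/-! ### Charts of the blow-up -/

namespace BlowUp

variable {n : ℕ}

theorem dir_apply (i j : Fin n) (w : Fin n → ℂ) : dir i w j = if j = i then 1 else w j := by
  by_cases h : j = i
  · subst h; simp [dir_same]
  · simp [dir, h]

theorem contDiff_dir (i j : Fin n) {m : ℕ∞ω} : ContDiff ℂ m fun w : Fin n → ℂ => dir i w j := by
  by_cases h : j = i
  · simp only [dir_apply, h, if_true]
    exact contDiff_const
  · simp only [dir_apply, h, if_false]
    fun_prop

/-- The squared norm `1 + ∑_{j ≠ i} |wⱼ|²` of the homogeneous coordinates in the `i`-th chart. -/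
def dirSq (i : Fin n) (w : Fin n → ℂ) : ℝ := ∑ j, ‖dir i w j‖ ^ 2

theorem one_le_dirSq (i : Fin n) (w : Fin n → ℂ) : 1 ≤ dirSq i w := by
  have := Finset.single_le_sum (f := fun j => ‖dir i w j‖ ^ 2) (fun j _ => by positivity)
    (Finset.mem_univ i)
  rw [dir_same, norm_one, one_pow] at this
  exact this

theorem dirSq_pos (i : Fin n) (w : Fin n → ℂ) : 0 < dirSq i w :=
  one_pos.trans_le (one_le_dirSq i w)

theorem continuous_dirSq (i : Fin n) : Continuous (dirSq i) := by
  unfold dirSq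
  exact continuous_finsetSum _ fun j _ => ((contDiff_dir i j (m := 0)).continuous.norm.pow 2)

theorem localPotential_eq (i : Fin n) (w : Fin n → ℂ) :
    localPotential i w = ‖w i‖ ^ 2 * dirSq i w + Real.log (dirSq i w) := rfl

theorem contDiff_localPotential_infty (i : Fin n) : ContDiff ℝ ∞ (localPotential i) := by
  have hs : ContDiff ℝ ∞ fun w : Fin n → ℂ => dirSq i w :=
    ContDiff.sum fun k _ => ((contDiff_dir i k).restrict_scalars ℝ).norm_sq ℝ
  exact (((contDiff_apply ℝ ℂ i).norm_sq ℝ).mul hs).add (hs.log fun w => (dirSq_pos i w).ne')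

theorem param_mem_source (i j : Fin n) (w : Fin n → ℂ) :
    param i w ∈ (chart j).source ↔ dir i w j ≠ 0 :=
  rep_mk_ne_zero _ (dir_ne_zero i w) j

theorem ratio_param (i j k : Fin n) (w : Fin n → ℂ) :
    ratio j k (param i w).1.2 = dir i w k / dir i w j := by
  simp only [param]
  exact ratio_mk _ (dir_ne_zero i w) j k

theorem coord_param_apply (i j k : Fin n) (w : Fin n → ℂ) : coord j (param i w) k
    = if k = j then w i * dir i w j else dir i w k / dir i w j := by
  by_cases h : k = j
  · subst h
    simp [coord, param]
  · simp [coord, h, ratio_param]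

theorem contDiffOn_coord_param (i j : Fin n) :
    ContDiffOn ℂ ω (fun w => coord j (param i w)) {w | dir i w j ≠ 0} := by
  rw [contDiffOn_pi]
  intro k
  simp only [coord_param_apply]
  split_ifs
  · exact ((contDiff_apply ℂ ℂ i).mul (contDiff_dir i j)).contDiffOn
  · exact (contDiff_dir i k).contDiffOn.div (contDiff_dir i j).contDiffOn fun w hw => hw

theorem isOpen_dir_ne_zero (i j : Fin n) : IsOpen {w : Fin n → ℂ | dir i w j ≠ 0} :=
  isOpen_ne_fun (contDiff_dir i j (m := 0)).continuous continuous_const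

instance isManifold_real : IsManifold 𝓘(ℝ, Fin n → ℂ) ∞ (BlowUp n) := by
  refine isManifold_of_contDiffOn _ _ _ ?_
  rintro _ _ ⟨i, rfl⟩ ⟨j, rfl⟩
  refine (((contDiffOn_coord_param i j).restrict_scalars ℝ).of_le le_top).mono ?_
  intro w hw
  have hw' := hw.1
  simp only [mfld_simps] at hw'
  exact (param_mem_source i j w).1 hw'.2

theorem chart_mem_atlas (i : Fin n) : chart i ∈ atlas (Fin n → ℂ) (BlowUp n) := mem_range_self i

theorem contMDiff_param (i : Fin n) : ContMDiff 𝓘(ℂ, Fin n → ℂ) 𝓘(ℂ, Fin n → ℂ) ω (param i) := by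
  have := contMDiffOn_symm_of_mem_maximalAtlas (I := 𝓘(ℂ, Fin n → ℂ)) (n := ω)
    (IsManifold.subset_maximalAtlas (chart_mem_atlas i))
  exact contMDiffOn_univ.1 this

theorem contMDiff_param_real (i : Fin n) :
    ContMDiff 𝓘(ℝ, Fin n → ℂ) 𝓘(ℝ, Fin n → ℂ) ∞ (param i) := by
  have := contMDiffOn_symm_of_mem_maximalAtlas (I := 𝓘(ℝ, Fin n → ℂ)) (n := ∞)
    (IsManifold.subset_maximalAtlas (chart_mem_atlas i))
  exact contMDiffOn_univ.1 this

theorem contMDiffOn_coord (i : Fin n) :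
    ContMDiffOn 𝓘(ℂ, Fin n → ℂ) 𝓘(ℂ, Fin n → ℂ) ω (coord i) (chart i).source :=
  contMDiffOn_of_mem_maximalAtlas (I := 𝓘(ℂ, Fin n → ℂ)) (n := ω)
    (IsManifold.subset_maximalAtlas (chart_mem_atlas i))

theorem contMDiffOn_coord_real (i : Fin n) :
    ContMDiffOn 𝓘(ℝ, Fin n → ℂ) 𝓘(ℝ, Fin n → ℂ) ∞ (coord i) (chart i).source :=
  contMDiffOn_of_mem_maximalAtlas (I := 𝓘(ℝ, Fin n → ℂ)) (n := ∞)
    (IsManifold.subset_maximalAtlas (chart_mem_atlas i))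

theorem dirSq_coord_param (i j : Fin n) (w : Fin n → ℂ) (h : dir i w j ≠ 0) :
    dirSq j (coord j (param i w)) = dirSq i w / ‖dir i w j‖ ^ 2 := by
  rw [dirSq, dirSq, Finset.sum_div]
  refine Finset.sum_congr rfl fun k _ => ?_
  rw [dir_apply, coord_param_apply]
  split_ifs with hk
  · subst hk
    rw [norm_one, one_pow, div_self]
    exact pow_ne_zero _ (norm_ne_zero_iff.2 h)
  · rw [norm_div, div_pow]

theorem localPotential_coord_param (i j : Fin n) (w : Fin n → ℂ) (h : dir i w j ≠ 0) :
    localPotential j (coord j (param i w)) = localPotential i w - Real.log (‖dir i w j‖ ^ 2) := by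
  have h' : ‖dir i w j‖ ≠ 0 := norm_ne_zero_iff.2 h
  rw [localPotential_eq, localPotential_eq, dirSq_coord_param i j w h, coord_param_apply,
    if_pos rfl, norm_mul, Real.log_div (dirSq_pos i w).ne' (pow_ne_zero _ h')]
  field_simp
  ring

theorem levi_sub_log_normSq {u : (Fin n → ℂ) → ℝ} {f : (Fin n → ℂ) → ℂ} {a : Fin n → ℂ}
    (hu : ContDiffAt ℝ 2 u a) (hf : ContDiffAt ℂ 2 f a) (h : f a ≠ 0) :
    levi (fun w => u w - Real.log (‖f w‖ ^ 2)) a = levi u a := by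
  have hF : ContDiffAt ℂ 2
      (fun w => -(2 * Complex.log (f w / f a) + Complex.log ((‖f a‖ ^ 2 : ℝ) : ℂ))) a := by
    have hlog : ContDiffAt ℂ 2 Complex.log (f a / f a) :=
      Complex.contDiffAt_log (by simp [div_self h])
    exact ((contDiffAt_const.mul (ContDiffAt.comp a hlog (hf.div_const _))).add
      contDiffAt_const).neg
  rw [← levi_add_re hu hF]
  apply levi_congr
  filter_upwards [hf.continuousAt.eventually_ne h] with w hw
  have hw' : 0 < ‖f w‖ := norm_pos_iff.2 hw
  have ha' : 0 < ‖f a‖ := norm_pos_iff.2 h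
  simp only [← Complex.ofReal_log (sq_nonneg _), Complex.neg_re, Complex.add_re, Complex.ofReal_re]
  rw [show (2 : ℂ) = ((2 : ℝ) : ℂ) by norm_num, Complex.re_ofReal_mul, Complex.log_re, norm_div,
    Real.log_div hw'.ne' ha'.ne', Real.log_pow, Real.log_pow]
  push_cast
  ring

theorem ddbar_congr {u v : BlowUp n → ℝ} {x : BlowUp n} (h : u =ᶠ[𝓝 x] v) :
    ddbar (n := n) u x = ddbar (n := n) v x := by
  apply levi_congr
  have hc : Tendsto (param (idx x)) (𝓝 (coord (idx x) x)) (𝓝 x) := by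
    have := (continuous_param (idx x)).tendsto (coord (idx x) x)
    rwa [param_coord _ _ (mem_affine_idx x)] at this
  exact hc.eventually h

theorem dir_coord_ne_zero {i j : Fin n} {x : BlowUp n} (hi : x ∈ (chart i).source)
    (hj : x ∈ (chart j).source) : dir i (coord i x) j ≠ 0 := by
  rw [← param_mem_source, param_coord _ _ hi]
  exact hj

theorem ddbar_localPotential (i : Fin n) {x : BlowUp n} (hx : x ∈ (chart i).source) (c : ℝ) :
    ddbar (fun p => c * localPotential i (coord i p)) x = (c : ℂ) • simanca n x := by
  set j := idx x with hj
  have hxj : x ∈ (chart j).source := mem_affine_idx x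
  have hne : dir j (coord j x) i ≠ 0 := dir_coord_ne_zero hxj hx
  change levi ((fun p => c * localPotential i (coord i p)) ∘ param j) (coord j x)
    = (c : ℂ) • levi (localPotential j) (coord j x)
  have hC := (contDiff_localPotential j).contDiffAt (x := coord j x)
  have hD := (contDiff_dir (m := 2) j i).contDiffAt (x := coord j x)
  rw [← levi_sub_log_normSq hC hD hne, ← levi_const_mul]
  · apply levi_congr
    filter_upwards [(isOpen_dir_ne_zero j i).mem_nhds hne] with w hw
    simp only [Function.comp, localPotential_coord_param j i w hw]
  · refine hC.sub (((hD.restrict_scalars ℝ).norm_sq ℝ).log ?_)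
    exact pow_ne_zero _ (norm_ne_zero_iff.2 hne)

theorem contDiffAt_comp_param {u : BlowUp n → ℝ} {x : BlowUp n} {i : Fin n}
    (hx : x ∈ (chart i).source) (hu : ContMDiffAt 𝓘(ℝ, Fin n → ℂ) 𝓘(ℝ, ℝ) ∞ u x) :
    ContDiffAt ℝ ∞ (u ∘ param i) (coord i x) := by
  rw [← contMDiffAt_iff_contDiffAt]
  refine ContMDiffAt.comp (coord i x) ?_ (contMDiff_param_real i).contMDiffAt
  rwa [param_coord _ _ hx]

theorem levi_comp_param_eq_zero {u : BlowUp n → ℝ} {x : BlowUp n} {i : Fin n}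
    (hx : x ∈ (chart i).source) (hu : ContMDiffAt 𝓘(ℝ, Fin n → ℂ) 𝓘(ℝ, ℝ) ∞ u x)
    (h : ddbar (n := n) u x = 0) : levi (u ∘ param i) (coord i x) = 0 := by
  set j := idx x with hj
  have hxj : x ∈ (chart j).source := mem_affine_idx x
  have hne : dir i (coord i x) j ≠ 0 := dir_coord_ne_zero hx hxj
  have hpc : coord j (param i (coord i x)) = coord j x := by rw [param_coord _ _ hx]
  have hev : u ∘ param i =ᶠ[𝓝 (coord i x)] (u ∘ param j) ∘ (fun w => coord j (param i w)) := by
    filter_upwards [(isOpen_dir_ne_zero i j).mem_nhds hne] with w hw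
    simp only [Function.comp]
    rw [param_coord j _ ((param_mem_source i j w).2 hw)]
  rw [levi_congr hev]
  funext v w
  rw [levi_comp]
  · simp only [hpc]
    change ddbar (n := n) u x _ _ = _
    rw [h]
    rfl
  · simp only [hpc]
    exact (contDiffAt_comp_param hxj hu).of_le (by norm_cast)
  · exact ((contDiffOn_coord_param i j).contDiffAt ((isOpen_dir_ne_zero i j).mem_nhds hne)).of_le
      le_top

end BlowUp

end

noncomputable section

/-! ### Holomorphic maps into `ℓ²` -/

namespace EllTwo

theorem hasSum_norm_sq (x : EllTwo) : HasSum (fun k => ‖x k‖ ^ 2) (‖x‖ ^ 2) := by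
  have := lp.hasSum_norm (p := 2) (by norm_num) x
  simpa using this

theorem memℓp_of_summable {f : ℕ → ℂ} (h : Summable fun k => ‖f k‖ ^ 2) :
    Memℓp (E := fun _ : ℕ => ℂ) f 2 := by
  refine memℓp_gen ?_
  simpa using h

theorem hasSum_norm_sq_expVec (z : ℂ) :
    HasSum (fun k : ℕ => ‖z ^ k / (Real.sqrt k.factorial : ℂ)‖ ^ 2) (Real.exp (‖z‖ ^ 2)) := by
  have := NormedSpace.expSeries_div_hasSum_exp (‖z‖ ^ 2)
  rw [← Real.exp_eq_exp_ℝ] at this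
  convert! this using 2 with k
  rw [norm_div, norm_pow, div_pow, Complex.norm_real, Real.norm_of_nonneg (Real.sqrt_nonneg _),
    Real.sq_sqrt (by positivity), ← pow_mul, ← pow_mul, mul_comm]

/-- The coherent vector `(zᵏ / √k!)ₖ`. -/
def expVec (z : ℂ) : EllTwo :=
  ⟨fun k => z ^ k / (Real.sqrt k.factorial : ℂ),
    memℓp_of_summable (hasSum_norm_sq_expVec z).summable⟩

theorem norm_sq_expVec (z : ℂ) : ‖expVec z‖ ^ 2 = Real.exp (‖z‖ ^ 2) :=
  (hasSum_norm_sq (expVec z)).unique (hasSum_norm_sq_expVec z)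

theorem differentiable_expVec : Differentiable ℂ expVec := by
  have hsum : expVec = fun z => ∑' k : ℕ, lp.single (E := fun _ : ℕ => ℂ) 2 k (expVec z k) := by
    funext z
    exact (lp.hasSum_single (by norm_num) (expVec z)).tsum_eq.symm
  intro z
  set R : ℝ := ‖z‖ + 1
  have hR : 0 < R := by positivity
  have hu : Summable fun k : ℕ => Real.sqrt (Real.exp ((2 * R) ^ 2)) * (1 / 2 : ℝ) ^ k :=
    (summable_geometric_of_lt_one (by norm_num) (by norm_num)).mul_left _
  have hd : DifferentiableOn ℂ
      (fun z => ∑' k : ℕ, lp.single (E := fun _ : ℕ => ℂ) 2 k (expVec z k)) (Metric.ball 0 R) := by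
    refine Complex.differentiableOn_tsum_of_summable_norm hu (fun k => ?_) Metric.isOpen_ball
      fun k w hw => ?_
    · have h1 : Differentiable ℂ fun z : ℂ => z ^ k / (Real.sqrt k.factorial : ℂ) := by fun_prop
      exact ((lp.singleContinuousLinearMap ℂ (fun _ : ℕ => ℂ) 2 k).differentiable.comp
        h1).differentiableOn
    · rw [lp.norm_single (by norm_num)]
      change ‖w ^ k / (Real.sqrt k.factorial : ℂ)‖ ≤ _
      rw [norm_div, norm_pow, Complex.norm_real, Real.norm_of_nonneg (Real.sqrt_nonneg _)]
      have hw' : ‖w‖ ≤ R := (mem_ball_zero_iff.1 hw).le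
      have h2 : (2 * R) ^ k / Real.sqrt k.factorial ≤ Real.sqrt (Real.exp ((2 * R) ^ 2)) := by
        have h3 := Real.pow_div_factorial_le_exp ((2 * R) ^ 2) (by positivity) k
        calc (2 * R) ^ k / Real.sqrt k.factorial
            = Real.sqrt (((2 * R) ^ 2) ^ k / k.factorial) := by
              rw [Real.sqrt_div' _ (by positivity), ← pow_mul, mul_comm 2 k, pow_mul,
                Real.sqrt_sq (by positivity)]
          _ ≤ _ := Real.sqrt_le_sqrt h3
      calc ‖w‖ ^ k / Real.sqrt k.factorial ≤ R ^ k / Real.sqrt k.factorial := by gcongr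
        _ = (2 * R) ^ k / Real.sqrt k.factorial * (1 / 2) ^ k := by
            rw [mul_pow, one_div, inv_pow]
            field_simp
        _ ≤ _ := by gcongr
  rw [hsum]
  refine (hd z ?_).differentiableAt (Metric.isOpen_ball.mem_nhds ?_) <;> simp [R]

theorem contDiff_expVec {m : ℕ∞ω} : ContDiff ℂ m expVec := differentiable_expVec.contDiff

theorem hasSum_norm_sq_tensor (x y : EllTwo) :
    HasSum (fun k : ℕ => ‖x k.unpair.1 * y k.unpair.2‖ ^ 2) (‖x‖ ^ 2 * ‖y‖ ^ 2) := by
  have h := (hasSum_norm_sq x).mul (hasSum_norm_sq y)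
    ((hasSum_norm_sq x).summable.mul_of_nonneg (hasSum_norm_sq y).summable
      (fun _ => by positivity) (fun _ => by positivity))
  have h2 := (Nat.pairEquiv.symm.hasSum_iff).2 h
  refine h2.congr_fun fun k => ?_
  rw [norm_mul, mul_pow]
  rfl

/-- The sequence of the products of the entries of two square summable sequences. -/
def tensorVec (x y : EllTwo) : EllTwo :=
  ⟨fun k : ℕ => x k.unpair.1 * y k.unpair.2,
    memℓp_of_summable (hasSum_norm_sq_tensor x y).summable⟩

theorem tensorVec_apply (x y : EllTwo) (k : ℕ) :
    tensorVec x y k = x k.unpair.1 * y k.unpair.2 := rfl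

theorem norm_sq_tensorVec (x y : EllTwo) : ‖tensorVec x y‖ ^ 2 = ‖x‖ ^ 2 * ‖y‖ ^ 2 :=
  (hasSum_norm_sq (tensorVec x y)).unique (hasSum_norm_sq_tensor x y)

/-- The tensor product as a bilinear map. -/
def tensorBilin : EllTwo →ₗ[ℂ] EllTwo →ₗ[ℂ] EllTwo :=
  LinearMap.mk₂ ℂ tensorVec
    (fun x x' y => by
      ext k; simp only [tensorVec_apply, lp.coeFn_add, Pi.add_apply, add_mul])
    (fun c x y => by
      ext k; simp only [tensorVec_apply, lp.coeFn_smul, Pi.smul_apply, smul_eq_mul, mul_assoc])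
    (fun x y y' => by
      ext k; simp only [tensorVec_apply, lp.coeFn_add, Pi.add_apply, mul_add])
    (fun c x y => by
      ext k; simp only [tensorVec_apply, lp.coeFn_smul, Pi.smul_apply, smul_eq_mul, mul_left_comm])

/-- The tensor product `ℓ² × ℓ² → ℓ²` of square summable sequences. -/
def tensor : EllTwo →L[ℂ] EllTwo →L[ℂ] EllTwo :=
  tensorBilin.mkContinuous₂ 1 fun x y => by
    rw [one_mul]
    refine le_of_sq_le_sq ?_ (by positivity)
    rw [mul_pow]
    exact (norm_sq_tensorVec x y).le

theorem norm_sq_tensor (x y : EllTwo) : ‖tensor x y‖ ^ 2 = ‖x‖ ^ 2 * ‖y‖ ^ 2 :=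
  norm_sq_tensorVec x y

/-- The isometric embedding of a finite dimensional unitary space. -/
def incl (n : ℕ) : (Fin n → ℂ) →L[ℂ] EllTwo :=
  ∑ k : Fin n, (lp.singleContinuousLinearMap ℂ (fun _ : ℕ => ℂ) 2 (k : ℕ)).comp
    (ContinuousLinearMap.proj k)

theorem norm_sq_incl {n : ℕ} (t : Fin n → ℂ) : ‖incl n t‖ ^ 2 = ∑ k, ‖t k‖ ^ 2 := by
  let f : ℕ → ℂ := fun k => if h : k < n then t ⟨k, h⟩ else 0
  have h1 : incl n t = ∑ k ∈ Finset.range n, lp.single (E := fun _ : ℕ => ℂ) 2 k (f k) := by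
    rw [Finset.sum_range]
    simp [incl, f, sum_apply]
  have h2 := lp.norm_sum_single (E := fun _ : ℕ => ℂ) (p := 2) (by norm_num) f (Finset.range n)
  rw [h1]
  simp only [ENNReal.toReal_ofNat, Real.rpow_ofNat] at h2
  rw [h2, Finset.sum_range]
  simp [f]

/-- The `m`-th tensor power of a vector. -/
def tensorPow (x : EllTwo) : ℕ → EllTwo
  | 0 => lp.single (E := fun _ : ℕ => ℂ) 2 0 1
  | m + 1 => tensor x (tensorPow x m)

theorem norm_sq_tensorPow (x : EllTwo) (m : ℕ) : ‖tensorPow x m‖ ^ 2 = (‖x‖ ^ 2) ^ m := by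
  induction m with
  | zero => simp [tensorPow, lp.norm_single]
  | succ m ih => rw [tensorPow, norm_sq_tensor, ih, pow_succ (‖x‖ ^ 2), mul_comm]

theorem tensorPow_smul (c : ℂ) (x : EllTwo) (m : ℕ) :
    tensorPow (c • x) m = c ^ m • tensorPow x m := by
  induction m with
  | zero => simp [tensorPow]
  | succ m ih => simp only [tensorPow, ih, map_smul, smul_apply, smul_smul, pow_succ]

theorem contDiff_tensorPow {E : Type*} [NormedAddCommGroup E] [NormedSpace ℂ E] {k : ℕ∞ω}
    {f : E → EllTwo} (hf : ContDiff ℂ k f) (m : ℕ) : ContDiff ℂ k fun x => tensorPow (f x) m := by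
  induction m with
  | zero => exact contDiff_const
  | succ m ih => exact (tensor.contDiff.comp hf).clm_apply ih

/-- The tensor product of the coherent vectors of a list of numbers with a given vector. -/
def tensorExp (l : List ℂ) (x : EllTwo) : EllTwo := l.foldr (fun z y => tensor (expVec z) y) x

theorem norm_sq_tensorExp (l : List ℂ) (x : EllTwo) :
    ‖tensorExp l x‖ ^ 2 = Real.exp (l.map fun z => ‖z‖ ^ 2).sum * ‖x‖ ^ 2 := by
  induction l with
  | nil => simp [tensorExp]
  | cons z l ih =>
    rw [tensorExp, List.foldr_cons, norm_sq_tensor, norm_sq_expVec, List.map_cons, List.sum_cons,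
      Real.exp_add, mul_assoc, ← ih]
    rfl

theorem tensorExp_smul (l : List ℂ) (c : ℂ) (x : EllTwo) :
    tensorExp l (c • x) = c • tensorExp l x := by
  induction l with
  | nil => rfl
  | cons z l ih =>
    rw [tensorExp, List.foldr_cons]
    change tensor (expVec z) (tensorExp l (c • x)) = _
    rw [ih, map_smul]
    rfl

theorem contDiff_tensorExp {E : Type*} [NormedAddCommGroup E] [NormedSpace ℂ E] {k : ℕ∞ω}
    {α : Type*} (l : List α) {z : α → E → ℂ} (hz : ∀ a, ContDiff ℂ k (z a)) {f : E → EllTwo}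
    (hf : ContDiff ℂ k f) : ContDiff ℂ k fun x => tensorExp (l.map fun a => z a x) (f x) := by
  induction l with
  | nil => exact hf
  | cons a l ih => exact (tensor.contDiff.comp (contDiff_expVec.comp (hz a))).clm_apply ih

end EllTwo

namespace BlowUp

open EllTwo

variable {n : ℕ}

/-- A vector of squared norm `exp (m |z|²) |t|^{2m}`, holomorphic in `z` and `t` and homogeneous of
degree `m` in `t`. -/
def cohVec (m : ℕ) (z t : Fin n → ℂ) : EllTwo :=
  tensorExp ((List.finRange n).map fun k => (Real.sqrt m : ℂ) * z k) (tensorPow (incl n t) m)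

theorem norm_sq_cohVec (m : ℕ) (z t : Fin n → ℂ) :
    ‖cohVec m z t‖ ^ 2 = Real.exp (m * ∑ k, ‖z k‖ ^ 2) * (∑ k, ‖t k‖ ^ 2) ^ m := by
  rw [cohVec, norm_sq_tensorExp, norm_sq_tensorPow, norm_sq_incl, List.map_map,
    ← Fin.sum_univ_def, Finset.mul_sum]
  congr 3
  funext k
  simp [mul_pow]

theorem cohVec_smul (m : ℕ) (c : ℂ) (z t : Fin n → ℂ) :
    cohVec m z (c • t) = c ^ m • cohVec m z t := by
  rw [cohVec, map_smul, tensorPow_smul, tensorExp_smul, cohVec]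

theorem contDiff_cohVec (m : ℕ) {E : Type*} [NormedAddCommGroup E] [NormedSpace ℂ E] {k : ℕ∞ω}
    {z t : E → Fin n → ℂ} (hz : ContDiff ℂ k z) (ht : ContDiff ℂ k t) :
    ContDiff ℂ k fun x => cohVec m (z x) (t x) :=
  contDiff_tensorExp (List.finRange n)
    (fun j => contDiff_const.mul ((contDiff_apply ℂ ℂ j).comp hz))
    (contDiff_tensorPow ((incl n).contDiff.comp ht) m)

theorem cohVec_ne_zero (m : ℕ) {z t : Fin n → ℂ} (ht : t ≠ 0) : cohVec m z t ≠ 0 := by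
  obtain ⟨j, hj⟩ := Function.ne_iff.1 ht
  have h1 : 0 < ∑ k, ‖t k‖ ^ 2 := Finset.sum_pos' (fun k _ => by positivity)
    ⟨j, Finset.mem_univ j, pow_pos (norm_pos_iff.2 hj) 2⟩
  have h2 : 0 < ‖cohVec m z t‖ ^ 2 := by
    rw [norm_sq_cohVec]
    positivity
  intro h
  simp [h] at h2

theorem log_norm_sq_cohVec (m : ℕ) (i : Fin n) (w : Fin n → ℂ) :
    Real.log (‖cohVec m (w i • dir i w) (dir i w)‖ ^ 2) = m * localPotential i w := by
  have h := dirSq_pos i w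
  have h1 : ∑ k, ‖(w i • dir i w) k‖ ^ 2 = ‖w i‖ ^ 2 * dirSq i w := by
    simp only [Pi.smul_apply, smul_eq_mul, norm_mul, mul_pow, dirSq, Finset.mul_sum]
  rw [norm_sq_cohVec, h1, localPotential_eq]
  change Real.log (_ * dirSq i w ^ m) = _
  rw [Real.log_mul (Real.exp_pos _).ne' (by positivity), Real.log_exp, Real.log_pow]
  ring

/-- The multiples of the generalized Simanca metric are projectively induced. -/
theorem projectivelyInduced_simanca (m n : ℕ) :
    ProjectivelyInduced ((m : ℂ) • simanca n) := by
  refine ⟨fun p => Projectivization.mk ℂ (cohVec m p.1.1 p.1.2.rep)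
    (cohVec_ne_zero m p.1.2.rep_nonzero), fun x => ?_⟩
  set i := idx x
  let G : (Fin n → ℂ) → EllTwo := fun w => cohVec m (w i • dir i w) (dir i w)
  have hdir : ContDiff ℂ ω (dir i) := contDiff_pi.2 fun j => contDiff_dir i j
  have hG : ContDiff ℂ ω G := contDiff_cohVec m ((contDiff_apply ℂ ℂ i).smul hdir) hdir
  refine ⟨(chart i).source, (chart i).open_source, mem_affine_idx x, fun p => G (coord i p),
    hG.contMDiff.comp_contMDiffOn (contMDiffOn_coord i), fun y hy => ?_, fun y hy => ?_⟩
  · refine ⟨cohVec_ne_zero m (dir_ne_zero i _), ?_⟩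
    rw [Projectivization.mk_eq_mk_iff']
    obtain ⟨a, _, h⟩ := rep_mk_eq (dir i (coord i y)) (dir_ne_zero i _)
    refine ⟨a ^ m, ?_⟩
    have hy' := param_coord i y hy
    conv_rhs => rw [← hy']
    simp only [param, h, G]
    rw [cohVec_smul]
  · have : (fun y' => Real.log (‖G (coord i y')‖ ^ 2))
        = fun y' => (m : ℝ) * localPotential i (coord i y') := by
      funext y'
      exact log_norm_sq_cohVec m i _
    rw [this, ddbar_localPotential i hy]
    simp

end BlowUp

end

noncomputable section

/-! ### Hermitian holomorphic line bundles -/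

section LineBundle

variable {n : ℕ} {M : Type} [TopologicalSpace M] [ChartedSpace (Fin n → ℂ) M]

namespace HolomorphicLineBundle

variable (L : HolomorphicLineBundle n M)

/-- The section `σ` is holomorphic near `p`. -/
def HolAt (σ : ∀ x, L.Fiber x) (p : M) : Prop :=
  ContMDiffAt 𝓘(ℂ, Fin n → ℂ) (𝓘(ℂ, Fin n → ℂ).prod 𝓘(ℂ, ℂ)) ω
    (fun x => TotalSpace.mk' ℂ x (σ x)) p

variable {L}

theorem holAt_iff {σ : ∀ x, L.Fiber x} {p : M} (e : Trivialization ℂ (π ℂ L.Fiber))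
    [MemTrivializationAtlas e] (hp : p ∈ e.baseSet) :
    L.HolAt σ p ↔ ContMDiffAt 𝓘(ℂ, Fin n → ℂ) 𝓘(ℂ, ℂ) ω (fun x => (e ⟨x, σ x⟩).2) p :=
  e.contMDiffAt_section_iff hp

theorem HolAt.congr {σ τ : ∀ x, L.Fiber x} {p : M} (h : L.HolAt σ p) (hτ : ∀ᶠ x in 𝓝 p, τ x = σ x) :
    L.HolAt τ p :=
  ContMDiffAt.congr_of_eventuallyEq h (hτ.mono fun x hx => by simp only [hx])

theorem eq_smul_symm (e : Trivialization ℂ (π ℂ L.Fiber)) [MemTrivializationAtlas e] {x : M}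
    (hx : x ∈ e.baseSet) (v : L.Fiber x) : v = (e ⟨x, v⟩).2 • e.symm x 1 := by
  have h1 := e.symm_apply_apply_mk hx v
  have h2 := (e.linearEquivAt ℂ x hx).symm.map_smul (e ⟨x, v⟩).2 1
  rw [Trivialization.linearEquivAt_symm_apply, Trivialization.linearEquivAt_symm_apply,
    smul_eq_mul, mul_one, h1] at h2
  exact h2

theorem triv_smul (e : Trivialization ℂ (π ℂ L.Fiber)) [MemTrivializationAtlas e] {x : M}
    (hx : x ∈ e.baseSet) (c : ℂ) (v : L.Fiber x) : (e ⟨x, c • v⟩).2 = c * (e ⟨x, v⟩).2 :=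
  (e.linear ℂ hx).map_smul c v

theorem eq_div_smul (e : Trivialization ℂ (π ℂ L.Fiber)) [MemTrivializationAtlas e] {x : M}
    (hx : x ∈ e.baseSet) {v w : L.Fiber x} (hw : (e ⟨x, w⟩).2 ≠ 0) :
    v = ((e ⟨x, v⟩).2 / (e ⟨x, w⟩).2) • w := by
  have h1 := eq_smul_symm e hx w
  have h2 := eq_smul_symm e hx v
  generalize (e ⟨x, w⟩).2 = b at *
  generalize (e ⟨x, v⟩).2 = a at *
  rw [h2, h1, smul_smul, div_mul_cancel₀ _ hw]

theorem symm_one_ne_zero (e : Trivialization ℂ (π ℂ L.Fiber)) [MemTrivializationAtlas e] {x : M}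
    (hx : x ∈ e.baseSet) : e.symm x (1 : ℂ) ≠ 0 := by
  intro h
  have h1 := e.apply_mk_symm hx (1 : ℂ)
  have h2 := triv_smul e hx 0 (e.symm x (1 : ℂ))
  rw [zero_smul, ← h, h1] at h2
  simp at h2

theorem HolAt.smul {σ : ∀ x, L.Fiber x} {f : M → ℂ} {p : M}
    (hf : ContMDiffAt 𝓘(ℂ, Fin n → ℂ) 𝓘(ℂ, ℂ) ω f p) (hσ : L.HolAt σ p) :
    L.HolAt (fun x => f x • σ x) p := by
  have hp := mem_baseSet_trivializationAt ℂ L.Fiber p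
  rw [holAt_iff (trivializationAt ℂ L.Fiber p) hp] at hσ ⊢
  refine (hf.smul hσ).congr_of_eventuallyEq ?_
  filter_upwards [(trivializationAt ℂ L.Fiber p).open_baseSet.mem_nhds hp] with x hx
  exact triv_smul _ hx _ _

end HolomorphicLineBundle

namespace HermitianMetric

open HolomorphicLineBundle

variable {L : HolomorphicLineBundle n M} (h : HermitianMetric L)

theorem smul_right (x : M) (r : ℂ) (a b : L.Fiber x) :
    h.form x a (r • b) = starRingEnd ℂ r * h.form x a b := by
  rw [h.conj_symm x (r • b) a, h.smul_left, map_mul, ← h.conj_symm]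

theorem form_self (x : M) (a : L.Fiber x) : h.form x a a = ((h.form x a a).re : ℂ) :=
  (Complex.conj_eq_iff_real.1 (h.conj_symm x a a).symm).elim fun r hr => by rw [hr]; simp

theorem form_self_ne_zero {x : M} {a : L.Fiber x} (ha : a ≠ 0) : h.form x a a ≠ 0 := fun h0 => by
  have := h.pos x a ha
  simp [h0] at this

theorem form_zero_left (x : M) (b : L.Fiber x) : h.form x 0 b = 0 := by
  have := h.smul_left x 0 0 b
  simpa using this

theorem re_form_smul (x : M) (c : ℂ) (a : L.Fiber x) :
    (h.form x (c • a) (c • a)).re = ‖c‖ ^ 2 * (h.form x a a).re := by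
  rw [h.smul_left, h.smul_right, ← mul_assoc, Complex.mul_conj, Complex.re_ofReal_mul,
    Complex.normSq_eq_norm_sq]

theorem ne_zero_of_re_pos {x : M} {a : L.Fiber x} (ha : 0 < (h.form x a a).re) : a ≠ 0 := by
  rintro rfl
  simp [h.form_zero_left] at ha

/-- The coefficient of `τ` with respect to a section `σ` without zeros. -/
def coef (σ τ : ∀ x, L.Fiber x) (x : M) : ℂ := h.form x (τ x) (σ x) / h.form x (σ x) (σ x)

theorem coef_eq_of_smul {σ τ : ∀ x, L.Fiber x} {x : M} (hσ : σ x ≠ 0) {c : ℂ}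
    (hc : τ x = c • σ x) : h.coef σ τ x = c := by
  rw [coef, hc, h.smul_left, mul_div_cancel_right₀ _ (h.form_self_ne_zero hσ)]

theorem coef_smul {σ : ∀ x, L.Fiber x} (τ : ∀ x, L.Fiber x) {x : M} (hσ : σ x ≠ 0) :
    h.coef σ τ x • σ x = τ x := by
  have hx := mem_baseSet_trivializationAt ℂ L.Fiber x
  set e := trivializationAt ℂ L.Fiber x
  have h1 := eq_smul_symm e hx (σ x)
  have hs : (e ⟨x, σ x⟩).2 ≠ 0 := fun h0 => hσ (by rw [h1, h0, zero_smul])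
  have h3 : τ x = ((e ⟨x, τ x⟩).2 / (e ⟨x, σ x⟩).2) • σ x := eq_div_smul e hx hs
  rw [h.coef_eq_of_smul hσ h3]
  exact h3.symm

theorem contMDiffAt_coef {σ τ : ∀ x, L.Fiber x} {p : M} (hσ : L.HolAt σ p) (hτ : L.HolAt τ p)
    (h0 : σ p ≠ 0) : ContMDiffAt 𝓘(ℂ, Fin n → ℂ) 𝓘(ℂ, ℂ) ω (h.coef σ τ) p := by
  have hp := mem_baseSet_trivializationAt ℂ L.Fiber p
  set e := trivializationAt ℂ L.Fiber p
  rw [holAt_iff e hp] at hσ hτ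
  have hs : (e ⟨p, σ p⟩).2 ≠ 0 := fun h1 => h0 (by rw [eq_smul_symm e hp (σ p), h1, zero_smul])
  have hdiv : ContMDiffAt 𝓘(ℂ, Fin n → ℂ) 𝓘(ℂ, ℂ) ω
      (fun x => (e ⟨x, τ x⟩).2 / (e ⟨x, σ x⟩).2) p := by
    have : ContDiffAt ℂ ω (fun z : ℂ × ℂ => z.1 / z.2) ((e ⟨p, τ p⟩).2, (e ⟨p, σ p⟩).2) :=
      contDiffAt_fst.div contDiffAt_snd hs
    exact this.contMDiffAt.comp p (hτ.prodMk_space hσ)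
  refine hdiv.congr_of_eventuallyEq ?_
  filter_upwards [e.open_baseSet.mem_nhds hp, hσ.continuousAt.eventually_ne hs] with x hx hx0
  refine h.coef_eq_of_smul (fun h3 => hx0 ?_) ?_
  · rw [h3]
    have := triv_smul e hx 0 (σ x)
    simpa [h3] using this
  · exact eq_div_smul e hx hx0

/-- `σ` is a holomorphic section over `U` with `h(σ, σ) = exp (-φ)`. -/
structure IsFrame (φ : M → ℝ) (U : Set M) (σ : ∀ x, L.Fiber x) : Prop where
  norm : ∀ x ∈ U, (h.form x (σ x) (σ x)).re = Real.exp (-φ x)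
  hol : ∀ x ∈ U, L.HolAt σ x

variable {h} {φ : M → ℝ} {U : Set M} {σ τ : ∀ x, L.Fiber x}

theorem IsFrame.ne_zero (hσ : h.IsFrame φ U σ) {x : M} (hx : x ∈ U) : σ x ≠ 0 :=
  h.ne_zero_of_re_pos (by rw [hσ.norm x hx]; exact Real.exp_pos _)

theorem IsFrame.mono {V : Set M} (hσ : h.IsFrame φ U σ) (hV : V ⊆ U) : h.IsFrame φ V σ :=
  ⟨fun x hx => hσ.norm x (hV hx), fun x hx => hσ.hol x (hV hx)⟩

theorem IsFrame.const_smul (hσ : h.IsFrame φ U σ) {c : ℂ} (hc : ‖c‖ = 1) :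
    h.IsFrame φ U fun x => c • σ x :=
  ⟨fun x hx => by rw [h.re_form_smul, hc, hσ.norm x hx]; simp,
    fun x hx => HolAt.smul contMDiffAt_const (hσ.hol x hx)⟩

theorem IsFrame.norm_coef (hσ : h.IsFrame φ U σ) (hτ : h.IsFrame φ U τ) {x : M} (hx : x ∈ U) :
    ‖h.coef σ τ x‖ = 1 := by
  have h1 := hτ.norm x hx
  rw [← h.coef_smul τ (hσ.ne_zero hx), h.re_form_smul, hσ.norm x hx] at h1
  have h2 : ‖h.coef σ τ x‖ ^ 2 = 1 := by
    have := Real.exp_pos (-φ x)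
    field_simp at h1
    exact h1
  exact (pow_eq_one_iff_of_nonneg (norm_nonneg _) two_ne_zero).1 h2

/-- Two frames of the same norm differ by a constant on connected sets. -/
theorem IsFrame.eq_const_smul [IsManifold 𝓘(ℂ, Fin n → ℂ) 1 M] (hσ : h.IsFrame φ U σ)
    (hτ : h.IsFrame φ U τ) (hU : IsOpen U) (hc : IsPreconnected U) {x : M} (hx : x ∈ U) {c : ℂ}
    (hxc : τ x = c • σ x) : ∀ y ∈ U, τ y = c • σ y := by
  intro y hy
  have hd : MDifferentiableOn 𝓘(ℂ, Fin n → ℂ) 𝓘(ℂ, ℂ) (h.coef σ τ) U := fun z hz =>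
    ((h.contMDiffAt_coef (hσ.hol z hz) (hτ.hol z hz) (hσ.ne_zero hz)).mdifferentiableAt
      (by simp)).mdifferentiableWithinAt
  have h1 := hd.eqOn_of_isPreconnected_of_isMaxOn_norm hc hU hx
    (fun z hz => by simp [hσ.norm_coef hτ hz, hσ.norm_coef hτ hx]) hy
  simp only [Function.const] at h1
  rw [← h.coef_eq_of_smul (hσ.ne_zero hx) hxc, ← h1, h.coef_smul τ (hσ.ne_zero hy)]

theorem IsFrame.exists_normalized (hσ : h.IsFrame φ U σ) {x : M} (hx : x ∈ U) {v : L.Fiber x}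
    (hv : (h.form x v v).re = Real.exp (-φ x)) :
    ∃ σ', h.IsFrame φ U σ' ∧ σ' x = v := by
  classical
  let τ : ∀ y, L.Fiber y := fun y => if hy : y = x then hy ▸ v else 0
  have hτ : τ x = v := by simp [τ]
  set c := h.coef σ τ x with hc
  have h1 : c • σ x = v := by rw [hc, h.coef_smul τ (hσ.ne_zero hx), hτ]
  refine ⟨fun y => c • σ y, hσ.const_smul ?_, h1⟩
  have h2 := hv
  rw [← h1, h.re_form_smul, hσ.norm x hx] at h2
  have h3 : ‖c‖ ^ 2 = 1 := by
    have := Real.exp_pos (-φ x)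
    field_simp at h2
    exact h2
  exact (pow_eq_one_iff_of_nonneg (norm_nonneg _) two_ne_zero).1 h3

/-- Frames that agree on overlaps can be glued. -/
theorem IsFrame.exists_glue {A : Type*} {V : A → Set M} {s : A → ∀ x, L.Fiber x}
    (hs : ∀ a, h.IsFrame φ (V a) (s a)) (hV : ∀ a, IsOpen (V a))
    (hagree : ∀ a b, ∀ x ∈ V a ∩ V b, s a x = s b x) :
    ∃ σ, h.IsFrame φ (⋃ a, V a) σ ∧ ∀ a, ∀ x ∈ V a, σ x = s a x := by
  classical
  let σ : ∀ x, L.Fiber x := fun x => if hx : ∃ a, x ∈ V a then s hx.choose x else 0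
  have hσ : ∀ a, ∀ x ∈ V a, σ x = s a x := by
    intro a x hx
    have hex : ∃ a, x ∈ V a := ⟨a, hx⟩
    simp only [σ, dif_pos hex]
    exact hagree _ _ x ⟨hex.choose_spec, hx⟩
  refine ⟨σ, ⟨fun x hx => ?_, fun x hx => ?_⟩, hσ⟩
  · obtain ⟨a, ha⟩ := mem_iUnion.1 hx
    rw [hσ a x ha, (hs a).norm x ha]
  · obtain ⟨a, ha⟩ := mem_iUnion.1 hx
    refine ((hs a).hol x ha).congr ?_
    filter_upwards [(hV a).mem_nhds ha] with y hy using hσ a y hy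

end HermitianMetric

end LineBundle

end

noncomputable section

/-! ### Frames of the quantizations of the generalized Simanca metric -/

namespace BlowUp

open HolomorphicLineBundle HermitianMetric

variable {n m : ℕ}

/-- The potential of `m` times the metric in the `i`-th chart, as a function on the blow-up. -/
def pot (m : ℕ) (i : Fin n) (p : BlowUp n) : ℝ := (m : ℝ) * localPotential i (coord i p)

theorem ddbar_add {u v : BlowUp n → ℝ} {x : BlowUp n}
    (hu : ContMDiffAt 𝓘(ℝ, Fin n → ℂ) 𝓘(ℝ, ℝ) ∞ u x)
    (hv : ContMDiffAt 𝓘(ℝ, Fin n → ℂ) 𝓘(ℝ, ℝ) ∞ v x) :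
    ddbar (n := n) (fun p => u p + v p) x = ddbar (n := n) u x + ddbar (n := n) v x :=
  levi_add ((contDiffAt_comp_param (mem_affine_idx x) hu).of_le (by norm_cast))
    ((contDiffAt_comp_param (mem_affine_idx x) hv).of_le (by norm_cast))

theorem isOpen_param_image (i : Fin n) {S : Set (Fin n → ℂ)} (hS : IsOpen S) :
    IsOpen (param i '' S) :=
  (chart i).symm.isOpen_image_of_subset_source hS (subset_univ S)

theorem injective_param (i : Fin n) : Function.Injective (param i) :=
  Function.LeftInverse.injective (coord_param i)

theorem param_mem_source_self (i : Fin n) (w : Fin n → ℂ) : param i w ∈ (chart i).source :=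
  (param_mem_source i i w).2 (by simp [dir_same])

theorem range_param (i : Fin n) : range (param i) = (chart i).source :=
  Subset.antisymm (range_subset_iff.2 (param_mem_source_self i))
    fun p hp => ⟨coord i p, param_coord i p hp⟩

variable (Q : GeometricQuantization ((m : ℂ) • simanca n))

theorem exists_local_frame (i : Fin n) (a : Fin n → ℂ) :
    ∃ r > 0, ∃ σ, Q.h.IsFrame (pot m i) (param i '' Metric.ball a r) σ := by
  set e := trivializationAt ℂ Q.L.Fiber (param i a)
  have he : param i a ∈ e.baseSet := mem_baseSet_trivializationAt ℂ Q.L.Fiber (param i a)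
  let H : BlowUp n → ℝ := fun y => (Q.h.form y (e.symm y 1) (e.symm y 1)).re
  have hH0 : ∀ y ∈ e.baseSet, 0 < H y := fun y hy => Q.h.pos y _ (symm_one_ne_zero e hy)
  have hlog : ∀ y ∈ e.baseSet,
      ContMDiffAt 𝓘(ℝ, Fin n → ℂ) 𝓘(ℝ, ℝ) ∞ (fun y => Real.log (H y)) y := fun y hy =>
    (Real.contDiffAt_log.2 (hH0 y hy).ne').contMDiffAt.comp y
      ((Q.h.smooth e).contMDiffAt (e.open_baseSet.mem_nhds hy))
  have hpot : ∀ y ∈ (chart i).source, ContMDiffAt 𝓘(ℝ, Fin n → ℂ) 𝓘(ℝ, ℝ) ∞ (pot m i) y := by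
    intro y hy
    have h1 : ContDiff ℝ ∞ fun w : Fin n → ℂ => (m : ℝ) * localPotential i w :=
      contDiff_const.mul (contDiff_localPotential_infty i)
    exact h1.contMDiff.contMDiffAt.comp y
      ((contMDiffOn_coord_real i).contMDiffAt ((chart i).open_source.mem_nhds hy))
  have hdd : ∀ y ∈ e.baseSet, y ∈ (chart i).source →
      ddbar (n := n) (fun y => Real.log (H y) + pot m i y) y = 0 := by
    intro y hy hyi
    have h1 := Q.curvature e y hy
    have h2 : ddbar (n := n) (pot m i) y = _ := ddbar_localPotential i hyi m
    rw [ddbar_add (hlog y hy) (hpot y hyi), h2]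
    rw [neg_eq_iff_eq_neg] at h1
    change ddbar (n := n) (fun y => Real.log (H y)) y = _ at h1
    rw [h1]
    simp
  have hopen : IsOpen (param i ⁻¹' e.baseSet) := e.open_baseSet.preimage (continuous_param i)
  obtain ⟨r, hr, hball⟩ := Metric.mem_nhds_iff.1 (hopen.mem_nhds he)
  obtain ⟨F, hF, hre⟩ := exists_re_eq_of_levi_eq_zero
    (u := (fun y => Real.log (H y) + pot m i y) ∘ param i) Metric.isOpen_ball (convex_ball a r)
    (fun b hb => by
      have := contDiffAt_comp_param (param_mem_source_self i b)
        ((hlog _ (hball hb)).add (hpot _ (param_mem_source_self i b)))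
      rw [coord_param] at this
      exact this.contDiffWithinAt)
    (fun b hb => by
      have := levi_comp_param_eq_zero (param_mem_source_self i b)
        ((hlog _ (hball hb)).add (hpot _ (param_mem_source_self i b)))
        (hdd _ (hball hb) (param_mem_source_self i b))
      rwa [coord_param] at this)
  refine ⟨r, hr, fun y => Complex.exp (-F (coord i y) / 2) • e.symm y 1, ?_, ?_⟩
  · rintro _ ⟨b, hb, rfl⟩
    have h1 := hre b hb
    have h2 := hH0 _ (hball hb)
    simp only [Function.comp] at h1
    rw [Q.h.re_form_smul, coord_param]
    change _ * H (param i b) = _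
    rw [Complex.norm_exp, ← Real.exp_nat_mul, ← Real.exp_log h2, ← Real.exp_add]
    congr 1
    have h3 : (-F b / 2).re = -(F b).re / 2 := by
      rw [show (2 : ℂ) = ((2 : ℝ) : ℂ) by norm_num, Complex.div_ofReal_re, Complex.neg_re]
    rw [h3, ← h1]
    push_cast
    ring
  · rintro _ ⟨b, hb, rfl⟩
    have h1 : ContDiffAt ℂ ω (fun w => Complex.exp (-F w / 2)) (coord i (param i b)) := by
      rw [coord_param]
      exact ((hF.contDiffAt (Metric.isOpen_ball.mem_nhds hb)).neg.div_const 2).cexp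
    refine HolAt.smul (h1.contMDiffAt.comp _ ((contMDiffOn_coord i).contMDiffAt
      ((chart i).open_source.mem_nhds (param_mem_source_self i b)))) ?_
    rw [holAt_iff e (hball hb)]
    refine (contMDiffAt_const (c := (1 : ℂ))).congr_of_eventuallyEq ?_
    filter_upwards [e.open_baseSet.mem_nhds (hball hb)] with y hy
    rw [e.apply_mk_symm hy]

/-- The existence of a frame over the part of the blow-up parametrized by `S`. -/
def HasFrame (i : Fin n) (S : Set (Fin n → ℂ)) : Prop :=
  ∃ σ, Q.h.IsFrame (pot m i) (param i '' S) σ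

variable {Q}

theorem HasFrame.mono {i : Fin n} {S T : Set (Fin n → ℂ)} (h : HasFrame Q i S) (hT : T ⊆ S) :
    HasFrame Q i T :=
  let ⟨σ, hσ⟩ := h
  ⟨σ, hσ.mono (image_mono hT)⟩

theorem HasFrame.union {i : Fin n} {S T : Set (Fin n → ℂ)} (hS : HasFrame Q i S)
    (hT : HasFrame Q i T) (hSo : IsOpen S) (hTo : IsOpen T) (hc : IsPreconnected (S ∩ T))
    (hne : (S ∩ T).Nonempty) : HasFrame Q i (S ∪ T) := by
  obtain ⟨σ, hσ⟩ := hS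
  obtain ⟨τ, hτ⟩ := hT
  obtain ⟨a, haS, haT⟩ := hne
  obtain ⟨τ', hτ', hτa⟩ := hτ.exists_normalized (mem_image_of_mem _ haT)
    (hσ.norm _ (mem_image_of_mem _ haS))
  have hST : ∀ y ∈ param i '' (S ∩ T), τ' y = (1 : ℂ) • σ y :=
    (hσ.mono (image_mono inter_subset_left)).eq_const_smul
      (hτ'.mono (image_mono inter_subset_right)) (isOpen_param_image i (hSo.inter hTo))
      (hc.image _ (continuous_param i).continuousOn) (mem_image_of_mem _ ⟨haS, haT⟩)
      (by rw [hτa, one_smul])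
  rw [image_inter (injective_param i)] at hST
  obtain ⟨ρ, hρ, -⟩ := IsFrame.exists_glue (A := Bool) (h := Q.h) (φ := pot m i)
    (V := fun b => cond b (param i '' S) (param i '' T)) (s := fun b => cond b σ τ')
    (by rintro (_ | _); exacts [hτ', hσ])
    (by rintro (_ | _); exacts [isOpen_param_image i hTo, isOpen_param_image i hSo])
    (by
      rintro (_ | _) (_ | _) x ⟨h1, h2⟩
      · rfl
      · simpa using hST x ⟨h2, h1⟩
      · simpa using (hST x ⟨h1, h2⟩).symm
      · rfl)
  refine ⟨ρ, hρ.mono ?_⟩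
  rw [image_union]
  refine union_subset ?_ ?_
  · exact subset_iUnion_of_subset true subset_rfl
  · exact subset_iUnion_of_subset false subset_rfl

theorem exists_frame_tube (i : Fin n) (w : Fin n → ℂ) :
    ∃ ε > 0, HasFrame Q i (Metric.thickening ε (segment ℝ 0 w)) := by
  choose r hr hσ using exists_local_frame Q i
  have hcomp : IsCompact (segment ℝ (0 : Fin n → ℂ) w) := by
    rw [segment_eq_image]
    exact isCompact_Icc.image (by fun_prop)
  obtain ⟨δ, hδ, hL⟩ := lebesgue_number_lemma_of_metric (c := fun a => Metric.ball a (r a)) hcomp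
    (fun a => Metric.isOpen_ball)
    fun x _ => mem_iUnion.2 ⟨x, Metric.mem_ball_self (hr x)⟩
  have hball : ∀ t : ℝ, 0 ≤ t → t ≤ 1 → HasFrame Q i (Metric.ball (t • w) δ) := by
    intro t h0 h1
    obtain ⟨a, ha⟩ := hL (t • w) (by
      rw [segment_eq_image]
      exact ⟨t, ⟨h0, h1⟩, by simp⟩)
    exact HasFrame.mono (hσ a) ha
  have hseg : ∀ t : ℝ, 0 ≤ t → ∀ y ∈ segment ℝ 0 (t • w), ∃ s, 0 ≤ s ∧ s ≤ t ∧ y = s • w := by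
    intro t ht y hy
    rw [segment_eq_image] at hy
    obtain ⟨s, ⟨hs0, hs1⟩, rfl⟩ := hy
    exact ⟨s * t, by positivity, by nlinarith, by simp [smul_smul]⟩
  have hseg' : ∀ s t : ℝ, 0 ≤ s → s ≤ t → s • w ∈ segment ℝ 0 (t • w) := by
    intro s t hs hst
    rw [segment_eq_image]
    rcases hs.eq_or_lt with rfl | hs
    · exact ⟨0, by simp, by simp⟩
    · exact ⟨s / t, ⟨div_nonneg hs.le (hs.le.trans hst), (div_le_one (by linarith)).2 hst⟩, by
        have : t ≠ 0 := by linarith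
        simp [smul_smul, div_mul_cancel₀ _ this]⟩
  have key : ∀ k : ℕ, ∀ t : ℝ, 0 ≤ t → t ≤ 1 → t * ‖w‖ ≤ k * (δ / 2) →
      HasFrame Q i (Metric.thickening (δ / 2) (segment ℝ 0 (t • w))) := by
    intro k
    induction k with
    | zero =>
      intro t h0 h1 ht
      refine (hball 0 le_rfl zero_le_one).mono fun y hy => ?_
      obtain ⟨z, hz, hyz⟩ := Metric.mem_thickening_iff.1 hy
      obtain ⟨s, hs0, hs1, rfl⟩ := hseg t h0 z hz
      have : ‖s • w‖ = 0 := by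
        rw [norm_smul, Real.norm_of_nonneg hs0]
        have h2 : s * ‖w‖ ≤ t * ‖w‖ := by gcongr
        have h3 : (0 : ℝ) ≤ s * ‖w‖ := by positivity
        simp only [Nat.cast_zero, zero_mul] at ht
        linarith
      rw [norm_eq_zero] at this
      rw [this] at hyz
      rw [zero_smul]
      exact Metric.mem_ball.2 (by linarith)
    | succ k ih =>
      intro t h0 h1 ht
      push_cast at ht
      have hk : (0 : ℝ) < k + 1 := by positivity
      set t' := t * (k / (k + 1)) with ht'
      have hfrac : (k : ℝ) / (k + 1) ≤ 1 := (div_le_one hk).2 (by linarith)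
      have ht'0 : 0 ≤ t' := by positivity
      have ht't : t' ≤ t := by nlinarith
      have hA := ih t' ht'0 (by linarith) (by
        have h2 : t' * ‖w‖ = t * ‖w‖ * (k / (k + 1)) := by rw [ht']; ring
        rw [h2]
        calc t * ‖w‖ * (k / (k + 1)) ≤ (k + 1) * (δ / 2) * (k / (k + 1)) := by gcongr
          _ = k * (δ / 2) := by field_simp)
      have hstep : (t - t') * ‖w‖ ≤ δ / 2 := by
        have h2 : (t - t') * ‖w‖ = t * ‖w‖ * (1 / (k + 1)) := by
          rw [ht']
          field_simp
          ring
        rw [h2]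
        calc t * ‖w‖ * (1 / (k + 1)) ≤ (k + 1) * (δ / 2) * (1 / (k + 1)) := by gcongr
          _ = δ / 2 := by field_simp
      have hconv := ((convex_segment (𝕜 := ℝ) (0 : Fin n → ℂ) (t' • w)).thickening (δ / 2)).inter
        (convex_ball (t' • w) δ)
      refine (hA.union (hball t' ht'0 (by linarith)) Metric.isOpen_thickening Metric.isOpen_ball
        hconv.isPreconnected ⟨t' • w, ?_, Metric.mem_ball_self hδ⟩).mono ?_
      · exact Metric.self_subset_thickening (by linarith) _ (right_mem_segment _ _ _)
      · intro y hy
        obtain ⟨z, hz, hyz⟩ := Metric.mem_thickening_iff.1 hy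
        obtain ⟨s, hs0, hs1, rfl⟩ := hseg t h0 z hz
        rcases le_total s t' with hst | hst
        · exact Or.inl (Metric.mem_thickening_iff.2 ⟨_, hseg' s t' hs0 hst, hyz⟩)
        · right
          have h2 : dist (s • w) (t' • w) ≤ δ / 2 := by
            rw [dist_eq_norm, ← sub_smul, norm_smul, Real.norm_of_nonneg (by linarith)]
            refine le_trans ?_ hstep
            gcongr
          have h3 := dist_triangle y (s • w) (t' • w)
          exact Metric.mem_ball.2 (by linarith)
  obtain ⟨k, hk⟩ := exists_nat_ge (‖w‖ / (δ / 2))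
  have := key k 1 zero_le_one le_rfl (by
    rw [one_mul]
    exact (div_le_iff₀ (by linarith)).1 hk)
  rw [one_smul] at this
  exact ⟨δ / 2, by linarith, this⟩

variable (Q)

theorem exists_frame (i : Fin n) : ∃ σ, Q.h.IsFrame (pot m i) (chart i).source σ := by
  choose ε hε hF using exists_frame_tube (Q := Q) i
  let S : (Fin n → ℂ) → Set (Fin n → ℂ) := fun w => Metric.thickening (ε w) (segment ℝ 0 w)
  have hS0 : ∀ w, (0 : Fin n → ℂ) ∈ S w := fun w =>
    Metric.self_subset_thickening (hε w) _ (left_mem_segment _ _ _)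
  have hSw : ∀ w, w ∈ S w := fun w =>
    Metric.self_subset_thickening (hε w) _ (right_mem_segment _ _ _)
  have hSo : ∀ w, IsOpen (S w) := fun w => Metric.isOpen_thickening
  have hSc : ∀ w, Convex ℝ (S w) := fun w => (convex_segment _ _).thickening _
  obtain ⟨σ₀, hσ₀⟩ := hF 0
  have hnorm : ∀ w, ∃ σ, Q.h.IsFrame (pot m i) (param i '' S w) σ ∧ σ (param i 0) = σ₀ (param i 0) :=
    fun w =>
      let ⟨τ, hτ⟩ := hF w
      hτ.exists_normalized (mem_image_of_mem _ (hS0 w)) (hσ₀.norm _ (mem_image_of_mem _ (hS0 0)))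
  choose s hs hs0 using hnorm
  obtain ⟨σ, hσ, -⟩ := IsFrame.exists_glue hs (fun w => isOpen_param_image i (hSo w)) (by
    intro a b x hx
    rw [← image_inter (injective_param i)] at hx
    have := ((hs a).mono (image_mono (inter_subset_left (t := S b)))).eq_const_smul
      ((hs b).mono (image_mono inter_subset_right)) (isOpen_param_image i ((hSo a).inter (hSo b)))
      (((hSc a).inter (hSc b)).isPreconnected.image _ (continuous_param i).continuousOn)
      (mem_image_of_mem _ ⟨hS0 a, hS0 b⟩) (c := 1) (by rw [one_smul, hs0, hs0]) x hx
    rw [this, one_smul])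
  refine ⟨σ, hσ.mono ?_⟩
  rw [← range_param]
  rintro _ ⟨w, rfl⟩
  exact mem_iUnion.2 ⟨w, mem_image_of_mem _ (hSw w)⟩

theorem isPreconnected_dir_ne_zero (i j : Fin n) : IsPreconnected {w : Fin n → ℂ | dir i w j ≠ 0} := by
  by_cases h : j = i
  · subst h
    have : {w : Fin n → ℂ | dir j w j ≠ 0} = univ := by ext; simp [dir_same]
    rw [this]
    exact isPreconnected_univ
  · have : {w : Fin n → ℂ | dir i w j ≠ 0}
        = Set.pi univ fun k => if k = j then {(0 : ℂ)}ᶜ else univ := by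
      ext w
      simp only [dir_apply, h, if_false, mem_ofPred_eq, Set.mem_pi, mem_univ, true_implies]
      constructor
      · intro hw k
        split_ifs with hk
        · subst hk; exact hw
        · exact mem_univ _
      · intro hw
        simpa using hw j
    rw [this]
    refine isPreconnected_univ_pi fun k => ?_
    split_ifs
    · exact (isConnected_compl_singleton_of_one_lt_rank (by simp) 0).isPreconnected
    · exact isPreconnected_univ

theorem param_image_dir_ne_zero (i j : Fin n) :
    param i '' {w | dir i w j ≠ 0} = (chart i).source ∩ (chart j).source := by
  ext p
  constructor
  · rintro ⟨w, hw, rfl⟩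
    exact ⟨param_mem_source_self i w, (param_mem_source i j w).2 hw⟩
  · rintro ⟨hi, hj⟩
    exact ⟨coord i p, dir_coord_ne_zero hi hj, param_coord i p hi⟩

theorem dir_coord (i j : Fin n) {p : BlowUp n} (hp : p ∈ (chart i).source) :
    dir i (coord i p) j = ratio i j p.1.2 := by
  rw [dir_apply]
  split_ifs with h
  · subst h
    rw [ratio, div_self]
    exact hp
  · simp [coord, h]

theorem pot_eq (i j : Fin n) {p : BlowUp n} (hi : p ∈ (chart i).source)
    (hj : p ∈ (chart j).source) :
    pot m j p = pot m i p - Real.log (‖ratio i j p.1.2 ^ m‖ ^ 2) := by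
  have h := localPotential_coord_param i j (coord i p) (dir_coord_ne_zero hi hj)
  rw [param_coord i p hi, dir_coord i j hi] at h
  rw [pot, pot, h, norm_pow, ← pow_mul, mul_comm m 2, pow_mul, Real.log_pow _ m]
  ring

theorem ratio_ne_zero {i j : Fin n} {p : BlowUp n} (hi : p ∈ (chart i).source)
    (hj : p ∈ (chart j).source) : ratio i j p.1.2 ≠ 0 := by
  rw [← dir_coord i j hi]
  exact dir_coord_ne_zero hi hj

theorem contMDiffAt_ratio {i j : Fin n} {p : BlowUp n} (hi : p ∈ (chart i).source) :
    ContMDiffAt 𝓘(ℂ, Fin n → ℂ) 𝓘(ℂ, ℂ) ω (fun p : BlowUp n => ratio i j p.1.2) p := by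
  refine ((contDiff_dir i j).contMDiff.contMDiffAt.comp p ((contMDiffOn_coord i).contMDiffAt
    ((chart i).open_source.mem_nhds hi))).congr_of_eventuallyEq ?_
  filter_upwards [(chart i).open_source.mem_nhds hi] with q hq
  exact (dir_coord i j hq).symm

/-- Frames over all charts with the expected transition functions. -/
theorem exists_frames (o : Fin n) : ∃ σ : Fin n → ∀ x, Q.L.Fiber x,
    (∀ i, Q.h.IsFrame (pot m i) (chart i).source (σ i)) ∧
    ∀ i j, ∀ p ∈ (chart i).source ∩ (chart j).source, σ j p = ratio i j p.1.2 ^ m • σ i p := by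
  choose τ hτ using exists_frame Q
  set b : BlowUp n := param o fun _ => 1 with hb
  have hdir : ∀ j, dir o (fun _ => (1 : ℂ)) j = 1 := fun j => by simp [dir_apply]
  have hbs : ∀ i, b ∈ (chart i).source := fun i => (param_mem_source o i _).2 (by simp [hdir])
  have hratio : ∀ i j, ratio i j b.1.2 = 1 := fun i j => by
    rw [hb, ratio_param, hdir, hdir, div_one]
  have hpot : ∀ i, pot m i b = pot m o b := fun i => by
    rw [pot_eq o i (hbs o) (hbs i), hratio]
    simp
  have hex : ∀ i, ∃ σ, Q.h.IsFrame (pot m i) (chart i).source σ ∧ σ b = τ o b := fun i =>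
    (hτ i).exists_normalized (hbs i) (by rw [(hτ o).norm b (hbs o), hpot i])
  choose σ hσ hσb using hex
  refine ⟨σ, hσ, fun i j p hp => ?_⟩
  have h1 : Q.h.IsFrame (pot m j) ((chart i).source ∩ (chart j).source)
      fun p => ratio i j p.1.2 ^ m • σ i p := by
    refine ⟨fun x hx => ?_, fun x hx => ?_⟩
    · have hne : 0 < ‖ratio i j x.1.2 ^ m‖ ^ 2 :=
        pow_pos (norm_pos_iff.2 (pow_ne_zero _ (ratio_ne_zero hx.1 hx.2))) 2
      rw [Q.h.re_form_smul, (hσ i).norm x hx.1, pot_eq i j hx.1 hx.2, neg_sub, sub_eq_add_neg,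
        Real.exp_add, Real.exp_log hne]
    · exact HolAt.smul ((contMDiffAt_ratio hx.1).pow m) ((hσ i).hol x hx.1)
  have h2 := h1.eq_const_smul ((hσ j).mono inter_subset_right)
    ((chart i).open_source.inter (chart j).open_source)
    (by
      rw [← param_image_dir_ne_zero]
      exact (isPreconnected_dir_ne_zero i j).image _ (continuous_param i).continuousOn)
    ⟨hbs i, hbs j⟩ (c := 1) (by rw [hσb, hσb, hratio, one_pow, one_smul, one_smul]) p hp
  rw [h2, one_smul]

end BlowUp

end

noncomputable section

/-! ### Sections of the quantizations as entire functions -/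

namespace BlowUp

open HolomorphicLineBundle HermitianMetric

variable {n m : ℕ} {Q : GeometricQuantization ((m : ℂ) • simanca n)}

theorem section_holAt (T : Q.Sections) (p : BlowUp n) : Q.L.HolAt (fun x => T x) p :=
  T.contMDiff p

/-- The entire function that represents a section with respect to a frame over the `o`-th chart. -/
def secMap (o : Fin n) (σ : ∀ x, Q.L.Fiber x) : Q.Sections →ₗ[ℂ] ((Fin n → ℂ) → ℂ) where
  toFun T w := Q.h.coef σ (fun x => T x) (param o w)
  map_add' S T := by
    funext w
    simp only [coef, Pi.add_apply, ContMDiffSection.coe_add, Q.h.add_left, add_div]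
  map_smul' c T := by
    funext w
    simp only [coef, Pi.smul_apply, ContMDiffSection.coe_smul, Q.h.smul_left, RingHom.id_apply,
      smul_eq_mul, mul_div_assoc]

theorem pot_param (o : Fin n) (w : Fin n → ℂ) :
    pot m o (param o w) = (m : ℝ) * localPotential o w := by rw [pot, coord_param]

variable {o : Fin n} {σ : ∀ x, Q.L.Fiber x}

theorem secMap_smul (hσ : Q.h.IsFrame (pot m o) (chart o).source σ) (T : Q.Sections)
    (w : Fin n → ℂ) : secMap o σ T w • σ (param o w) = T (param o w) :=
  Q.h.coef_smul (fun x => T x) (hσ.ne_zero (param_mem_source_self o w))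

theorem secMap_eq (hσ : Q.h.IsFrame (pot m o) (chart o).source σ) {T : Q.Sections}
    {w : Fin n → ℂ} {c : ℂ} (h : T (param o w) = c • σ (param o w)) : secMap o σ T w = c :=
  Q.h.coef_eq_of_smul (τ := fun x => T x) (hσ.ne_zero (param_mem_source_self o w)) h

theorem contDiff_secMap (hσ : Q.h.IsFrame (pot m o) (chart o).source σ) (T : Q.Sections) :
    ContDiff ℂ ω (secMap o σ T) := by
  rw [contDiff_iff_contDiffAt]
  intro w
  rw [← contMDiffAt_iff_contDiffAt]
  exact (Q.h.contMDiffAt_coef (hσ.hol _ (param_mem_source_self o w))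
    (section_holAt T _) (hσ.ne_zero (param_mem_source_self o w))).comp w
    (contMDiff_param o).contMDiffAt

theorem form_section (hσ : Q.h.IsFrame (pot m o) (chart o).source σ) (S T : Q.Sections)
    (w : Fin n → ℂ) : Q.h.form (param o w) (S (param o w)) (T (param o w)) =
      secMap o σ S w * starRingEnd ℂ (secMap o σ T w)
        * (Real.exp (-(m * localPotential o w)) : ℝ) := by
  rw [← secMap_smul hσ S, ← secMap_smul hσ T, Q.h.smul_left, Q.h.smul_right, Q.h.form_self,
    hσ.norm _ (param_mem_source_self o w), pot_param]
  ring

/-- Functions on the charts that are related by the transition functions define a section. -/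
theorem exists_section {σ : Fin n → ∀ x, Q.L.Fiber x}
    (hσ : ∀ i, Q.h.IsFrame (pot m i) (chart i).source (σ i))
    (htr : ∀ i j, ∀ p ∈ (chart i).source ∩ (chart j).source,
      σ j p = ratio i j p.1.2 ^ m • σ i p)
    {G : Fin n → (Fin n → ℂ) → ℂ} (hG : ∀ i, ContDiff ℂ ω (G i))
    (hGtr : ∀ i j, ∀ p ∈ (chart i).source ∩ (chart j).source,
      G i (coord i p) = ratio i j p.1.2 ^ m * G j (coord j p)) :
    ∃ T : Q.Sections, ∀ i, ∀ p ∈ (chart i).source, T p = G i (coord i p) • σ i p := by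
  let t : ∀ x, Q.L.Fiber x := fun p => G (idx p) (coord (idx p) p) • σ (idx p) p
  have ht : ∀ i, ∀ p ∈ (chart i).source, t p = G i (coord i p) • σ i p := by
    intro i p hp
    have hp' : p ∈ (chart (idx p)).source := mem_affine_idx p
    rw [hGtr i (idx p) p ⟨hp, hp'⟩, mul_comm, mul_smul, ← htr i (idx p) p ⟨hp, hp'⟩]
  refine ⟨⟨t, fun p => ?_⟩, ht⟩
  have hp : p ∈ (chart (idx p)).source := mem_affine_idx p
  have h1 : Q.L.HolAt (fun x => G (idx p) (coord (idx p) x) • σ (idx p) x) p :=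
    HolAt.smul ((hG (idx p)).contMDiff.contMDiffAt.comp p ((contMDiffOn_coord (idx p)).contMDiffAt
      ((chart (idx p)).open_source.mem_nhds hp))) ((hσ (idx p)).hol p hp)
  refine h1.congr ?_
  filter_upwards [(chart (idx p)).open_source.mem_nhds hp] with q hq using ht _ q hq

theorem ratio_eq_div {i j k : Fin n} {p : BlowUp n} (hi : p ∈ (chart i).source) :
    ratio j k p.1.2 = ratio i k p.1.2 / ratio i j p.1.2 := by
  have hi' : p.1.2.rep i ≠ 0 := hi
  simp only [ratio]
  field_simp

/-- Every monomial `w ^ β` whose degree in the directions is at most `β o + m` extends to a global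
section. -/
theorem exists_section_monomial {σ : Fin n → ∀ x, Q.L.Fiber x}
    (hσ : ∀ i, Q.h.IsFrame (pot m i) (chart i).source (σ i))
    (htr : ∀ i j, ∀ p ∈ (chart i).source ∩ (chart j).source,
      σ j p = ratio i j p.1.2 ^ m • σ i p)
    (o : Fin n) (β : Fin n → ℕ) (hβ : ∑ k ∈ Finset.univ.erase o, β k ≤ β o + m) :
    ∃ T : Q.Sections, ∀ w, secMap o (σ o) T w = ∏ k, w k ^ β k := by
  obtain ⟨N, hN⟩ := Nat.exists_eq_add_of_le hβ
  let G : Fin n → (Fin n → ℂ) → ℂ := fun i w =>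
    w i ^ β o * dir i w o ^ N * ∏ k ∈ Finset.univ.erase o, dir i w k ^ β k
  obtain ⟨T, hT⟩ := exists_section hσ htr (G := G)
    (fun i => (((contDiff_apply ℂ ℂ i).pow _).mul ((contDiff_dir i o).pow _)).mul
      (contDiff_prod fun k _ => (contDiff_dir i k).pow _))
    (by
      rintro i j p ⟨hi, hj⟩
      have hr := ratio_ne_zero hi hj
      have hz : coord j p j = coord i p i * ratio i j p.1.2 := by
        have h1 : coord j p j = p.1.1 j := by simp [coord]
        have h2 : coord i p i = p.1.1 i := by simp [coord]
        rw [h1, h2, smul_ratio i p hi j]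
      simp only [G, dir_coord i _ hi, dir_coord j _ hj, hz]
      have h3 : ∀ k, ratio j k p.1.2 = ratio i k p.1.2 / ratio i j p.1.2 :=
        fun k => ratio_eq_div hi
      simp only [h3, div_pow, Finset.prod_div_distrib, mul_pow]
      rw [Finset.prod_pow_eq_pow_sum]
      generalize ∏ x ∈ Finset.univ.erase o, ratio i x p.1.2 ^ β x = P
      generalize ratio i o p.1.2 = a
      generalize ∑ k ∈ Finset.univ.erase o, β k = B at *
      have h4 : ratio i j p.1.2 ^ m * ratio i j p.1.2 ^ β o
          = ratio i j p.1.2 ^ B * ratio i j p.1.2 ^ N := by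
        rw [← pow_add, ← pow_add, ← hN, add_comm]
      field_simp
      linear_combination (-(coord i p i ^ β o * a ^ N * P)) * h4)
  refine ⟨T, fun w => secMap_eq (hσ o) ?_⟩
  rw [hT o _ (param_mem_source_self o w), coord_param]
  congr 1
  simp only [G, dir_same, one_pow, mul_one]
  rw [← Finset.mul_prod_erase Finset.univ _ (Finset.mem_univ o)]
  congr 1
  refine Finset.prod_congr rfl fun k hk => ?_
  rw [dir_apply, if_neg (Finset.ne_of_mem_erase hk)]

end BlowUp

end

noncomputable section

/-! ### The volume of the generalized Simanca metric -/

namespace BlowUp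

/-- The derivative of the `j`-th homogeneous coordinate in the `i`-th chart. -/
def dirDeriv {n : ℕ} (i j : Fin n) : (Fin n → ℂ) →L[ℂ] ℂ :=
  if j = i then 0 else ContinuousLinearMap.proj j

theorem hasFDerivAt_dir {n : ℕ} (i j : Fin n) (a : Fin n → ℂ) :
    HasFDerivAt (fun w => dir i w j) (dirDeriv i j) a := by
  unfold dirDeriv
  by_cases h : j = i
  · simp only [dir_apply, h, if_true]
    exact hasFDerivAt_const _ _
  · simp only [dir_apply, h, if_false]
    exact (ContinuousLinearMap.proj (R := ℂ) (φ := fun _ : Fin n => ℂ) j).hasFDerivAt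

theorem levi_localPotential {n : ℕ} (i : Fin n) (a v w : Fin n → ℂ) :
    levi (localPotential i) a v w =
      ∑ j, (v i * dir i a j + a i * dirDeriv i j v) *
        starRingEnd ℂ (w i * dir i a j + a i * dirDeriv i j w)
      + ((∑ j, dirDeriv i j v * starRingEnd ℂ (dirDeriv i j w)) / dirSq i a
        - (∑ j, starRingEnd ℂ (dir i a j) * dirDeriv i j v)
          * starRingEnd ℂ (∑ j, starRingEnd ℂ (dir i a j) * dirDeriv i j w) / dirSq i a ^ 2) := by
  have hdC : ∀ j, ContDiffAt ℂ 2 (fun w => dir i w j) a := fun j => (contDiff_dir i j).contDiffAt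
  have hFC : ∀ j, ContDiffAt ℂ 2 (fun w : Fin n → ℂ => w i * dir i w j) a := fun j =>
    (contDiff_apply ℂ ℂ i).contDiffAt.mul (hdC j)
  have hsq : ∀ {f : (Fin n → ℂ) → ℂ}, ContDiffAt ℂ 2 f a → ContDiffAt ℝ 2 (fun w => ‖f w‖ ^ 2) a :=
    fun hf => (hf.restrict_scalars ℝ).norm_sq ℝ
  have hs : ContDiffAt ℝ 2 (fun w => dirSq i w) a := ContDiffAt.sum fun j _ => hsq (hdC j)
  have h1 : localPotential i = fun w => (∑ j, ‖w i * dir i w j‖ ^ 2) + Real.log (dirSq i w) := by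
    funext w
    rw [localPotential_eq]
    congr 1
    simp only [dirSq, Finset.mul_sum, norm_mul, mul_pow]
  have h2 : ∀ j, HasFDerivAt (fun w : Fin n → ℂ => w i * dir i w j)
      (a i • dirDeriv i j + dir i a j • ContinuousLinearMap.proj i) a := fun j =>
    ((ContinuousLinearMap.proj (R := ℂ) (φ := fun _ : Fin n => ℂ) i).hasFDerivAt (x := a)).mul
      (hasFDerivAt_dir i j a)
  rw [h1, levi_add (ContDiffAt.sum fun j _ => hsq (hFC j)) (hs.log (dirSq_pos i a).ne'),
    levi_sum _ fun j _ => hsq (hFC j)]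
  simp only [Pi.add_apply, Finset.sum_apply]
  congr 1
  · refine Finset.sum_congr rfl fun j _ => ?_
    rw [levi_normSq (hFC j), (h2 j).fderiv]
    simp only [add_apply, smul_apply, ContinuousLinearMap.proj_apply, smul_eq_mul]
    ring_nf
  · rw [levi_log hs (dirSq_pos i a).ne']
    have h3 : levi (dirSq i) a v w = ∑ j, dirDeriv i j v * starRingEnd ℂ (dirDeriv i j w) := by
      change levi (fun w => ∑ j, ‖dir i w j‖ ^ 2) a v w = _
      rw [levi_sum _ fun j _ => hsq (hdC j)]
      simp only [Finset.sum_apply]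
      refine Finset.sum_congr rfl fun j _ => ?_
      rw [levi_normSq (hdC j), (hasFDerivAt_dir i j a).fderiv]
    have h4 : ∀ v, dbarConj (dirSq i) a v = ∑ j, starRingEnd ℂ (dir i a j) * dirDeriv i j v := by
      intro v
      change dbarConj (fun w => ∑ j, ‖dir i w j‖ ^ 2) a v = _
      rw [dbarConj_sum _ fun j _ => (hsq (hdC j)).differentiableAt (by simp)]
      exact Finset.sum_congr rfl fun j _ => dbarConj_normSq (hasFDerivAt_dir i j a) v
    rw [h3, h4, h4]

theorem det_levi_localPotential {k : ℕ} (a : Fin (k + 1) → ℂ) :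
    (Matrix.of fun j l : Fin (k + 1) =>
      levi (localPotential 0) a (Pi.single j 1) (Pi.single l 1)).det
      = (((1 + ‖a 0‖ ^ 2 * dirSq 0 a) / dirSq 0 a : ℝ) : ℂ) ^ k := by
  set s : ℝ := dirSq 0 a with hs
  have hs0 : (s : ℂ) ≠ 0 := by exact_mod_cast (dirSq_pos 0 a).ne'
  set α : ℂ := ‖a 0‖ ^ 2 + 1 / s with hα
  have hsum : (s : ℂ) = 1 + ∑ j : Fin k, a j.succ * starRingEnd ℂ (a j.succ) := by
    rw [hs, dirSq, Fin.sum_univ_succ]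
    push_cast
    simp [dir_apply, Complex.mul_conj, Complex.normSq_eq_norm_sq]
  have hsum' : ∑ j : Fin k, a j.succ * starRingEnd ℂ (a j.succ) = s - 1 := by rw [hsum]; ring
  have hα' : α = a 0 * starRingEnd ℂ (a 0) + 1 / s := by
    rw [hα, Complex.mul_conj, Complex.normSq_eq_norm_sq]
    push_cast
    rfl
  set A := Matrix.of fun j l : Fin (k + 1) =>
      levi (localPotential 0) a (Pi.single j 1) (Pi.single l 1) with hA
  have h00 : A 0 0 = s := by
    simp only [hA, Matrix.of_apply, levi_localPotential]
    simp [Fin.sum_univ_succ, dirDeriv, dir_apply, hsum]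
  have h0s : ∀ l : Fin k, A 0 l.succ = a l.succ * starRingEnd ℂ (a 0) := by
    intro l
    simp only [hA, Matrix.of_apply, levi_localPotential]
    simp [Fin.sum_univ_succ, dirDeriv, dir_apply, Pi.single_apply]
  have hs0' : ∀ j : Fin k, A j.succ 0 = a 0 * starRingEnd ℂ (a j.succ) := by
    intro j
    simp only [hA, Matrix.of_apply, levi_localPotential]
    simp [Fin.sum_univ_succ, dirDeriv, dir_apply, Pi.single_apply]
  have hss : ∀ j l : Fin k, A j.succ l.succ = α * (if j = l then 1 else 0)
      - starRingEnd ℂ (a j.succ) * a l.succ / s ^ 2 := by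
    intro j l
    simp only [hA, Matrix.of_apply, levi_localPotential]
    by_cases hjl : j = l
    · subst hjl
      simp [Fin.sum_univ_succ, dirDeriv, dir_apply, Pi.single_apply, hα']
      ring
    · have hlj : ¬ l = j := fun h => hjl h.symm
      simp [Fin.sum_univ_succ, dirDeriv, dir_apply, Pi.single_apply, hjl, hlj, ← hs]
  let c : Fin (k + 1) → ℂ := Fin.cons 0 fun j => a 0 * starRingEnd ℂ (a j.succ) / s
  let B : Matrix (Fin (k + 1)) (Fin (k + 1)) ℂ := Matrix.of fun j l => A j l - c j * A 0 l
  have hdet : A.det = B.det := by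
    refine Matrix.det_eq_of_forall_row_eq_smul_add_const c 0 rfl fun j l => ?_
    simp [B, c]
  have hB0 : ∀ j : Fin k, B j.succ 0 = 0 := by
    intro j
    simp only [B, c, Matrix.of_apply, Fin.cons_succ, hs0', h00]
    field_simp
    ring
  have hBsub : B.submatrix Fin.succ Fin.succ = α • (1 +
      Matrix.replicateCol Unit (fun j : Fin k => -(starRingEnd ℂ (a j.succ)) / s) *
      Matrix.replicateRow Unit (fun l : Fin k => a l.succ)) := by
    ext j l
    simp only [B, c, Matrix.submatrix_apply, Matrix.of_apply, Fin.cons_succ, hss, h0s,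
      Matrix.smul_apply, Matrix.add_apply, Matrix.one_apply, Matrix.mul_apply,
      Matrix.replicateCol_apply, Matrix.replicateRow_apply, Finset.univ_unique,
      Finset.sum_const, Finset.card_singleton, one_smul, smul_eq_mul, hα']
    field_simp
    ring
  rw [hdet, Matrix.det_succ_column_zero, Fin.sum_univ_succ]
  simp only [hB0, mul_zero, zero_mul, Finset.sum_const_zero, add_zero, Fin.succAbove_zero, hBsub]
  rw [Matrix.det_smul, Matrix.det_one_add_replicateCol_mul_replicateRow]
  have h5 : (fun l : Fin k => a l.succ) ⬝ᵥ (fun j : Fin k => -(starRingEnd ℂ (a j.succ)) / (s : ℂ))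
      = -(s - 1) / s := by
    rw [← hsum', dotProduct, ← Finset.sum_neg_distrib, Finset.sum_div]
    exact Finset.sum_congr rfl fun j _ => by ring
  have h6 : B 0 0 = s := by simp [B, c, h00]
  have h7 : (((1 + ‖a 0‖ ^ 2 * s) / s : ℝ) : ℂ) = α := by
    rw [hα]
    push_cast
    field_simp
    ring
  rw [h5, h6, h7]
  simp only [Fin.val_zero, pow_zero, one_mul, Fintype.card_fin]
  field_simp
  ring

theorem volumeDensity_zero {k : ℕ} (a : Fin (k + 1) → ℂ) : volumeDensity 0 a =
    ENNReal.ofReal (((1 + ‖a 0‖ ^ 2 * dirSq 0 a) / dirSq 0 a) ^ k / Real.pi ^ (k + 1)) := by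
  rw [volumeDensity, det_levi_localPotential, ← Complex.ofReal_pow, Complex.ofReal_re]

theorem isOpenEmbedding_param {n : ℕ} (i : Fin n) : IsOpenEmbedding (param i) :=
  (chart i).symm.isOpenEmbedding rfl

theorem simancaVolume_eq (k : ℕ) : simancaVolume (k + 1)
    = Measure.map (param 0) (volume.withDensity (volumeDensity (0 : Fin (k + 1)))) := by
  have hme := fun i : Fin (k + 1) => (isOpenEmbedding_param i).measurableEmbedding
  rw [simancaVolume, Fin.sum_univ_succ, Finset.sum_eq_zero, add_zero]
  · have h1 : (chart (0 : Fin (k + 1))).source \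
        ⋃ j : Fin (k + 1), ⋃ _ : j < 0, (chart j).source = range (param 0) := by
      simp [range_param]
    rw [h1]
    refine Measure.restrict_eq_self_of_ae_mem ?_
    change ∀ᵐ x ∂(Measure.map (param 0) _), x ∈ range (param 0)
    rw [(hme 0).ae_map_iff]
    exact Eventually.of_forall fun w => mem_range_self w
  · intro i _
    rw [Measure.restrict_eq_zero]
    change Measure.map (param i.succ) _ _ = 0
    rw [(hme i.succ).map_apply]
    refine withDensity_absolutelyContinuous _ _ (measure_mono_null (t := {w | w 0 = 0}) ?_ ?_)
    · rintro w ⟨_, hw⟩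
      by_contra h
      refine hw (mem_iUnion₂.2 ⟨0, Fin.succ_pos i, (param_mem_source _ _ w).2 ?_⟩)
      rwa [dir_apply, if_neg (Fin.succ_ne_zero i).symm]
    · exact Measure.pi_hyperplane (fun _ : Fin (k + 1) => (volume : Measure ℂ)) 0 0

end BlowUp

end

noncomputable section

/-! ### Square integrable series of homogeneous functions -/

section CircleSeries

theorem lintegral_enorm_sq_eq {α : Type*} [MeasurableSpace α] (μ : Measure α) (f : α → ℂ) :
    ∫⁻ x, ‖f x‖ₑ ^ 2 ∂μ = eLpNorm f 2 μ ^ 2 := by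
  have := eLpNorm_nnreal_pow_eq_lintegral (f := f) (μ := μ) (p := 2) (by norm_num)
  simpa using this.symm

theorem Orthonormal.enorm_sum_sq {E ι : Type*} [NormedAddCommGroup E] [InnerProductSpace ℂ E]
    {e : ι → E} (he : Orthonormal ℂ e) (c : ι → ℂ) (s : Finset ι) :
    ‖∑ i ∈ s, c i • e i‖ₑ ^ 2 = ∑ i ∈ s, ‖c i‖ₑ ^ 2 := by
  have h1 : ‖∑ i ∈ s, c i • e i‖ ^ 2 = ∑ i ∈ s, ‖c i‖ ^ 2 := by
    have h2 : ((‖∑ i ∈ s, c i • e i‖ ^ 2 : ℝ) : ℂ) = ((∑ i ∈ s, ‖c i‖ ^ 2 : ℝ) : ℂ) := by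
      rw [Complex.ofReal_pow]
      have := inner_self_eq_norm_sq_to_K (𝕜 := ℂ) (∑ i ∈ s, c i • e i)
      rw [he.inner_sum] at this
      rw [← Complex.coe_algebraMap]
      refine Eq.trans this.symm ?_
      push_cast
      exact Finset.sum_congr rfl fun i _ => Complex.conj_mul' _
    exact_mod_cast h2
  simp only [← ofReal_norm, ← ENNReal.ofReal_pow (norm_nonneg _)]
  rw [h1, ENNReal.ofReal_sum_of_nonneg fun i _ => by positivity]

/-- Parseval's identity for an absolutely convergent Fourier series. -/
theorem lintegral_circle_sq {c : ℕ → ℂ} {F : UnitAddCircle → ℂ}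
    (hF : ∀ t : UnitAddCircle, HasSum (fun d => (AddCircle.toCircle t : ℂ) ^ d * c d) (F t)) :
    ∫⁻ t, ‖F t‖ₑ ^ 2 ∂AddCircle.haarAddCircle = ∑' d, ‖c d‖ₑ ^ 2 := by
  have hc : Summable fun d => ‖c d‖ := by
    have := (hF 0).summable.norm
    simpa using this
  have hs : Summable fun d : ℕ => c d • (fourier (T := 1) (d : ℤ)) :=
    Summable.of_norm (by simpa [norm_smul, fourier_norm] using hc)
  set G : C(UnitAddCircle, ℂ) := ∑' d : ℕ, c d • (fourier (T := 1) (d : ℤ)) with hG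
  have hGF : ∀ t, G t = F t := by
    intro t
    have h1 := ContinuousMap.hasSum_apply hs.hasSum t
    refine h1.unique ?_
    convert hF t using 2 with d
    simp [fourier_apply, AddCircle.toCircle_nsmul, mul_comm]
  have h2 := (ContinuousMap.toLp (E := ℂ) 2 (AddCircle.haarAddCircle (T := 1)) ℂ).hasSum hs.hasSum
  have ho : Orthonormal ℂ fun d : ℕ => fourierLp (T := 1) 2 (d : ℤ) :=
    orthonormal_fourier.comp _ Nat.cast_injective
  have h3 : HasSum (fun d => ‖c d‖ₑ ^ 2)
      (‖ContinuousMap.toLp (E := ℂ) 2 (AddCircle.haarAddCircle (T := 1)) ℂ G‖ₑ ^ 2) := by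
    have h4 := (ENNReal.continuous_pow 2).continuousAt.tendsto.comp
      (continuous_enorm.continuousAt.tendsto.comp h2)
    refine Tendsto.congr (fun s => ?_) h4
    simp only [Function.comp]
    rw [← ho.enorm_sum_sq]
    simp [fourierLp]
  rw [h3.tsum_eq, Lp.enorm_def, ← lintegral_enorm_sq_eq]
  refine lintegral_congr_ae ?_
  filter_upwards [ContinuousMap.coeFn_toLp (p := 2) (𝕜 := ℂ)
    (AddCircle.haarAddCircle (T := 1)) G] with t ht
  rw [ht, hGF]

end CircleSeries

section Rotations

variable {n : ℕ}

/-- The rotation of the `k`-th coordinate by `c`. -/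
def rotate (k : Fin n) (c : ℂ) (z : Fin n → ℂ) : Fin n → ℂ := Function.update z k (c * z k)

theorem continuous_rotate (k : Fin n) :
    Continuous fun q : ℂ × (Fin n → ℂ) => rotate k q.1 q.2 := by
  unfold rotate
  fun_prop

/-- Invariance of a measure on `ℂⁿ` under the rotations of the coordinates. -/
def RotationInvariant (μ : Measure (Fin n → ℂ)) : Prop :=
  ∀ (k : Fin n) (c : Circle), MeasurePreserving (rotate k c) μ μ

variable {μ : Measure (Fin n → ℂ)} [SFinite μ]

theorem RotationInvariant.lintegral_sq_eq_tsum (hμ : RotationInvariant μ) (k : Fin n)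
    {f : (Fin n → ℂ) → ℂ} {p : ℕ → (Fin n → ℂ) → ℂ} (hf : Continuous f)
    (hp : ∀ d, Continuous (p d))
    (h : ∀ z (c : Circle), HasSum (fun d => (c : ℂ) ^ d * p d z) (f (rotate k c z))) :
    ∫⁻ z, ‖f z‖ₑ ^ 2 ∂μ = ∑' d, ∫⁻ z, ‖p d z‖ₑ ^ 2 ∂μ := by
  have hrot : Continuous fun q : UnitAddCircle × (Fin n → ℂ) =>
      f (rotate k (AddCircle.toCircle q.1) q.2) := by
    refine hf.comp ((continuous_rotate k).comp (Continuous.prodMk ?_ continuous_snd))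
    exact continuous_subtype_val.comp (AddCircle.continuous_toCircle.comp continuous_fst)
  have h1 : ∀ t : UnitAddCircle, ∫⁻ z, ‖f (rotate k (AddCircle.toCircle t) z)‖ₑ ^ 2 ∂μ
      = ∫⁻ z, ‖f z‖ₑ ^ 2 ∂μ := fun t =>
    (hμ k (AddCircle.toCircle t)).lintegral_comp (f := fun z => ‖f z‖ₑ ^ 2)
      (by fun_prop)
  calc ∫⁻ z, ‖f z‖ₑ ^ 2 ∂μ
      = ∫⁻ t : UnitAddCircle, ∫⁻ z, ‖f (rotate k (AddCircle.toCircle t) z)‖ₑ ^ 2 ∂μ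
          ∂AddCircle.haarAddCircle := by
        simp_rw [h1]
        simp
    _ = ∫⁻ z, ∫⁻ t : UnitAddCircle, ‖f (rotate k (AddCircle.toCircle t) z)‖ₑ ^ 2
          ∂AddCircle.haarAddCircle ∂μ := by
        refine lintegral_lintegral_swap (Measurable.aemeasurable ?_)
        exact hrot.enorm.measurable.pow_const 2
    _ = ∫⁻ z, ∑' d, ‖p d z‖ₑ ^ 2 ∂μ := by
        refine lintegral_congr fun z => lintegral_circle_sq fun t => ?_
        exact h z (AddCircle.toCircle t)
    _ = _ := lintegral_tsum fun d => ((hp d).enorm.measurable.pow_const 2).aemeasurable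

theorem RotationInvariant.tendsto_lintegral_sq (hμ : RotationInvariant μ) (k : Fin n)
    {f : (Fin n → ℂ) → ℂ} {p : ℕ → (Fin n → ℂ) → ℂ} (hf : Continuous f)
    (hp : ∀ d, Continuous (p d))
    (h : ∀ z (c : Circle), HasSum (fun d => (c : ℂ) ^ d * p d z) (f (rotate k c z)))
    (hrot : ∀ d z (c : Circle), p d (rotate k c z) = (c : ℂ) ^ d * p d z)
    (hfin : ∫⁻ z, ‖f z‖ₑ ^ 2 ∂μ ≠ ⊤) :
    Tendsto (fun N => ∫⁻ z, ‖f z - ∑ d ∈ Finset.range N, p d z‖ₑ ^ 2 ∂μ) atTop (𝓝 0) := by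
  have h1 := hμ.lintegral_sq_eq_tsum k hf hp h
  rw [h1] at hfin
  refine (ENNReal.tendsto_sum_nat_add _ hfin).congr fun N => ?_
  let q : ℕ → (Fin n → ℂ) → ℂ := fun d z => if d ∈ Finset.range N then 0 else p d z
  rw [hμ.lintegral_sq_eq_tsum k (f := fun z => f z - ∑ d ∈ Finset.range N, p d z) (p := q)
    (hf.sub (continuous_finsetSum (Finset.range N) fun d _ => hp d))]
  · rw [← ENNReal.summable.sum_add_tsum_nat_add' (f := fun d => ∫⁻ z, ‖q d z‖ₑ ^ 2 ∂μ) (k := N),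
      Finset.sum_eq_zero, zero_add]
    · refine tsum_congr fun d => ?_
      simp [q]
    · intro d hd
      simp [q, Finset.mem_range.1 hd]
  · intro d
    by_cases hd : d < N
    · simpa [q, hd] using continuous_const
    · simpa [q, hd] using hp d
  · intro z c
    have h2 := (h z c).sub (hasSum_sum_of_ne_finset_zero (s := Finset.range N)
      (f := fun d => if d ∈ Finset.range N then (c : ℂ) ^ d * p d z else 0)
      fun d hd => if_neg hd)
    have h3 : (fun d => (c : ℂ) ^ d * q d z) = fun d => (c : ℂ) ^ d * p d z -
        if d ∈ Finset.range N then (c : ℂ) ^ d * p d z else 0 := by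
      funext d
      by_cases hd : d ∈ Finset.range N
      · simp only [q, hd, if_true]; ring
      · simp only [q, hd, if_false]; ring
    rw [h3]
    have h4 : ∑ d ∈ Finset.range N, p d (rotate k c z) = ∑ d ∈ Finset.range N,
        if d ∈ Finset.range N then (c : ℂ) ^ d * p d z else 0 :=
      Finset.sum_congr rfl fun d hd => by rw [if_pos hd, hrot]
    rw [h4]
    exact h2

end Rotations

end

noncomputable section

/-! ### Homogeneous parts of entire functions of several variables -/

section HomogeneousParts

variable {n : ℕ}

/-- The holomorphic derivative in the direction of the `k`-th coordinate. -/
def coordDeriv (k : Fin n) (f : (Fin n → ℂ) → ℂ) : (Fin n → ℂ) → ℂ :=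
  fun z => fderiv ℂ f z (Pi.single k 1)

theorem contDiff_coordDeriv_iterate (k : Fin n) (d : ℕ) {f : (Fin n → ℂ) → ℂ}
    (hf : ContDiff ℂ ω f) : ContDiff ℂ ω ((coordDeriv k)^[d] f) := by
  induction d generalizing f with
  | zero => exact hf
  | succ d ih =>
    rw [Function.iterate_succ_apply]
    exact ih ((hf.fderiv_right (m := ω) le_top).clm_apply contDiff_const)

theorem contDiff_update_const (k : Fin n) (t : ℂ) :
    ContDiff ℂ ω fun z : Fin n → ℂ => Function.update z k t := by
  rw [contDiff_pi]
  intro l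
  by_cases h : l = k
  · subst h
    simpa using contDiff_const
  · simpa [h] using contDiff_apply ℂ ℂ l

theorem iteratedDeriv_comp_update (k : Fin n) (d : ℕ) {f : (Fin n → ℂ) → ℂ}
    (hf : ContDiff ℂ ω f) (z : Fin n → ℂ) :
    iteratedDeriv d (fun t => f (Function.update z k t))
      = fun t => (coordDeriv k)^[d] f (Function.update z k t) := by
  induction d generalizing f with
  | zero => simp
  | succ d ih =>
    rw [iteratedDeriv_succ', Function.iterate_succ_apply, 
      ← ih (f := coordDeriv k f) (contDiff_coordDeriv_iterate k 1 hf)]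
    congr 1
    funext t
    exact ((hf.differentiable (by simp)).differentiableAt.hasFDerivAt.comp_hasDerivAt t
      (hasDerivAt_update z k t)).deriv

/-- The part of `f` which is homogeneous of degree `d` in the `k`-th coordinate. -/
def homPart (k : Fin n) (d : ℕ) (f : (Fin n → ℂ) → ℂ) (z : Fin n → ℂ) : ℂ :=
  z k ^ d * ((d.factorial : ℂ)⁻¹ * iteratedDeriv d (fun t => f (Function.update z k t)) 0)

theorem contDiff_homPart (k : Fin n) (d : ℕ) {f : (Fin n → ℂ) → ℂ} (hf : ContDiff ℂ ω f) :
    ContDiff ℂ ω (homPart k d f) := by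
  unfold homPart
  simp only [iteratedDeriv_comp_update k d hf]
  exact ((contDiff_apply ℂ ℂ k).pow d).mul
    (contDiff_const.mul ((contDiff_coordDeriv_iterate k d hf).comp (contDiff_update_const k 0)))

theorem hasSum_update (k : Fin n) {f : (Fin n → ℂ) → ℂ} (hf : ContDiff ℂ ω f) (z : Fin n → ℂ)
    (t : ℂ) : HasSum (fun d : ℕ => (d.factorial : ℂ)⁻¹ *
      iteratedDeriv d (fun t => f (Function.update z k t)) 0 * t ^ d) (f (Function.update z k t)) := by
  have h := Complex.hasSum_taylorSeries_of_entire
    ((hf.comp (contDiff_update ω z k)).differentiable (by simp)) 0 t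
  refine (h.congr_fun ?_)
  intro d
  simp only [sub_zero, smul_eq_mul, Function.comp_def]
  ring

theorem hasSum_homPart (k : Fin n) {f : (Fin n → ℂ) → ℂ} (hf : ContDiff ℂ ω f) (z : Fin n → ℂ)
    (c : ℂ) : HasSum (fun d => c ^ d * homPart k d f z) (f (rotate k c z)) := by
  refine (hasSum_update k hf z (c * z k)).congr_fun ?_
  intro d
  rw [homPart, mul_pow]
  ring

/-- Homogeneity of degree `d` in the `k`-th coordinate. -/
def IsHomogeneousIn (k : Fin n) (d : ℕ) (f : (Fin n → ℂ) → ℂ) : Prop :=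
  ∀ z c, f (rotate k c z) = c ^ d * f z

theorem isHomogeneousIn_homPart (k : Fin n) (d : ℕ) (f : (Fin n → ℂ) → ℂ) :
    IsHomogeneousIn k d (homPart k d f) := by
  intro z c
  simp only [homPart, rotate, Function.update_idem, Function.update_self, mul_pow, mul_assoc]

theorem IsHomogeneousIn.homPart {k l : Fin n} {d e : ℕ} {f : (Fin n → ℂ) → ℂ}
    (h : IsHomogeneousIn l e f) (hl : l ≠ k) : IsHomogeneousIn l e (homPart k d f) := by
  intro z c
  have h1 : (fun t => f (Function.update (rotate l c z) k t))
      = fun t => c ^ e * f (Function.update z k t) := by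
    funext t
    rw [← h]
    congr 1
    simp only [rotate, Function.update_of_ne hl]
    rw [Function.update_comm hl]
  rw [_root_.homPart, _root_.homPart, h1, iteratedDeriv_const_mul_field, rotate, Function.update_of_ne hl.symm]
  ring

theorem isHomogeneousIn_coord_pow {o k : Fin n} (j : ℕ) (h : o ≠ k) :
    IsHomogeneousIn k 0 fun z : Fin n → ℂ => z o ^ j := by
  intro z c
  simp [rotate, h]

theorem isHomogeneousIn_coord_pow_self (o : Fin n) (j : ℕ) :
    IsHomogeneousIn o j fun z : Fin n → ℂ => z o ^ j := by
  intro z c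
  simp [rotate, mul_pow]

theorem isHomogeneousIn_monomial (k : Fin n) (β : Fin n → ℕ) :
    IsHomogeneousIn k (β k) fun z : Fin n → ℂ => ∏ l, z l ^ β l := by
  intro z c
  simp only
  rw [← Finset.mul_prod_erase _ _ (Finset.mem_univ k), ← Finset.mul_prod_erase _ _ (Finset.mem_univ k)]
  have : ∏ l ∈ Finset.univ.erase k, rotate k c z l ^ β l = ∏ l ∈ Finset.univ.erase k, z l ^ β l :=
    Finset.prod_congr rfl fun l hl => by rw [rotate, Function.update_of_ne (Finset.ne_of_mem_erase hl)]
  rw [this, rotate, Function.update_self, mul_pow, mul_assoc]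

theorem eq_monomial_of_isHomogeneousIn {f : (Fin n → ℂ) → ℂ} {β : Fin n → ℕ}
    (h : ∀ k, IsHomogeneousIn k (β k) f) (z : Fin n → ℂ) : f z = f 1 * ∏ k, z k ^ β k := by
  have key : ∀ s : Finset (Fin n), f (s.piecewise z 1) = f 1 * ∏ k ∈ s, z k ^ β k := by
    intro s
    induction s using Finset.induction_on with
    | empty => simp
    | insert k s hk ih =>
      have h1 : (insert k s).piecewise z 1 = rotate k (z k) (s.piecewise z 1) := by
        rw [Finset.piecewise_insert, rotate, Finset.piecewise_eq_of_notMem _ _ _ hk]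
        simp
      rw [h1, h k, ih, Finset.prod_insert hk]
      ring
  simpa using key Finset.univ

end HomogeneousParts

section Orthogonality

variable {n : ℕ} {μ : Measure (Fin n → ℂ)}

theorem RotationInvariant.integral_eq_zero (hμ : RotationInvariant μ) {k : Fin n} {d e : ℕ}
    (hde : d ≠ e) {f g : (Fin n → ℂ) → ℂ} (hf : IsHomogeneousIn k d f)
    (hg : IsHomogeneousIn k e g) (hfc : Continuous f) (hgc : Continuous g) :
    ∫ z, starRingEnd ℂ (f z) * g z ∂μ = 0 := by
  have hne : (e : ℝ) - d ≠ 0 := sub_ne_zero.2 (by exact_mod_cast hde.symm)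
  let c : Circle := Circle.exp (Real.pi / (e - d))
  have hc : starRingEnd ℂ (c : ℂ) ^ d * (c : ℂ) ^ e = -1 := by
    rw [Circle.coe_exp, ← Complex.exp_conj, ← Complex.exp_nat_mul, ← Complex.exp_nat_mul,
      ← Complex.exp_add, ← Complex.exp_pi_mul_I]
    congr 1
    have : ((e : ℂ) - d) ≠ 0 := by exact_mod_cast hne
    simp only [map_mul, Complex.conj_ofReal, Complex.conj_I]
    push_cast
    field_simp
    ring
  have hcont : Continuous fun z => starRingEnd ℂ (f z) * g z :=
    (Complex.continuous_conj.comp hfc).mul hgc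
  have h1 := (hμ k c).map_eq
  have h2 : ∫ z, starRingEnd ℂ (f z) * g z ∂μ
      = ∫ z, starRingEnd ℂ (f (rotate k c z)) * g (rotate k c z) ∂μ := by
    conv_lhs => rw [← h1]
    exact integral_map (hμ k c).measurable.aemeasurable hcont.aestronglyMeasurable
  have h3 : ∫ z, starRingEnd ℂ (f (rotate k c z)) * g (rotate k c z) ∂μ
      = ∫ z, -1 * (starRingEnd ℂ (f z) * g z) ∂μ := by
    refine integral_congr_ae (Eventually.of_forall fun z => ?_)
    simp only [hf z, hg z, map_mul, map_pow]
    rw [← hc]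
    ring
  rw [h3, integral_const_mul] at h2
  linear_combination h2 / 2

theorem inner_toLp {α : Type*} [MeasurableSpace α] {μ : Measure α} {f g : α → ℂ}
    (hf : MemLp f 2 μ) (hg : MemLp g 2 μ) :
    inner ℂ (hf.toLp f) (hg.toLp g) = ∫ z, starRingEnd ℂ (f z) * g z ∂μ := by
  rw [L2.inner_def]
  refine integral_congr_ae ?_
  filter_upwards [hf.coeFn_toLp, hg.coeFn_toLp] with z h1 h2
  rw [h1, h2, RCLike.inner_apply, mul_comm]

theorem memLp_two_iff {α : Type*} [TopologicalSpace α] [MeasurableSpace α] [OpensMeasurableSpace α]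
    {μ : Measure α} {f : α → ℂ} (hf : Continuous f) :
    MemLp f 2 μ ↔ ∫⁻ z, ‖f z‖ₑ ^ 2 ∂μ ≠ ⊤ := by
  rw [lintegral_enorm_sq_eq, MemLp, and_iff_right hf.aestronglyMeasurable, lt_top_iff_ne_top]
  simp

variable [SFinite μ]

theorem RotationInvariant.memLp_homPart (hμ : RotationInvariant μ) (k : Fin n) (d : ℕ)
    {f : (Fin n → ℂ) → ℂ} (hf : ContDiff ℂ ω f) (hfp : MemLp f 2 μ) :
    MemLp (homPart k d f) 2 μ := by
  rw [memLp_two_iff (contDiff_homPart k d hf).continuous]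
  rw [memLp_two_iff hf.continuous, hμ.lintegral_sq_eq_tsum k hf.continuous
    (fun d => (contDiff_homPart k d hf).continuous) fun z c => hasSum_homPart k hf z c] at hfp
  exact ne_top_of_le_ne_top hfp (ENNReal.le_tsum d)

theorem RotationInvariant.tendsto_toLp_homPart (hμ : RotationInvariant μ) (k : Fin n)
    {f : (Fin n → ℂ) → ℂ} (hf : ContDiff ℂ ω f) (hfp : MemLp f 2 μ) :
    Tendsto (fun N => ∑ d ∈ Finset.range N, (hμ.memLp_homPart k d hf hfp).toLp (homPart k d f))
      atTop (𝓝 (hfp.toLp f)) := by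
  have h1 := hμ.tendsto_lintegral_sq k hf.continuous
    (fun d => (contDiff_homPart k d hf).continuous) (fun z c => hasSum_homPart k hf z c)
    (fun d z c => isHomogeneousIn_homPart k d f z c) ((memLp_two_iff hf.continuous).1 hfp)
  rw [tendsto_iff_edist_tendsto_0]
  have h2 : ∀ N, edist (∑ d ∈ Finset.range N, (hμ.memLp_homPart k d hf hfp).toLp (homPart k d f))
      (hfp.toLp f) ^ 2 = ∫⁻ z, ‖f z - ∑ d ∈ Finset.range N, homPart k d f z‖ₑ ^ 2 ∂μ := by
    intro N
    have h3 : ∑ d ∈ Finset.range N, (hμ.memLp_homPart k d hf hfp).toLp (homPart k d f)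
        = (memLp_finsetSum (Finset.range N) fun d _ => hμ.memLp_homPart k d hf hfp).toLp
          (fun z => ∑ d ∈ Finset.range N, homPart k d f z) := by
      refine Lp.ext ?_
      refine (Lp.coeFn_finsetSum _ _).trans ?_
      refine EventuallyEq.trans ?_ (MemLp.coeFn_toLp _).symm
      have h4 : ∀ᵐ z ∂μ, ∀ d, (hμ.memLp_homPart k d hf hfp).toLp (homPart k d f) z
        = homPart k d f z := ae_all_iff.2 fun d => MemLp.coeFn_toLp _
      filter_upwards [h4] with z hz
      simp [hz]
    rw [h3, edist_comm, Lp.edist_toLp_toLp, lintegral_enorm_sq_eq]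
    rfl
  have h5 := h1.congr fun N => (h2 N).symm
  have h6 := (ENNReal.continuous_rpow_const (y := 1 / 2)).continuousAt.tendsto.comp h5
  have h7 : ∀ x : ℝ≥0∞, (x ^ 2) ^ (1 / 2 : ℝ) = x := fun x => by
    rw [← ENNReal.rpow_natCast, ← ENNReal.rpow_mul]
    norm_num
  simpa only [Function.comp_def, h7, ENNReal.zero_rpow_of_pos (by norm_num : (0 : ℝ) < 1 / 2)]
    using h6

/-- The monomials span the square integrable entire functions. -/
theorem RotationInvariant.toLp_mem (hμ : RotationInvariant μ) {K : Submodule ℂ (Lp ℂ 2 μ)}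
    (hK : IsClosed (K : Set (Lp ℂ 2 μ)))
    (hmon : ∀ (β : Fin n → ℕ) (h : MemLp (fun z : Fin n → ℂ => ∏ k, z k ^ β k) 2 μ),
      h.toLp (fun z : Fin n → ℂ => ∏ k, z k ^ β k) ∈ K)
    {f : (Fin n → ℂ) → ℂ} (hf : ContDiff ℂ ω f) (hfp : MemLp f 2 μ) : hfp.toLp f ∈ K := by
  have key : ∀ s : Finset (Fin n), ∀ f : (Fin n → ℂ) → ℂ, ContDiff ℂ ω f →
      (∀ k ∉ s, ∃ d, IsHomogeneousIn k d f) → ∀ hfp : MemLp f 2 μ, hfp.toLp f ∈ K := by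
    intro s
    induction s using Finset.induction_on with
    | empty =>
      intro f _ hhom hfp
      choose β hβ using fun k => hhom k (Finset.notMem_empty k)
      have h1 := eq_monomial_of_isHomogeneousIn hβ
      by_cases h0 : f 1 = 0
      · have : hfp.toLp f = 0 :=
          (MemLp.toLp_congr hfp MemLp.zero
            (Eventually.of_forall fun z => by simp [h1 z, h0])).trans (MemLp.toLp_zero _)
        rw [this]
        exact K.zero_mem
      · have h2 : (fun z : Fin n → ℂ => ∏ k, z k ^ β k) = (f 1)⁻¹ • f := by
          funext z
          rw [Pi.smul_apply, h1 z, smul_eq_mul, inv_mul_cancel_left₀ h0]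
        have h3 : MemLp (fun z : Fin n → ℂ => ∏ k, z k ^ β k) 2 μ := by
          rw [h2]
          exact hfp.const_smul _
        have h4 : hfp.toLp f = f 1 • h3.toLp _ := by
          rw [← MemLp.toLp_const_smul]
          exact MemLp.toLp_congr _ _ (Eventually.of_forall fun z => h1 z)
        rw [h4]
        exact K.smul_mem _ (hmon β h3)
    | insert k s _ ih =>
      intro f hf hhom hfp
      refine hK.mem_of_tendsto (hμ.tendsto_toLp_homPart k hf hfp) (Eventually.of_forall fun N => ?_)
      refine K.sum_mem fun d _ => ih _ (contDiff_homPart k d hf) (fun l hl => ?_) _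
      by_cases hlk : l = k
      · exact ⟨d, hlk ▸ isHomogeneousIn_homPart k d f⟩
      · obtain ⟨e, he⟩ := hhom l (by simp [hl, hlk])
        exact ⟨e, he.homPart hlk⟩
  exact key Finset.univ f hf (fun k hk => absurd (Finset.mem_univ k) hk) hfp

theorem RotationInvariant.inner_homPart (hμ : RotationInvariant μ) {k : Fin n} {e : ℕ}
    {f g : (Fin n → ℂ) → ℂ} (hf : ContDiff ℂ ω f) (hfp : MemLp f 2 μ) (hg : Continuous g)
    (hgp : MemLp g 2 μ) (hgh : IsHomogeneousIn k e g) :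
    ∫ z, starRingEnd ℂ (g z) * f z ∂μ = ∫ z, starRingEnd ℂ (g z) * homPart k e f z ∂μ := by
  have h1 := ((innerSL ℂ (hgp.toLp g)).continuous.tendsto _).comp
    (hμ.tendsto_toLp_homPart k hf hfp)
  rw [← inner_toLp hgp hfp, ← inner_toLp hgp (hμ.memLp_homPart k e hf hfp)]
  refine tendsto_nhds_unique h1 (tendsto_const_nhds.congr' ?_)
  filter_upwards [eventually_gt_atTop e] with N hN
  simp only [Function.comp, innerSL_apply_apply]
  rw [inner_sum, Finset.sum_eq_single e]
  · intro d _ hd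
    rw [inner_toLp]
    exact hμ.integral_eq_zero hd.symm hgh (isHomogeneousIn_homPart k d f) hg
      (contDiff_homPart k d hf).continuous
  · intro h
    exact absurd (Finset.mem_range.2 hN) h

/-- The coefficient of `t ^ j` in the restriction of `f` to the `o`-th axis. -/
def axisCoeff (o : Fin n) (j : ℕ) (f : (Fin n → ℂ) → ℂ) : ℂ :=
  (j.factorial : ℂ)⁻¹ * iteratedDeriv j (fun t => f (Pi.single o t)) 0

theorem hasSum_axisCoeff (o : Fin n) {f : (Fin n → ℂ) → ℂ} (hf : ContDiff ℂ ω f) (t : ℂ) :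
    HasSum (fun j => t ^ j * axisCoeff o j f) (f (Pi.single o t)) := by
  refine (hasSum_update o hf 0 t).congr_fun fun d => ?_
  rw [mul_comm]
  rfl

/-- The coefficients on an axis of an entire function are given by scalar products with the powers
of the coordinate. -/
theorem RotationInvariant.integral_conj_pow_mul (hμ : RotationInvariant μ) (o : Fin n) (j : ℕ)
    {f : (Fin n → ℂ) → ℂ} (hf : ContDiff ℂ ω f) (hfp : MemLp f 2 μ)
    (hgp : MemLp (fun z : Fin n → ℂ => z o ^ j) 2 μ) :
    ∫ z, starRingEnd ℂ (z o ^ j) * f z ∂μ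
      = axisCoeff o j f * ∫ z, starRingEnd ℂ (z o ^ j) * z o ^ j ∂μ := by
  have hgc : Continuous fun z : Fin n → ℂ => z o ^ j := by fun_prop
  have key : ∀ s : Finset (Fin n), o ∉ s → ∃ F : (Fin n → ℂ) → ℂ, ContDiff ℂ ω F ∧ MemLp F 2 μ ∧
      (∀ z, F z = f (s.piecewise 0 z)) ∧
      ∫ z, starRingEnd ℂ (z o ^ j) * f z ∂μ = ∫ z, starRingEnd ℂ (z o ^ j) * F z ∂μ := by
    intro s
    induction s using Finset.induction_on with
    | empty => exact fun _ => ⟨f, hf, hfp, fun z => by simp, rfl⟩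
    | insert k s hk ih =>
      intro ho
      obtain ⟨F, hF, hFp, hFe, hFi⟩ := ih fun h => ho (Finset.mem_insert_of_mem h)
      have hok : o ≠ k := fun h => ho (h ▸ Finset.mem_insert_self k s)
      refine ⟨homPart k 0 F, contDiff_homPart k 0 hF, hμ.memLp_homPart k 0 hF hFp, fun z => ?_, ?_⟩
      · simp only [homPart, pow_zero, Nat.factorial_zero, Nat.cast_one, inv_one, one_mul,
          iteratedDeriv_zero, hFe]
        congr 1
        funext l
        by_cases hl : l ∈ s
        · simp [hl]
        · by_cases hlk : l = k
          · subst hlk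
            simp [hl]
          · simp [hl, hlk]
      · rw [hFi]
        exact hμ.inner_homPart hF hFp hgc hgp (isHomogeneousIn_coord_pow j hok)
  obtain ⟨F, hF, hFp, hFe, hFi⟩ := key (Finset.univ.erase o) (Finset.notMem_erase o _)
  rw [hFi, hμ.inner_homPart hF hFp hgc hgp (isHomogeneousIn_coord_pow_self o j),
    ← integral_const_mul]
  refine integral_congr_ae (Eventually.of_forall fun z => ?_)
  have h1 : ∀ t, (Finset.univ.erase o).piecewise 0 (Function.update z o t) = Pi.single o t := by
    intro t
    funext l
    by_cases hl : l = o
    · subst hl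
      simp
    · simp [hl]
  simp only [homPart, hFe, h1, axisCoeff]
  ring

end Orthogonality

end

noncomputable section

/-! ### Radial integrals over `ℂⁿ` -/

section RadialIntegrals

theorem lintegral_ofReal_eq_of_integral_pos {α : Type*} [MeasurableSpace α] {μ : Measure α}
    {f : α → ℝ} {c : ℝ} (hf : ∀ x, 0 ≤ f x) (hc : 0 < c) (h : ∫ x, f x ∂μ = c) :
    ∫⁻ x, ENNReal.ofReal (f x) ∂μ = ENNReal.ofReal c := by
  have hi : Integrable f μ := by
    by_contra hn
    rw [integral_undef hn] at h
    exact hc.ne h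
  rw [← h, ofReal_integral_eq_lintegral_ofReal hi (Eventually.of_forall hf)]

theorem lintegral_pow_mul_exp (j : ℕ) {b : ℝ} (hb : 0 < b) :
    ∫⁻ z : ℂ, ENNReal.ofReal (‖z‖ ^ (2 * j) * Real.exp (-(b * ‖z‖ ^ 2)))
      = ENNReal.ofReal (Real.pi * j.factorial / b ^ (j + 1)) := by
  refine lintegral_ofReal_eq_of_integral_pos (fun z => by positivity) (by positivity) ?_
  have h := Complex.integral_rpow_mul_exp_neg_mul_rpow (p := 2) (q := 2 * j) (b := b)
    (by norm_num) (by linarith [j.cast_nonneg (α := ℝ)]) hb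
  have h1 : ∀ z : ℂ, ‖z‖ ^ (2 * j) * Real.exp (-(b * ‖z‖ ^ 2))
      = ‖z‖ ^ (2 * j : ℝ) * Real.exp (-b * ‖z‖ ^ (2 : ℝ)) := by
    intro z
    rw [← Real.rpow_natCast ‖z‖ (2 * j), ← Real.rpow_natCast ‖z‖ 2]
    push_cast
    ring_nf
  simp_rw [h1]
  rw [h]
  have h2 : (2 * (j : ℝ) + 2) / 2 = (j : ℝ) + 1 := by ring
  have h3 : -(2 * (j : ℝ) + 2) / 2 = -((j + 1 : ℕ) : ℝ) := by push_cast; ring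
  rw [h2, h3, Real.Gamma_nat_eq_factorial, Real.rpow_neg hb.le, Real.rpow_natCast]
  field_simp

theorem integral_Ioi_mul_inv_pow (q : ℕ) {a : ℝ} (ha : 0 < a) :
    ∫ y in Ioi (0 : ℝ), y * (1 / (a + y ^ 2) ^ (q + 2)) = 1 / (2 * (q + 1) * a ^ (q + 1)) := by
  have hpos : ∀ y : ℝ, 0 < a + y ^ 2 := fun y => by positivity
  have hd : ∀ y : ℝ, HasDerivAt (fun y : ℝ => -(1 / (2 * (q + 1))) * ((a + y ^ 2) ^ (q + 1))⁻¹)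
      (y * (1 / (a + y ^ 2) ^ (q + 2))) y := by
    intro y
    have h1 : HasDerivAt (fun y : ℝ => a + y ^ 2) (2 * y) y := by
      simpa using (hasDerivAt_pow 2 y).const_add a
    have h2 := ((h1.pow (q + 1)).inv (pow_pos (hpos y) _).ne').const_mul (-(1 / (2 * ((q : ℝ) + 1))))
    refine h2.congr_deriv ?_
    have := (hpos y).ne'
    simp only [Nat.add_sub_cancel, Pi.pow_apply]
    push_cast
    field_simp
    ring
  have ht : Tendsto (fun y : ℝ => -(1 / (2 * ((q : ℝ) + 1))) * ((a + y ^ 2) ^ (q + 1))⁻¹) atTop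
      (𝓝 0) := by
    rw [← mul_zero (-(1 / (2 * ((q : ℝ) + 1))))]
    refine Tendsto.const_mul _ (tendsto_inv_atTop_zero.comp ?_)
    exact (tendsto_pow_atTop (by simp)).comp
      (tendsto_atTop_add_const_left _ _ (tendsto_pow_atTop (by simp)))
  rw [integral_Ioi_of_hasDerivAt_of_nonneg' (fun y _ => hd y) (fun y hy => ?_) ht]
  · have := ha.ne'
    simp
    field_simp
  · have : 0 < y := hy
    have := hpos y
    positivity

theorem lintegral_inv_pow (q : ℕ) {a : ℝ} (ha : 0 < a) :
    ∫⁻ z : ℂ, ENNReal.ofReal (1 / (a + ‖z‖ ^ 2) ^ (q + 2))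
      = ENNReal.ofReal (Real.pi / ((q + 1) * a ^ (q + 1))) := by
  refine lintegral_ofReal_eq_of_integral_pos (fun z => by positivity) (by positivity) ?_
  rw [integral_fun_norm_addHaar (volume : Measure ℂ) fun y => 1 / (a + y ^ 2) ^ (q + 2)]
  simp only [Complex.finrank_real_complex, smul_eq_mul, Nat.add_one_sub_one, pow_one,
    nsmul_eq_mul, integral_Ioi_mul_inv_pow q ha]
  have : (volume : Measure ℂ).real (Metric.ball 0 1) = Real.pi := by
    simp [Measure.real, Complex.volume_ball]
  rw [this]
  field_simp
  norm_num

theorem piFinSuccAbove_zero_symm_apply {k : ℕ} (z : ℂ) (v : Fin k → ℂ) :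
    (MeasurableEquiv.piFinSuccAbove (fun _ : Fin (k + 1) => ℂ) 0).symm (z, v) = Fin.cons z v :=
  Fin.insertNth_zero' z v

theorem lintegral_fin_succ {k : ℕ} {F : (Fin (k + 1) → ℂ) → ℝ≥0∞} (hF : Measurable F) :
    ∫⁻ w, F w = ∫⁻ v : Fin k → ℂ, ∫⁻ z : ℂ, F (Fin.cons z v) := by
  have h := (volume_preserving_piFinSuccAbove (fun _ : Fin (k + 1) => ℂ) 0).symm
  rw [← h.lintegral_comp hF, Measure.volume_eq_prod, lintegral_prod_symm']
  · simp_rw [piFinSuccAbove_zero_symm_apply]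
  · exact hF.comp h.measurable

theorem lintegral_fin_succ' {k : ℕ} {F : (Fin (k + 1) → ℂ) → ℝ≥0∞} (hF : Measurable F) :
    ∫⁻ w, F w = ∫⁻ z : ℂ, ∫⁻ v : Fin k → ℂ, F (Fin.cons z v) := by
  have h := (volume_preserving_piFinSuccAbove (fun _ : Fin (k + 1) => ℂ) 0).symm
  rw [← h.lintegral_comp hF, Measure.volume_eq_prod, lintegral_prod]
  · simp_rw [piFinSuccAbove_zero_symm_apply]
  · exact (hF.comp h.measurable).aemeasurable

theorem lintegral_inv_pow_sum (k q : ℕ) {a : ℝ} (ha : 0 < a) :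
    ∫⁻ v : Fin k → ℂ, ENNReal.ofReal (1 / (a + ∑ i, ‖v i‖ ^ 2) ^ (q + k + 1))
      = ENNReal.ofReal (Real.pi ^ k / (a ^ (q + 1) * ∏ i ∈ Finset.range k, ((q : ℝ) + 1 + i))) := by
  induction k generalizing q a with
  | zero => simp [lintegral_unique, volume_pi]
  | succ k ih =>
    rw [lintegral_fin_succ' (by fun_prop)]
    have h1 : ∀ z : ℂ, ∫⁻ v : Fin k → ℂ, ENNReal.ofReal
        (1 / (a + ∑ i, ‖(Fin.cons z v : Fin (k + 1) → ℂ) i‖ ^ 2) ^ (q + (k + 1) + 1))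
        = ENNReal.ofReal (Real.pi ^ k / ∏ i ∈ Finset.range k, ((q : ℝ) + 1 + 1 + i)) *
          ENNReal.ofReal (1 / (a + ‖z‖ ^ 2) ^ (q + 2)) := by
      intro z
      have := ih (q + 1) (a := a + ‖z‖ ^ 2) (by positivity)
      rw [← ENNReal.ofReal_mul (by positivity)]
      simp only [Fin.sum_univ_succ, Fin.cons_zero, Fin.cons_succ, ← add_assoc]
      rw [show q + k + 1 + 1 = q + 1 + k + 1 by ring, this]
      push_cast
      congr 1
      field_simp
    simp_rw [h1]
    rw [lintegral_const_mul _ (by fun_prop), lintegral_inv_pow q ha,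
      ← ENNReal.ofReal_mul (by positivity), Finset.prod_range_succ']
    congr 1
    have h2 : ∏ i ∈ Finset.range k, ((q : ℝ) + 1 + 1 + i)
        = ∏ i ∈ Finset.range k, ((q : ℝ) + 1 + ((i + 1 : ℕ) : ℝ)) :=
      Finset.prod_congr rfl fun i _ => by push_cast; ring
    rw [h2]
    push_cast
    rw [add_zero]
    field_simp
    ring

theorem volume_annulus (t : ℕ) :
    volume (Metric.ball (0 : ℂ) (2 ^ (t + 1)) \ Metric.ball 0 (2 ^ t))
      = ENNReal.ofReal (3 * Real.pi * 4 ^ t) := by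
  have hb : ∀ r : ℝ, 0 ≤ r → volume (Metric.ball (0 : ℂ) r) = ENNReal.ofReal (r ^ 2 * Real.pi) := by
    intro r hr
    rw [Complex.volume_ball, ENNReal.ofReal_mul (by positivity), ENNReal.ofReal_pow hr]
    congr 1
    rw [← ENNReal.ofReal_coe_nnreal]
    rfl
  rw [measure_sdiff (Metric.ball_subset_ball (pow_le_pow_right₀ (by norm_num) (by simp)))
    measurableSet_ball.nullMeasurableSet (by rw [hb _ (by positivity)]; exact ENNReal.ofReal_ne_top),
    hb _ (by positivity), hb _ (by positivity), ← ENNReal.ofReal_sub _ (by positivity)]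
  congr 1
  rw [show (4 : ℝ) = 2 ^ 2 by norm_num, ← pow_mul, ← pow_mul, ← pow_mul]
  ring

theorem lintegral_monomial_eq_top {k : ℕ} (β : Fin (k + 1) → ℕ) {p : ℕ}
    (hp : p ≤ ∑ i, β i + (k + 1)) : ∫⁻ v : Fin (k + 1) → ℂ,
      ENNReal.ofReal ((∏ i, ‖v i‖ ^ (2 * β i)) / (1 + ∑ i, ‖v i‖ ^ 2) ^ p) = ⊤ := by
  let A : ℕ → Set ℂ := fun t => Metric.ball (0 : ℂ) (2 ^ (t + 1)) \ Metric.ball 0 (2 ^ t)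
  let D : ℕ → Set (Fin (k + 1) → ℂ) := fun t => Set.pi univ fun _ => A t
  have hA : ∀ t z, z ∈ A t ↔ 2 ^ t ≤ ‖z‖ ∧ ‖z‖ < 2 ^ (t + 1) := by
    intro t z
    simp only [A, Set.mem_sdiff, mem_ball_zero_iff, not_lt]
    exact and_comm
  have hAm : ∀ t, MeasurableSet (A t) := fun t => measurableSet_ball.diff measurableSet_ball
  have hDm : ∀ t, MeasurableSet (D t) := fun t => MeasurableSet.univ_pi fun _ => hAm t
  have hdisj : Pairwise (Function.onFun Disjoint D) := by
    have h1 : ∀ s t, s < t → Disjoint (D s) (D t) := by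
      intro s t hst
      rw [Set.disjoint_left]
      intro v hs ht
      have h2 := ((hA s _).1 (hs 0 (mem_univ _))).2
      have h3 := ((hA t _).1 (ht 0 (mem_univ _))).1
      exact absurd (h2.trans_le ((pow_le_pow_right₀ (by norm_num) hst).trans h3)) (lt_irrefl _)
    intro s t hst
    rcases hst.lt_or_gt with h | h
    · exact h1 s t h
    · exact (h1 t s h).symm
  set c : ℝ := (3 * Real.pi) ^ (k + 1) / ((k + 2) * 4) ^ p with hc
  have hc0 : 0 < c := by positivity
  have hlow : ∀ t, ENNReal.ofReal c ≤ ∫⁻ v in D t,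
      ENNReal.ofReal ((∏ i, ‖v i‖ ^ (2 * β i)) / (1 + ∑ i, ‖v i‖ ^ 2) ^ p) := by
    intro t
    have hvol : volume (D t) = ENNReal.ofReal ((3 * Real.pi * 4 ^ t) ^ (k + 1)) := by
      rw [volume_pi_pi, Finset.prod_const, volume_annulus, Finset.card_univ, Fintype.card_fin,
        ENNReal.ofReal_pow (by positivity)]
    have hpt : ∀ v ∈ D t, (4 : ℝ) ^ (t * ∑ i, β i) / ((k + 2) * 4 ^ (t + 1)) ^ p
        ≤ (∏ i, ‖v i‖ ^ (2 * β i)) / (1 + ∑ i, ‖v i‖ ^ 2) ^ p := by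
      intro v hv
      have hv' := fun i => (hA t (v i)).1 (hv i (mem_univ i))
      refine div_le_div₀ (by positivity) ?_ (by positivity) (pow_le_pow_left₀ (by positivity) ?_ _)
      · rw [pow_mul, ← Finset.prod_pow_eq_pow_sum]
        refine Finset.prod_le_prod (fun i _ => by positivity) fun i _ => ?_
        rw [pow_mul]
        refine pow_le_pow_left₀ (by positivity) ?_ _
        calc (4 : ℝ) ^ t = (2 ^ t) ^ 2 := by rw [← pow_mul, mul_comm, pow_mul]; norm_num
          _ ≤ ‖v i‖ ^ 2 := pow_le_pow_left₀ (by positivity) (hv' i).1 2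
      · have h4 : ∀ i ∈ Finset.univ, ‖v i‖ ^ 2 ≤ (4 : ℝ) ^ (t + 1) := fun i _ => by
          calc ‖v i‖ ^ 2 ≤ (2 ^ (t + 1)) ^ 2 := pow_le_pow_left₀ (norm_nonneg _) (hv' i).2.le 2
            _ = 4 ^ (t + 1) := by rw [← pow_mul, mul_comm, pow_mul]; norm_num
        have h5 := Finset.sum_le_sum h4
        have h6 : (1 : ℝ) ≤ 4 ^ (t + 1) := one_le_pow₀ (by norm_num)
        simp only [Finset.sum_const, Finset.card_univ, Fintype.card_fin, nsmul_eq_mul] at h5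
        push_cast at h5
        linarith
    calc ENNReal.ofReal c ≤ ENNReal.ofReal ((4 : ℝ) ^ (t * ∑ i, β i) / ((k + 2) * 4 ^ (t + 1)) ^ p)
          * volume (D t) := by
          rw [hvol, ← ENNReal.ofReal_mul (by positivity)]
          refine ENNReal.ofReal_le_ofReal ?_
          have h7 : (4 : ℝ) ^ (t * p) ≤ 4 ^ (t * ∑ i, β i) * 4 ^ (t * (k + 1)) := by
            rw [← pow_add, ← mul_add]
            exact pow_le_pow_right₀ (by norm_num) (Nat.mul_le_mul_left t hp)
          have h8 : (4 : ℝ) ^ (t * ∑ i, β i) / ((k + 2) * 4 ^ (t + 1)) ^ p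
              * (3 * Real.pi * 4 ^ t) ^ (k + 1)
              = c * (4 ^ (t * ∑ i, β i) * 4 ^ (t * (k + 1)) / 4 ^ (t * p)) := by
            rw [hc, pow_succ, mul_pow _ _ p, mul_pow _ _ p, mul_pow _ (4 ^ t) (k + 1),
              mul_pow _ _ p, ← pow_mul 4 t p, ← pow_mul 4 t (k + 1)]
            field_simp
          rw [h8]
          exact le_mul_of_one_le_right hc0.le ((one_le_div (by positivity)).2 h7)
      _ = ∫⁻ v in D t, ENNReal.ofReal ((4 : ℝ) ^ (t * ∑ i, β i) / ((k + 2) * 4 ^ (t + 1)) ^ p) := by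
          rw [setLIntegral_const]
      _ ≤ _ := setLIntegral_mono' (hDm t) fun v hv => ENNReal.ofReal_le_ofReal (hpt v hv)
  rw [eq_top_iff]
  calc (⊤ : ℝ≥0∞) = ∑' _ : ℕ, ENNReal.ofReal c :=
        (ENNReal.tsum_const_eq_top_of_ne_zero (by simpa using hc0)).symm
    _ ≤ ∑' t, ∫⁻ v in D t, ENNReal.ofReal
          ((∏ i, ‖v i‖ ^ (2 * β i)) / (1 + ∑ i, ‖v i‖ ^ 2) ^ p) := ENNReal.tsum_le_tsum hlow
    _ = ∫⁻ v in ⋃ t, D t, ENNReal.ofReal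
          ((∏ i, ‖v i‖ ^ (2 * β i)) / (1 + ∑ i, ‖v i‖ ^ 2) ^ p) :=
        (lintegral_iUnion hDm hdisj _).symm
    _ ≤ _ := setLIntegral_le_lintegral _ _

end RadialIntegrals

end

noncomputable section

/-! ### The weighted measure on the first chart -/

namespace BlowUp

/-- The measure `h(σ, σ) dμ` on the first chart, for a frame `σ` of a quantization of `m` times the
generalized Simanca metric. -/
def quantMeasure (m k : ℕ) : Measure (Fin (k + 1) → ℂ) :=
  (volume.withDensity (volumeDensity 0)).withDensity
    fun w => ENNReal.ofReal (Real.exp (-(m * localPotential 0 w)))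

instance (m k : ℕ) : SFinite (quantMeasure m k) := by
  unfold quantMeasure
  infer_instance

theorem measurable_volumeDensity_zero (k : ℕ) :
    Measurable (volumeDensity (0 : Fin (k + 1))) := by
  have h : volumeDensity (0 : Fin (k + 1)) = fun a => ENNReal.ofReal
      (((1 + ‖a 0‖ ^ 2 * dirSq 0 a) / dirSq 0 a) ^ k / Real.pi ^ (k + 1)) :=
    funext volumeDensity_zero
  have hd : Measurable (dirSq (0 : Fin (k + 1))) := (continuous_dirSq 0).measurable
  rw [h]
  fun_prop

theorem measurable_exp_localPotential (m k : ℕ) : Measurable fun w : Fin (k + 1) → ℂ =>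
    ENNReal.ofReal (Real.exp (-(m * localPotential 0 w))) := by
  have hd : Measurable (localPotential (0 : Fin (k + 1))) :=
    (contDiff_localPotential 0).continuous.measurable
  fun_prop

theorem dirSq_zero_cons {k : ℕ} (z : ℂ) (v : Fin k → ℂ) :
    dirSq 0 (Fin.cons z v : Fin (k + 1) → ℂ) = 1 + ∑ i, ‖v i‖ ^ 2 := by
  simp [dirSq, Fin.sum_univ_succ, dir_apply]

theorem lintegral_quantMeasure (m k : ℕ) {F : (Fin (k + 1) → ℂ) → ℝ≥0∞} (hF : Measurable F) :
    ∫⁻ w, F w ∂quantMeasure m k = ∫⁻ w, volumeDensity 0 w *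
      (ENNReal.ofReal (Real.exp (-(m * localPotential 0 w))) * F w) := by
  have h := measurable_exp_localPotential m k
  rw [quantMeasure, lintegral_withDensity_eq_lintegral_mul _ h hF,
    lintegral_withDensity_eq_lintegral_mul _ (measurable_volumeDensity_zero k) (h.mul hF)]
  rfl

/-- `∫ |z|^(2j) exp(-m|z|²) (1 + |z|²)^k` over `ℂ`. -/
def radialConst (m k j : ℕ) : ℝ := ∑ l ∈ Finset.range (k + 1),
  (k.choose l : ℝ) * (Real.pi * (j + l).factorial / (m : ℝ) ^ (j + l + 1))

theorem radialConst_pos {m : ℕ} (hm : 1 ≤ m) (k j : ℕ) : 0 < radialConst m k j := by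
  have hm' : (0 : ℝ) < m := by exact_mod_cast hm
  refine Finset.sum_pos (fun l hl => ?_) (by simp)
  have : 0 < k.choose l := Nat.choose_pos (Nat.lt_succ_iff.1 (Finset.mem_range.1 hl))
  positivity

theorem lintegral_fibre {m : ℕ} (hm : 1 ≤ m) (k j : ℕ) {s : ℝ} (hs : 0 < s) :
    ∫⁻ z : ℂ, ENNReal.ofReal (‖z‖ ^ (2 * j) * Real.exp (-(m * s * ‖z‖ ^ 2)) *
      (1 + ‖z‖ ^ 2 * s) ^ k) = ENNReal.ofReal (radialConst m k j / s ^ (j + 1)) := by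
  have hm' : (0 : ℝ) < m := by exact_mod_cast hm
  have h1 : ∀ z : ℂ, ENNReal.ofReal (‖z‖ ^ (2 * j) * Real.exp (-(m * s * ‖z‖ ^ 2)) *
      (1 + ‖z‖ ^ 2 * s) ^ k) = ∑ l ∈ Finset.range (k + 1), ENNReal.ofReal (k.choose l * s ^ l) *
        ENNReal.ofReal (‖z‖ ^ (2 * (j + l)) * Real.exp (-(m * s * ‖z‖ ^ 2))) := by
    intro z
    simp_rw [← ENNReal.ofReal_mul (show (0 : ℝ) ≤ k.choose _ * s ^ _ by positivity)]
    rw [← ENNReal.ofReal_sum_of_nonneg (fun l _ => by positivity), add_comm 1, add_pow,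
      Finset.mul_sum]
    congr 1
    refine Finset.sum_congr rfl fun l _ => ?_
    rw [mul_pow, ← pow_mul, mul_add, pow_add]
    ring
  simp_rw [h1]
  rw [lintegral_finsetSum _ fun l _ => by fun_prop]
  have h2 : ∀ l, ∫⁻ z : ℂ, ENNReal.ofReal (k.choose l * s ^ l) *
      ENNReal.ofReal (‖z‖ ^ (2 * (j + l)) * Real.exp (-(m * s * ‖z‖ ^ 2)))
      = ENNReal.ofReal (k.choose l * (Real.pi * (j + l).factorial / (m : ℝ) ^ (j + l + 1))
          / s ^ (j + 1)) := by
    intro l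
    rw [lintegral_const_mul _ (by fun_prop), lintegral_pow_mul_exp (j + l) (by positivity),
      ← ENNReal.ofReal_mul (by positivity)]
    congr 1
    rw [mul_pow, show j + l + 1 = (j + 1) + l by ring, pow_add s]
    field_simp
  simp_rw [h2]
  rw [← ENNReal.ofReal_sum_of_nonneg fun l _ => by positivity, radialConst, Finset.sum_div]

theorem lintegral_monomial {m : ℕ} (hm : 1 ≤ m) (k : ℕ) (β : Fin (k + 1) → ℕ) :
    ∫⁻ w, ‖∏ i, w i ^ β i‖ₑ ^ 2 ∂quantMeasure m k
      = ENNReal.ofReal (radialConst m k (β 0) / Real.pi ^ (k + 1)) * ∫⁻ v : Fin k → ℂ,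
        ENNReal.ofReal ((∏ i, ‖v i‖ ^ (2 * β i.succ)) /
          (1 + ∑ i, ‖v i‖ ^ 2) ^ (β 0 + m + k + 1)) := by
  have hc := radialConst_pos hm k (β 0)
  have h0 : Measurable fun w : Fin (k + 1) → ℂ => ‖∏ i, w i ^ β i‖ₑ ^ 2 := by fun_prop
  have h5 : Measurable fun w : Fin (k + 1) → ℂ => volumeDensity 0 w *
      (ENNReal.ofReal (Real.exp (-(m * localPotential 0 w))) * ‖∏ i, w i ^ β i‖ₑ ^ 2) :=
    (measurable_volumeDensity_zero k).mul ((measurable_exp_localPotential m k).mul h0)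
  rw [lintegral_quantMeasure m k h0, lintegral_fin_succ h5, ← lintegral_const_mul _ (by fun_prop)]
  refine lintegral_congr fun v => ?_
  set s : ℝ := 1 + ∑ i, ‖v i‖ ^ 2 with hs
  have hs0 : 0 < s := by positivity
  set P : ℝ := ∏ i, ‖v i‖ ^ (2 * β i.succ) with hP
  have hP0 : 0 ≤ P := by positivity
  have h1 : ∀ z : ℂ, volumeDensity 0 (Fin.cons z v : Fin (k + 1) → ℂ) *
      (ENNReal.ofReal (Real.exp (-(m * localPotential 0 (Fin.cons z v : Fin (k + 1) → ℂ)))) *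
        ‖∏ i, (Fin.cons z v : Fin (k + 1) → ℂ) i ^ β i‖ₑ ^ 2)
      = ENNReal.ofReal (P / (s ^ (m + k) * Real.pi ^ (k + 1))) *
        ENNReal.ofReal (‖z‖ ^ (2 * β 0) * Real.exp (-(m * s * ‖z‖ ^ 2)) *
          (1 + ‖z‖ ^ 2 * s) ^ k) := by
    intro z
    have h2 : ‖∏ i, (Fin.cons z v : Fin (k + 1) → ℂ) i ^ β i‖ₑ ^ 2
        = ENNReal.ofReal (‖z‖ ^ (2 * β 0) * P) := by
      rw [← ofReal_norm, ← ENNReal.ofReal_pow (norm_nonneg _), Fin.prod_univ_succ]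
      congr 1
      simp only [Fin.cons_zero, Fin.cons_succ, norm_mul, norm_pow, norm_prod, mul_pow,
        ← Finset.prod_pow, hP, ← pow_mul, mul_comm 2]
    have h3 : Real.exp (-(m * localPotential 0 (Fin.cons z v : Fin (k + 1) → ℂ)))
        = Real.exp (-(m * s * ‖z‖ ^ 2)) / s ^ m := by
      rw [localPotential_eq, dirSq_zero_cons, ← hs, Fin.cons_zero, ← Real.rpow_natCast s m,
        Real.rpow_def_of_pos hs0, ← Real.exp_sub]
      congr 1
      ring
    rw [volumeDensity_zero, dirSq_zero_cons, ← hs, Fin.cons_zero, h2, h3,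
      ← ENNReal.ofReal_mul (by positivity), ← ENNReal.ofReal_mul (by positivity),
      ← ENNReal.ofReal_mul (by positivity)]
    congr 1
    rw [div_pow, pow_add]
    field_simp
    ring
  simp_rw [h1]
  rw [lintegral_const_mul _ (by fun_prop), lintegral_fibre hm k (β 0) hs0,
    ← ENNReal.ofReal_mul (by positivity), ← ENNReal.ofReal_mul (by positivity)]
  congr 1
  rw [show β 0 + m + k + 1 = (m + k) + (β 0 + 1) by ring, pow_add s]
  field_simp
  ring

/-- The squared norm of the power `w₀ ^ j`. -/
def axisNormSq (m k j : ℕ) : ℝ :=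
  radialConst m k j / (Real.pi * ∏ i ∈ Finset.range k, ((j : ℝ) + m + 1 + i))

theorem axisNormSq_pos {m : ℕ} (hm : 1 ≤ m) (k j : ℕ) : 0 < axisNormSq m k j :=
  div_pos (radialConst_pos hm k j) (by positivity)

theorem lintegral_axis_pow {m : ℕ} (hm : 1 ≤ m) (k j : ℕ) :
    ∫⁻ w : Fin (k + 1) → ℂ, ‖w 0 ^ j‖ₑ ^ 2 ∂quantMeasure m k
      = ENNReal.ofReal (axisNormSq m k j) := by
  have hc := radialConst_pos hm k j
  have h := lintegral_monomial hm k (Pi.single 0 j)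
  have h1 : ∀ w : Fin (k + 1) → ℂ, ∏ i, w i ^ (Pi.single 0 j : Fin (k + 1) → ℕ) i = w 0 ^ j := by
    intro w
    simp [Fin.prod_univ_succ]
  have h2 := lintegral_inv_pow_sum k (j + m) one_pos
  simp only [h1, Pi.single_eq_same, Pi.single_eq_of_ne (Fin.succ_ne_zero _), mul_zero, pow_zero,
    Finset.prod_const_one, h2] at h
  rw [h, ← ENNReal.ofReal_mul (by positivity), axisNormSq]
  congr 1
  push_cast
  rw [one_pow, one_mul, pow_succ]
  field_simp

theorem lintegral_monomial_ne_top {m : ℕ} (hm : 1 ≤ m) (k : ℕ) {β : Fin (k + 1) → ℕ}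
    (hβ : ∑ i : Fin k, β i.succ ≤ β 0 + m) :
    ∫⁻ w, ‖∏ i, w i ^ β i‖ₑ ^ 2 ∂quantMeasure m k ≠ ⊤ := by
  rw [lintegral_monomial hm]
  refine ENNReal.mul_ne_top ENNReal.ofReal_ne_top ?_
  refine ne_top_of_le_ne_top ?_ (lintegral_mono
    (g := fun v : Fin k → ℂ => ENNReal.ofReal (1 / (1 + ∑ i, ‖v i‖ ^ 2) ^ (0 + k + 1)))
    fun v => ENNReal.ofReal_le_ofReal ?_)
  · rw [lintegral_inv_pow_sum k 0 one_pos]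
    exact ENNReal.ofReal_ne_top
  · set s : ℝ := 1 + ∑ i, ‖v i‖ ^ 2 with hs
    have hs1 : 1 ≤ s := le_add_of_nonneg_right (by positivity)
    have h1 : ∏ i, ‖v i‖ ^ (2 * β i.succ) ≤ s ^ (β 0 + m) := by
      calc ∏ i, ‖v i‖ ^ (2 * β i.succ) ≤ ∏ i, s ^ β (Fin.succ i) := by
            refine Finset.prod_le_prod (fun i _ => by positivity) fun i _ => ?_
            rw [pow_mul]
            refine pow_le_pow_left₀ (by positivity) ?_ _
            have := Finset.single_le_sum (f := fun i => ‖v i‖ ^ 2) (fun i _ => by positivity)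
              (Finset.mem_univ i)
            linarith
        _ = s ^ ∑ i : Fin k, β i.succ := Finset.prod_pow_eq_pow_sum _ _ _
        _ ≤ s ^ (β 0 + m) := pow_le_pow_right₀ hs1 hβ
    rw [div_le_div_iff₀ (by positivity) (by positivity), one_mul, zero_add, add_assoc (β 0 + m) k 1,
      pow_add _ (β 0 + m)]
    exact mul_le_mul_of_nonneg_right h1 (by positivity)

theorem lintegral_monomial_eq_top' {m : ℕ} (hm : 1 ≤ m) {k : ℕ} {β : Fin (k + 1) → ℕ}
    (hβ : β 0 + m < ∑ i : Fin k, β i.succ) :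
    ∫⁻ w, ‖∏ i, w i ^ β i‖ₑ ^ 2 ∂quantMeasure m k = ⊤ := by
  rw [lintegral_monomial hm]
  cases k with
  | zero => simp at hβ
  | succ k =>
    rw [lintegral_monomial_eq_top _ (by omega)]
    have := radialConst_pos hm (k + 1) (β 0)
    refine ENNReal.mul_top ?_
    rw [ne_eq, ENNReal.ofReal_eq_zero, not_le]
    positivity

/-! ### Rotations -/

theorem measurePreserving_rotate {n : ℕ} (k : Fin n) (c : Circle) :
    MeasurePreserving (rotate k c) (volume : Measure (Fin n → ℂ)) volume := by
  have h : rotate k (c : ℂ) = fun (z : Fin n → ℂ) l => (if l = k then (rotation c : ℂ → ℂ) else id) (z l) := by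
    funext z l
    by_cases hl : l = k
    · subst hl
      simp [rotate]
    · simp [rotate, hl]
  rw [h]
  refine volume_preserving_pi (f := fun l => if l = k then (rotation c : ℂ → ℂ) else id) fun l => ?_
  by_cases hl : l = k
  · simp only [hl, if_true]
    exact (rotation c).measurePreserving
  · simp only [hl, if_false]
    exact MeasurePreserving.id _

theorem withDensity_measurePreserving {α : Type*} [MeasurableSpace α] {μ : Measure α} {T : α → α}
    (hT : MeasurePreserving T μ μ) {f : α → ℝ≥0∞} (hf : Measurable f) (h : ∀ x, f (T x) = f x) :
    MeasurePreserving T (μ.withDensity f) (μ.withDensity f) := by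
  refine ⟨hT.measurable, Measure.ext fun s hs => ?_⟩
  rw [Measure.map_apply hT.measurable hs, withDensity_apply _ hs,
    withDensity_apply _ (hT.measurable hs), ← hT.setLIntegral_comp_preimage hs hf]
  simp_rw [h]

theorem norm_rotate {n : ℕ} (k l : Fin n) (c : Circle) (w : Fin n → ℂ) :
    ‖rotate k c w l‖ = ‖w l‖ := by
  by_cases hl : l = k
  · subst hl
    rw [rotate, Function.update_self, norm_mul, Circle.norm_coe, one_mul]
  · rw [rotate, Function.update_of_ne hl]

theorem dirSq_rotate {n : ℕ} (i k : Fin n) (c : Circle) (w : Fin n → ℂ) :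
    dirSq i (rotate k c w) = dirSq i w := by
  refine Finset.sum_congr rfl fun j _ => ?_
  simp only [dir_apply]
  split_ifs
  · rfl
  · rw [norm_rotate]

theorem rotationInvariant_quantMeasure (m k : ℕ) : RotationInvariant (quantMeasure m k) := by
  intro l c
  refine withDensity_measurePreserving (withDensity_measurePreserving (measurePreserving_rotate l c)
    (measurable_volumeDensity_zero k) fun w => ?_) (measurable_exp_localPotential m k) fun w => ?_
  · simp only [volumeDensity_zero, dirSq_rotate, norm_rotate]
  · simp only [localPotential_eq, dirSq_rotate, norm_rotate]

end BlowUp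

end

noncomputable section

/-! ### The norms of the powers are not those of a Fock space -/

section Coefficients

open Polynomial

theorem eq_zero_of_hasSum_pow {b : ℕ → ℝ}
    (h : ∀ x : ℝ, 0 ≤ x → HasSum (fun j => b j * x ^ j) 0) (j : ℕ) : b j = 0 := by
  have hb : Summable fun j => |b j| := by
    have h1 := (h 1 zero_le_one).summable
    simp only [one_pow, mul_one] at h1
    exact h1.abs
  induction j using Nat.strong_induction_on with
  | _ j ih =>
    set B : ℝ := ∑' i, |b (i + (j + 1))|
    have hB : Summable fun i => |b (i + (j + 1))| := 
      (summable_nat_add_iff (f := fun i => |b i|) (j + 1)).2 hb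
    have key : ∀ x : ℝ, 0 < x → x ≤ 1 → |b j| ≤ x * B := by
      intro x hx hx1
      have h1 := (hasSum_nat_add_iff' (f := fun j => b j * x ^ j) (j + 1)).2 (h x hx.le)
      rw [Finset.sum_range_succ, Finset.sum_eq_zero fun i hi => by
        rw [ih i (Finset.mem_range.1 hi), zero_mul]] at h1
      have h2 : HasSum (fun i => b (i + (j + 1)) * x ^ i * x) (-b j) := by
        have h3 := h1.div_const (x ^ j)
        have hx' := hx.ne'
        have h4 : (0 - (0 + b j * x ^ j)) / x ^ j = -b j := by field_simp; ring
        rw [h4] at h3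
        refine h3.congr_fun fun i => ?_
        rw [pow_add, pow_succ]
        field_simp
      have h5 : ∀ i, ‖b (i + (j + 1)) * x ^ i * x‖ ≤ x * |b (i + (j + 1))| := by
        intro i
        rw [Real.norm_eq_abs, abs_mul, abs_mul, abs_of_pos hx, abs_of_nonneg (pow_nonneg hx.le i),
          mul_comm]
        exact mul_le_mul_of_nonneg_left
          (mul_le_of_le_one_right (abs_nonneg _) (pow_le_one₀ hx.le hx1)) hx.le
      have h6 := tsum_of_norm_bounded (hB.mul_left x).hasSum h5
      rwa [h2.tsum_eq, tsum_mul_left, norm_neg, Real.norm_eq_abs] at h6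
    have hlim : Tendsto (fun x : ℝ => x * B) (𝓝[>] 0) (𝓝 0) := by
      have : Tendsto (fun x : ℝ => x * B) (𝓝 0) (𝓝 (0 * B)) := tendsto_id.mul_const B
      rw [zero_mul] at this
      exact this.mono_left nhdsWithin_le_nhds
    have h7 : |b j| ≤ 0 := by
      refine ge_of_tendsto hlim ?_
      filter_upwards [Ioc_mem_nhdsGT (zero_lt_one' ℝ)] with x hx using key x hx.1 hx.2
    exact abs_nonpos_iff.1 h7

theorem prod_range_add_eq_ascPochhammer (k : ℕ) (x : ℝ) :
    ∏ i ∈ Finset.range k, (x + i) = (ascPochhammer ℝ k).eval x := by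
  induction k with
  | zero => simp
  | succ k ih => rw [Finset.prod_range_succ, ih, ascPochhammer_succ_eval]

theorem ascPochhammer_eval_succ_mul_factorial (j l : ℕ) :
    (ascPochhammer ℝ l).eval ((j : ℝ) + 1) * j.factorial = (j + l).factorial := by
  have h := Nat.factorial_mul_ascFactorial j l
  have h1 : (((j + 1).ascFactorial l : ℕ) : ℝ) = (ascPochhammer ℝ l).eval ((j : ℝ) + 1) := by
    rw [Nat.cast_ascFactorial]
    push_cast
    rfl
  rw [← h1, ← h]
  push_cast
  ring

/-- A shifted rising factorial of degree at least two is not a multiple of the binomial sum of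
rising factorials. -/
theorem not_forall_ascPochhammer_eq {m k : ℕ} (hm : 1 ≤ m) (hk : 2 ≤ k) (c : ℝ) :
    ¬ ∀ j : ℕ, (ascPochhammer ℝ k).eval ((j : ℝ) + 1 + m) =
      c * ∑ l ∈ Finset.range (k + 1),
        (k.choose l : ℝ) * (m : ℝ) ^ (k - l) * (ascPochhammer ℝ l).eval ((j : ℝ) + 1) := by
  intro h
  let P : ℝ[X] := (ascPochhammer ℝ k).comp (X + C (m : ℝ))
  let R : ℝ[X] := ∑ l ∈ Finset.range (k + 1), C ((k.choose l : ℝ) * (m : ℝ) ^ (k - l)) *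
    ascPochhammer ℝ l
  have hR : ∀ x, R.eval x = ∑ l ∈ Finset.range (k + 1),
      (k.choose l : ℝ) * (m : ℝ) ^ (k - l) * (ascPochhammer ℝ l).eval x := by
    intro x
    simp only [R, eval_finsetSum, eval_mul, eval_C]
  have hPR : P = C c * R := by
    refine Polynomial.eq_of_infinite_eval_eq _ _ ?_
    refine (Set.infinite_range_of_injective (f := fun j : ℕ => (j : ℝ) + 1) fun a b hab => ?_).mono ?_
    · simpa using hab
    · rintro _ ⟨j, rfl⟩
      simp only [mem_ofPred_eq, eval_mul, eval_C, hR, ← h j]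
      simp [P]
  have hc : c = 1 := by
    have h1 : P.coeff k = 1 := by
      have hmon : P.Monic := (monic_ascPochhammer ℝ k).comp_X_add_C _
      have hdeg : P.natDegree = k := by
        simp only [P, natDegree_comp, ascPochhammer_natDegree, natDegree_X_add_C, mul_one]
      rw [← hdeg]
      exact hmon
    have h2 : R.coeff k = 1 := by
      simp only [R, finsetSum_coeff, coeff_C_mul]
      rw [Finset.sum_range_succ, Finset.sum_eq_zero, zero_add]
      · have h3 : (ascPochhammer ℝ k).coeff k = 1 := by
          have := monic_ascPochhammer ℝ k
          rwa [Monic, leadingCoeff, ascPochhammer_natDegree] at this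
        simp [h3]
      · intro l hl
        rw [coeff_eq_zero_of_natDegree_lt, mul_zero]
        rw [ascPochhammer_natDegree]
        exact Finset.mem_range.1 hl
    rw [hPR, coeff_C_mul, h2, mul_one] at h1
    exact h1
  have h0 : P.eval 0 = R.eval 0 := by rw [hPR, hc]; simp
  have h1 : R.eval 0 = (m : ℝ) ^ k := by
    rw [hR, Finset.sum_eq_single 0]
    · simp
    · intro l _ hl
      rw [ascPochhammer_ne_zero_eval_zero ℝ hl, mul_zero]
    · simp
  have h2 : P.eval 0 = ∏ i ∈ Finset.range k, ((m : ℝ) + i) := by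
    rw [prod_range_add_eq_ascPochhammer]
    simp [P]
  have hm' : (0 : ℝ) < m := by exact_mod_cast hm
  have h3 : (m : ℝ) ^ k < ∏ i ∈ Finset.range k, ((m : ℝ) + i) := by
    rw [← Finset.card_range k, ← Finset.prod_const, Finset.card_range]
    refine Finset.prod_lt_prod (fun i _ => hm') (fun i _ => by simp) ⟨1, ?_, by simp⟩
    exact Finset.mem_range.2 (by omega)
  rw [← h2, h0, h1] at h3
  exact lt_irrefl _ h3

namespace BlowUp

/-- In dimension at least three, the norms of the powers of the first coordinate are not
proportional to those in a Fock space. -/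
theorem not_forall_axisNormSq {m k : ℕ} (hm : 1 ≤ m) (hk : 2 ≤ k) (c : ℝ) :
    ¬ ∀ j : ℕ, 1 / axisNormSq m k j = c * ((m : ℝ) ^ j / j.factorial) := by
  intro h
  refine not_forall_ascPochhammer_eq hm hk (c / m ^ (k + 1)) fun j => ?_
  have hm' : (0 : ℝ) < m := by exact_mod_cast hm
  have hr := (radialConst_pos hm k j).ne'
  have h1 := h j
  rw [axisNormSq, one_div_div, div_eq_iff hr] at h1
  have h2 : ∏ i ∈ Finset.range k, ((j : ℝ) + m + 1 + i)
      = (ascPochhammer ℝ k).eval ((j : ℝ) + 1 + m) := by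
    rw [prod_range_add_eq_ascPochhammer, add_right_comm]
  have h3 : radialConst m k j = Real.pi * j.factorial / m ^ (j + k + 1) *
      ∑ l ∈ Finset.range (k + 1),
        (k.choose l : ℝ) * (m : ℝ) ^ (k - l) * (ascPochhammer ℝ l).eval ((j : ℝ) + 1) := by
    rw [radialConst, Finset.mul_sum]
    refine Finset.sum_congr rfl fun l hl => ?_
    obtain ⟨d, rfl⟩ := Nat.exists_eq_add_of_le (Nat.lt_succ_iff.1 (Finset.mem_range.1 hl))
    rw [← ascPochhammer_eval_succ_mul_factorial j l, Nat.add_sub_cancel_left,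
      show j + (l + d) + 1 = (j + l + 1) + d by ring, pow_add _ (j + l + 1)]
    field_simp
  rw [h2, h3] at h1
  have hpi := Real.pi_pos.ne'
  have h4 : (j.factorial : ℝ) ≠ 0 := by positivity
  refine mul_left_cancel₀ hpi (h1.trans ?_)
  rw [show j + k + 1 = j + (k + 1) by ring, pow_add _ j]
  field_simp

end BlowUp

end Coefficients

/-! ### Parseval's identity in the closed span of an orthonormal family -/

theorem Orthonormal.tsum_enorm_inner_sq {E ι : Type*} [NormedAddCommGroup E]
    [InnerProductSpace ℂ E] [CompleteSpace E] {v : ι → E} (hv : Orthonormal ℂ v) {x : E}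
    (hx : x ∈ (Submodule.span ℂ (range v)).topologicalClosure) :
    ∑' i, ‖inner ℂ (v i) x‖ₑ ^ 2 = ‖x‖ₑ ^ 2 := by
  set K := (Submodule.span ℂ (range v)).topologicalClosure with hK
  have hmem : ∀ i, v i ∈ K := fun i =>
    Submodule.le_topologicalClosure _ (Submodule.subset_span (mem_range_self i))
  let v' : ι → K := fun i => ⟨v i, hmem i⟩
  have hv' : Orthonormal ℂ v' := by
    constructor
    · exact fun i => hv.1 i
    · exact fun i j hij => hv.2 hij
  have : CompleteSpace K := (Submodule.isClosed_topologicalClosure _).completeSpace_coe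
  have himg : (Submodule.span ℂ (range v')).map K.subtype = Submodule.span ℂ (range v) := by
    rw [Submodule.map_span, ← range_comp]
    rfl
  have hsp : ⊤ ≤ (Submodule.span ℂ (range v')).topologicalClosure := by
    rintro ⟨y, hy⟩ -
    change _ ∈ closure (Submodule.span ℂ (range v') : Set K)
    rw [closure_subtype]
    have h1 : ((↑) : K → E) '' (Submodule.span ℂ (range v') : Set K)
        = (Submodule.span ℂ (range v) : Set E) := by
      rw [← himg]
      rfl
    rw [h1]
    exact hy
  let b := HilbertBasis.mk hv' hsp
  have h2 := b.hasSum_inner_mul_inner ⟨x, hx⟩ ⟨x, hx⟩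
  have h3 : HasSum (fun i => ‖inner ℂ (v i) x‖ ^ 2) (‖x‖ ^ 2) := by
    have h4 : ∀ i, inner ℂ (⟨x, hx⟩ : K) (b i) * inner ℂ (b i) (⟨x, hx⟩ : K)
        = ((‖inner ℂ (v i) x‖ ^ 2 : ℝ) : ℂ) := by
      intro i
      have h5 : b i = v' i := by rw [HilbertBasis.coe_mk]
      rw [h5]
      change inner ℂ x (v i) * inner ℂ (v i) x = _
      rw [← inner_conj_symm x, Complex.conj_mul']
      push_cast
      rfl
    simp_rw [h4] at h2
    have h6 : inner ℂ (⟨x, hx⟩ : K) (⟨x, hx⟩ : K) = ((‖x‖ ^ 2 : ℝ) : ℂ) := by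
      change inner ℂ x x = _
      rw [inner_self_eq_norm_sq_to_K]
      push_cast
      rfl
    rw [h6] at h2
    exact Complex.hasSum_ofReal.1 h2
  rw [← ofReal_norm, ← ENNReal.ofReal_pow (norm_nonneg _), ← h3.tsum_eq,
    ENNReal.ofReal_tsum_of_nonneg (fun i => by positivity) h3.summable]
  refine tsum_congr fun i => ?_
  rw [← ofReal_norm, ← ENNReal.ofReal_pow (norm_nonneg _)]

end

noncomputable section

/-! ### The Hilbert space of sections and the epsilon function -/

namespace BlowUp

open HolomorphicLineBundle HermitianMetric

variable {m k : ℕ} {Q : GeometricQuantization ((m : ℂ) • simanca (k + 1))}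
  {σ : ∀ x, Q.L.Fiber x}

theorem normSq_eq (hσ : Q.h.IsFrame (pot m 0) (chart 0).source σ) (T : Q.Sections) :
    Q.normSq (simancaVolume (k + 1)) T = ∫⁻ w, ‖secMap 0 σ T w‖ₑ ^ 2 ∂quantMeasure m k := by
  have hm := (contDiff_secMap hσ T).continuous.enorm.measurable.pow_const 2
  rw [GeometricQuantization.normSq, simancaVolume_eq,
    (isOpenEmbedding_param 0).measurableEmbedding.lintegral_map, quantMeasure,
    lintegral_withDensity_eq_lintegral_mul _ (measurable_exp_localPotential m k) hm]
  refine lintegral_congr fun w => ?_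
  rw [form_section hσ, Pi.mul_apply, Complex.mul_conj', ← Complex.ofReal_pow, ← Complex.ofReal_mul,
    Complex.ofReal_re, ENNReal.ofReal_mul (by positivity), ENNReal.ofReal_pow (norm_nonneg _),
    ofReal_norm, mul_comm]

theorem scalarProduct_eq (hσ : Q.h.IsFrame (pot m 0) (chart 0).source σ) (S T : Q.Sections) :
    Q.scalarProduct (simancaVolume (k + 1)) S T
      = ∫ w, starRingEnd ℂ (secMap 0 σ T w) * secMap 0 σ S w ∂quantMeasure m k := by
  rw [GeometricQuantization.scalarProduct, simancaVolume_eq,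
    (isOpenEmbedding_param 0).measurableEmbedding.integral_map, quantMeasure,
    integral_withDensity_eq_integral_toReal_smul (measurable_exp_localPotential m k)
      (Eventually.of_forall fun w => ENNReal.ofReal_lt_top)]
  refine integral_congr_ae (Eventually.of_forall fun w => ?_)
  simp only [form_section hσ, ENNReal.toReal_ofReal (Real.exp_pos _).le, Complex.real_smul]
  ring

theorem memLp_secMap (hσ : Q.h.IsFrame (pot m 0) (chart 0).source σ) {T : Q.Sections} :
    MemLp (secMap 0 σ T) 2 (quantMeasure m k) ↔ Q.normSq (simancaVolume (k + 1)) T < ⊤ := by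
  rw [memLp_two_iff (contDiff_secMap hσ T).continuous, normSq_eq hσ, lt_top_iff_ne_top]

theorem scalarProduct_eq_inner (hσ : Q.h.IsFrame (pot m 0) (chart 0).source σ) {S T : Q.Sections}
    (hS : MemLp (secMap 0 σ S) 2 (quantMeasure m k))
    (hT : MemLp (secMap 0 σ T) 2 (quantMeasure m k)) :
    Q.scalarProduct (simancaVolume (k + 1)) S T = inner ℂ (hT.toLp _) (hS.toLp _) := by
  rw [scalarProduct_eq hσ, inner_toLp]

theorem memLp_secMap_sum {ι : Type} {s : ι → Q.Sections} (hs : ∀ i, MemLp (secMap 0 σ (s i)) 2 (quantMeasure m k)) (c : ι →₀ ℂ) :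
    ∃ h : MemLp (secMap 0 σ (c.sum fun j a => a • s j)) 2 (quantMeasure m k),
      h.toLp _ = c.sum fun j a => a • (hs j).toLp _ := by
  classical
  induction c using Finsupp.induction_linear with
  | zero =>
    have h0 : secMap 0 σ ((0 : ι →₀ ℂ).sum fun j a => a • s j) = 0 := by simp
    refine ⟨by rw [h0]; exact MemLp.zero, ?_⟩
    refine Eq.trans ?_ Finsupp.sum_zero_index.symm
    rw [Lp.eq_zero_iff_ae_eq_zero]
    exact (MemLp.coeFn_toLp _).trans (EventuallyEq.of_eq h0)
  | add f g hf hg =>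
    obtain ⟨h1, h1e⟩ := hf
    obtain ⟨h2, h2e⟩ := hg
    have h3 : secMap 0 σ ((f + g).sum fun j a => a • s j)
        = secMap 0 σ (f.sum fun j a => a • s j) + secMap 0 σ (g.sum fun j a => a • s j) := by
      rw [Finsupp.sum_add_index' (by simp) (fun j a b => add_smul a b (s j)), map_add]
    refine ⟨by rw [h3]; exact h1.add h2, ?_⟩
    refine (MemLp.toLp_congr _ (h1.add h2) (EventuallyEq.of_eq h3)).trans ?_
    refine (MemLp.toLp_add h1 h2).trans ?_
    rw [h1e, h2e, Finsupp.sum_add_index' (by simp) fun j a b => add_smul a b _]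
  | single i a =>
    have h3 : secMap 0 σ ((Finsupp.single i a).sum fun j a => a • s j) = a • secMap 0 σ (s i) := by
      rw [Finsupp.sum_single_index (by simp), map_smul]
    refine ⟨by rw [h3]; exact (hs i).const_smul a, ?_⟩
    refine (MemLp.toLp_congr _ ((hs i).const_smul a) (EventuallyEq.of_eq h3)).trans ?_
    rw [MemLp.toLp_const_smul, Finsupp.sum_single_index (by simp)]

/-- An orthonormal basis of sections is an orthonormal family of functions, and the square
integrable sections lie in its closed span. -/
theorem orthonormalBasis_iff (hσ : Q.h.IsFrame (pot m 0) (chart 0).source σ) {ι : Type}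
    {s : ι → Q.Sections} (hs : ∀ i, MemLp (secMap 0 σ (s i)) 2 (quantMeasure m k)) :
    Q.IsOrthonormalBasis (simancaVolume (k + 1)) s ↔
      Orthonormal ℂ (fun i => (hs i).toLp _) ∧
      ∀ T : Q.Sections, ∀ hT : MemLp (secMap 0 σ T) 2 (quantMeasure m k),
        hT.toLp _ ∈ (Submodule.span ℂ (range fun i => (hs i).toLp _)).topologicalClosure := by
  classical
  have hsub : ∀ (T : Q.Sections) (hT : MemLp (secMap 0 σ T) 2 (quantMeasure m k)) (c : ι →₀ ℂ),
      Q.normSq (simancaVolume (k + 1)) (T - c.sum fun j a => a • s j)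
        = edist (hT.toLp _) (c.sum fun j a => a • (hs j).toLp _) ^ 2 := by
    intro T hT c
    obtain ⟨h1, h1e⟩ := memLp_secMap_sum hs c
    have h2 : secMap 0 σ (T - c.sum fun j a => a • s j)
        = secMap 0 σ T - secMap 0 σ (c.sum fun j a => a • s j) := map_sub _ _ _
    rw [normSq_eq hσ, lintegral_enorm_sq_eq, h2, ← h1e, Lp.edist_toLp_toLp]
  constructor
  · intro h
    refine ⟨orthonormal_iff_ite.2 fun i j => ?_, fun T hT => ?_⟩
    · rw [← scalarProduct_eq_inner hσ]
      split_ifs with hij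
      · rw [hij, h.normSq_eq_one]
      · exact h.orthogonal j i (Ne.symm hij)
    · rw [← SetLike.mem_coe, Submodule.topologicalClosure_coe]
      rw [EMetric.mem_closure_iff]
      intro ε hε
      have hε2 : 0 < ε ^ 2 := ENNReal.pow_pos hε 2
      obtain ⟨c, hc⟩ := h.dense T ((memLp_secMap hσ).1 hT) (ε ^ 2) hε2
      rw [hsub T hT] at hc
      refine ⟨c.sum fun j a => a • (hs j).toLp _, ?_, lt_of_pow_lt_pow_left' 2 hc⟩
      exact Submodule.sum_mem _ fun j _ =>
        Submodule.smul_mem _ _ (Submodule.subset_span (mem_range_self j))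
  · rintro ⟨ho, hd⟩
    have hite := orthonormal_iff_ite.1 ho
    refine ⟨fun j => (memLp_secMap hσ).1 (hs j), fun j => ?_, fun i j hij => ?_, fun T hT δ hδ => ?_⟩
    · rw [scalarProduct_eq_inner hσ (hs j) (hs j), hite, if_pos rfl]
    · rw [scalarProduct_eq_inner hσ (hs i) (hs j), hite, if_neg hij.symm]
    · have hT' := (memLp_secMap hσ).2 hT
      have h1 := hd T hT'
      rw [← SetLike.mem_coe, Submodule.topologicalClosure_coe, EMetric.mem_closure_iff] at h1
      obtain ⟨ε, hε, hεδ⟩ : ∃ ε : ℝ≥0∞, 0 < ε ∧ ε ^ 2 ≤ δ := by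
        refine ⟨min δ 1, lt_min hδ one_pos, ?_⟩
        rw [pow_two]
        calc min δ 1 * min δ 1 ≤ δ * 1 := mul_le_mul' (min_le_left _ _) (min_le_right _ _)
          _ = δ := mul_one δ
      obtain ⟨y, hy, hyd⟩ := h1 ε hε
      obtain ⟨c, rfl⟩ := Finsupp.mem_span_range_iff_exists_finsupp.1 hy
      exact ⟨c, (hsub T hT' c).trans_lt ((ENNReal.pow_lt_pow_left two_ne_zero hyd).trans_le hεδ)⟩

theorem prod_pow_single {k : ℕ} (w : Fin (k + 1) → ℂ) (j : ℕ) :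
    ∏ i, w i ^ (Pi.single 0 j : Fin (k + 1) → ℕ) i = w 0 ^ j := by
  simp [Fin.prod_univ_succ]

theorem memLp_axis_pow {m : ℕ} (hm : 1 ≤ m) (k j : ℕ) :
    MemLp (fun w : Fin (k + 1) → ℂ => w 0 ^ j) 2 (quantMeasure m k) := by
  rw [memLp_two_iff (by fun_prop), lintegral_axis_pow hm]
  exact ENNReal.ofReal_ne_top

theorem integral_conj_axis_pow {m : ℕ} (hm : 1 ≤ m) (k j : ℕ) :
    ∫ w : Fin (k + 1) → ℂ, starRingEnd ℂ (w 0 ^ j) * w 0 ^ j ∂quantMeasure m k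
      = axisNormSq m k j := by
  have h1 : ∀ w : Fin (k + 1) → ℂ, starRingEnd ℂ (w 0 ^ j) * w 0 ^ j
      = ((‖w 0 ^ j‖ ^ 2 : ℝ) : ℂ) := fun w => by rw [Complex.conj_mul']; push_cast; rfl
  simp_rw [h1]
  rw [integral_complex_ofReal, integral_eq_lintegral_of_nonneg_ae
    (Eventually.of_forall fun w => by positivity) (Continuous.aestronglyMeasurable (by fun_prop))]
  have h2 : ∀ w : Fin (k + 1) → ℂ, ENNReal.ofReal (‖w 0 ^ j‖ ^ 2) = ‖w 0 ^ j‖ₑ ^ 2 := fun w => by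
    rw [ENNReal.ofReal_pow (norm_nonneg _), ofReal_norm]
  simp_rw [h2]
  rw [lintegral_axis_pow hm, ENNReal.toReal_ofReal (axisNormSq_pos hm k j).le]

theorem epsilon_axis (hσ : Q.h.IsFrame (pot m 0) (chart 0).source σ) {ι : Type}
    (s : ι → Q.Sections) (x : ℂ) : Q.epsilon s (param 0 (Pi.single 0 x)) =
      ENNReal.ofReal (Real.exp (-(m * ‖x‖ ^ 2))) * ∑' i, ‖secMap 0 σ (s i) (Pi.single 0 x)‖ₑ ^ 2 := by
  have h1 : localPotential 0 (Pi.single 0 x : Fin (k + 1) → ℂ) = ‖x‖ ^ 2 := by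
    have h2 : dirSq 0 (Pi.single 0 x : Fin (k + 1) → ℂ) = 1 := by
      simp [dirSq, Fin.sum_univ_succ, dir_apply]
    rw [localPotential_eq, h2]
    simp
  rw [GeometricQuantization.epsilon, ← ENNReal.tsum_mul_left]
  refine tsum_congr fun i => ?_
  rw [form_section hσ, h1, Complex.mul_conj', ← Complex.ofReal_pow, ← Complex.ofReal_mul,
    Complex.ofReal_re, ENNReal.ofReal_mul (by positivity), ENNReal.ofReal_pow (norm_nonneg _),
    ofReal_norm, mul_comm]

theorem tsum_axisCoeff_sq (hm : 1 ≤ m) {ι : Type} {s : ι → Q.Sections}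
    (hσ : Q.h.IsFrame (pot m 0) (chart 0).source σ)
    (hmon : ∀ j, ∃ T : Q.Sections, ∀ w, secMap 0 σ T w = w 0 ^ j)
    (h : Q.IsOrthonormalBasis (simancaVolume (k + 1)) s) (j : ℕ) :
    ∑' i, ‖axisCoeff 0 j (secMap 0 σ (s i))‖ₑ ^ 2 = ENNReal.ofReal (1 / axisNormSq m k j) := by
  have hs := fun i => (memLp_secMap hσ).2 (h.normSq_lt_top i)
  obtain ⟨ho, hd⟩ := (orthonormalBasis_iff hσ hs).1 h
  have hN := axisNormSq_pos hm k j
  have hg := memLp_axis_pow hm k j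
  obtain ⟨T, hT⟩ := hmon j
  have hTe : secMap 0 σ T = fun w => w 0 ^ j := funext hT
  have hTp : MemLp (secMap 0 σ T) 2 (quantMeasure m k) := hTe ▸ hg
  have hmem : hg.toLp _ ∈ (Submodule.span ℂ (range fun i => (hs i).toLp _)).topologicalClosure := by
    have h1 := hd T hTp
    rwa [MemLp.toLp_congr hTp hg (by rw [hTe])] at h1
  have h2 := ho.tsum_enorm_inner_sq hmem
  rw [Lp.enorm_toLp, ← lintegral_enorm_sq_eq, lintegral_axis_pow hm] at h2
  have h3 : ∀ i, ‖inner ℂ ((hs i).toLp _) (hg.toLp _)‖ₑ ^ 2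
      = ENNReal.ofReal (axisNormSq m k j ^ 2) * ‖axisCoeff 0 j (secMap 0 σ (s i))‖ₑ ^ 2 := by
    intro i
    have h4 : inner ℂ (hg.toLp _) ((hs i).toLp _)
        = axisCoeff 0 j (secMap 0 σ (s i)) * (axisNormSq m k j : ℂ) := by
      rw [inner_toLp hg (hs i), (rotationInvariant_quantMeasure m k).integral_conj_pow_mul 0 j
        (contDiff_secMap hσ (s i)) (hs i) hg, integral_conj_axis_pow hm]
    have h5 : ‖inner ℂ ((hs i).toLp (secMap 0 σ (s i))) (hg.toLp _)‖
        = ‖axisCoeff 0 j (secMap 0 σ (s i))‖ * axisNormSq m k j := by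
      rw [norm_inner_symm, h4, norm_mul, Complex.norm_real, Real.norm_of_nonneg hN.le]
    rw [← ofReal_norm, h5, ENNReal.ofReal_mul (norm_nonneg _), ofReal_norm, mul_pow,
      ENNReal.ofReal_pow hN.le, mul_comm]
  simp_rw [h3] at h2
  rw [ENNReal.tsum_mul_left] at h2
  have h6 : ENNReal.ofReal (axisNormSq m k j ^ 2) ≠ 0 := by
    rw [ne_eq, ENNReal.ofReal_eq_zero, not_le]
    positivity
  rw [← ENNReal.mul_right_inj h6 ENNReal.ofReal_ne_top, h2, ← ENNReal.ofReal_mul (by positivity)]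
  congr 1
  field_simp

theorem tsum_axisNormSq_of_epsilon_eq (hm : 1 ≤ m) {ι : Type} {s : ι → Q.Sections}
    (hσ : Q.h.IsFrame (pot m 0) (chart 0).source σ)
    (hmon : ∀ j, ∃ T : Q.Sections, ∀ w, secMap 0 σ T w = w 0 ^ j)
    (h : Q.IsOrthonormalBasis (simancaVolume (k + 1)) s) {c : ℝ≥0∞}
    (hc : ∀ x, Q.epsilon s x = c) (r : ℝ) :
    ∑' j : ℕ, ENNReal.ofReal (r ^ (2 * j) * (1 / axisNormSq m k j))
      = c * ENNReal.ofReal (Real.exp (m * r ^ 2)) := by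
  let a : ι → ℕ → ℂ := fun i j => axisCoeff 0 j (secMap 0 σ (s i))
  let F : ι → ℂ → ℂ := fun i x => secMap 0 σ (s i) (Pi.single 0 x)
  have hF : ∀ i x, HasSum (fun j => x ^ j * a i j) (F i x) := fun i x =>
    hasSum_axisCoeff 0 (contDiff_secMap hσ (s i)) x
  have hsg : Continuous fun x : ℂ => (Pi.single 0 x : Fin (k + 1) → ℂ) :=
    (contDiff_update (𝕜 := ℂ) 1 (0 : Fin (k + 1) → ℂ) 0).continuous
  have hFc : ∀ i, Continuous (F i) := fun i =>
    (contDiff_secMap hσ (s i)).continuous.comp hsg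
  have ha : ∀ j, ∑' i, ‖a i j‖ₑ ^ 2 = ENNReal.ofReal (1 / axisNormSq m k j) :=
    tsum_axisCoeff_sq hm hσ hmon h
  let S : Set ι := ⋃ j, Function.support fun i => ‖a i j‖ₑ ^ 2
  have hSc : S.Countable := countable_iUnion fun j =>
    Summable.countable_support_ennreal (by rw [ha j]; exact ENNReal.ofReal_ne_top)
  have : Countable S := hSc.to_subtype
  have haS : ∀ i ∉ S, ∀ j, a i j = 0 := by
    intro i hi j
    by_contra h0
    exact hi (mem_iUnion.2 ⟨j, by simpa using h0⟩)
  have hFS : ∀ i ∉ S, ∀ x, F i x = 0 := by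
    intro i hi x
    refine (hF i x).unique ?_
    simp [haS i hi]
  have hsumF : ∀ x, ∑' i : S, ‖F i x‖ₑ ^ 2 = ∑' i, ‖F i x‖ₑ ^ 2 := fun x =>
    tsum_subtype_eq_of_support_subset (f := fun i => ‖F i x‖ₑ ^ 2) fun i hi => by
      by_contra hiS
      exact hi (by simp [hFS i hiS x])
  have hsuma : ∀ j, ∑' i : S, ‖a i j‖ₑ ^ 2 = ∑' i, ‖a i j‖ₑ ^ 2 := fun j =>
    tsum_subtype_eq_of_support_subset (f := fun i => ‖a i j‖ₑ ^ 2) fun i hi => by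
      by_contra hiS
      exact hi (by simp [haS i hiS j])
  have hE : ∀ t : UnitAddCircle, ∑' i : S, ‖F i (AddCircle.toCircle t * r)‖ₑ ^ 2
      = c * ENNReal.ofReal (Real.exp (m * r ^ 2)) := by
    intro t
    rw [hsumF, ← hc (param 0 (Pi.single 0 (AddCircle.toCircle t * r))), epsilon_axis hσ, norm_mul,
      Circle.norm_coe, one_mul, Complex.norm_real, Real.norm_eq_abs, sq_abs, mul_right_comm,
      ← ENNReal.ofReal_mul (Real.exp_pos _).le, ← Real.exp_add, neg_add_cancel, Real.exp_zero,
      ENNReal.ofReal_one]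
    exact (one_mul _).symm
  calc ∑' j : ℕ, ENNReal.ofReal (r ^ (2 * j) * (1 / axisNormSq m k j))
      = ∑' j : ℕ, ∑' i : S, ‖(r : ℂ) ^ j * a i j‖ₑ ^ 2 := by
        refine tsum_congr fun j => ?_
        rw [pow_mul, ENNReal.ofReal_mul (by positivity), ← ha, ← hsuma, ← ENNReal.tsum_mul_left]
        refine tsum_congr fun i => ?_
        rw [enorm_mul, mul_pow]
        congr 1
        rw [← ofReal_norm, norm_pow, Complex.norm_real, ← ENNReal.ofReal_pow (by positivity),
          Real.norm_eq_abs, ← pow_mul |r|, mul_comm j, pow_mul |r|, sq_abs]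
    _ = ∑' i : S, ∑' j : ℕ, ‖(r : ℂ) ^ j * a i j‖ₑ ^ 2 := ENNReal.tsum_comm
    _ = ∑' i : S, ∫⁻ t : UnitAddCircle, ‖F i (AddCircle.toCircle t * r)‖ₑ ^ 2
          ∂AddCircle.haarAddCircle := by
        refine tsum_congr fun i => (lintegral_circle_sq fun t => ?_).symm
        refine (hF i _).congr_fun fun j => ?_
        rw [mul_pow, mul_assoc]
    _ = ∫⁻ t : UnitAddCircle, ∑' i : S, ‖F i (AddCircle.toCircle t * r)‖ₑ ^ 2
          ∂AddCircle.haarAddCircle := by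
        refine (lintegral_tsum fun i => Measurable.aemeasurable ?_).symm
        have h1 : Continuous fun t : UnitAddCircle => ((AddCircle.toCircle t : Circle) : ℂ) :=
          continuous_subtype_val.comp AddCircle.continuous_toCircle
        exact ((hFc i).comp (h1.mul continuous_const)).enorm.measurable.pow_const 2
    _ = c * ENNReal.ofReal (Real.exp (m * r ^ 2)) := by
        simp_rw [hE]
        simp

/-- In dimension at least three the epsilon function is not constant. -/
theorem not_epsilon_eq_const (hm : 1 ≤ m) (hk : 2 ≤ k) {ι : Type} {s : ι → Q.Sections}
    (h : Q.IsOrthonormalBasis (simancaVolume (k + 1)) s) (c : ℝ≥0∞) : ¬ ∀ x, Q.epsilon s x = c := by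
  intro hc
  obtain ⟨τ, hτ, htr⟩ := exists_frames Q 0
  have hmon : ∀ j, ∃ T : Q.Sections, ∀ w, secMap 0 (τ 0) T w = w 0 ^ j := by
    intro j
    obtain ⟨T, hT⟩ := exists_section_monomial hτ htr 0 (Pi.single 0 j) (by
      rw [Finset.sum_eq_zero fun i hi => Pi.single_eq_of_ne (Finset.ne_of_mem_erase hi) _]
      exact Nat.zero_le _)
    exact ⟨T, fun w => by rw [hT, prod_pow_single]⟩
  have key := tsum_axisNormSq_of_epsilon_eq hm (hτ 0) hmon h hc
  have hN := axisNormSq_pos hm k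
  have hct : c ≠ ⊤ := by
    have h0 := key 0
    rw [tsum_eq_single 0 fun j hj => by simp [hj]] at h0
    intro htop
    rw [htop] at h0
    simp at h0
  refine not_forall_axisNormSq hm hk c.toReal fun j => ?_
  refine sub_eq_zero.1 (eq_zero_of_hasSum_pow
    (b := fun j => 1 / axisNormSq m k j - c.toReal * ((m : ℝ) ^ j / j.factorial)) (fun x hx => ?_) j)
  have hx1 := key (Real.sqrt x)
  simp only [pow_mul, Real.sq_sqrt hx] at hx1
  have hpos : ∀ j, 0 ≤ x ^ j * (1 / axisNormSq m k j) := fun j =>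
    mul_nonneg (pow_nonneg hx j) (one_div_nonneg.2 (hN j).le)
  have hsum : HasSum (fun j => x ^ j * (1 / axisNormSq m k j)) (c.toReal * Real.exp (m * x)) := by
    have h1 : Summable fun j => x ^ j * (1 / axisNormSq m k j) := by
      refine (ENNReal.summable_toReal (f := fun j =>
        ENNReal.ofReal (x ^ j * (1 / axisNormSq m k j))) ?_).congr fun j =>
          ENNReal.toReal_ofReal (hpos j)
      rw [hx1]
      exact ENNReal.mul_ne_top hct ENNReal.ofReal_ne_top
    rw [← ENNReal.ofReal_tsum_of_nonneg hpos h1] at hx1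
    have h2 := congrArg ENNReal.toReal hx1
    rw [ENNReal.toReal_ofReal (tsum_nonneg hpos), ENNReal.toReal_mul,
      ENNReal.toReal_ofReal (Real.exp_pos _).le] at h2
    rw [← h2]
    exact h1.hasSum
  have hexp : HasSum (fun j : ℕ => (m * x) ^ j / j.factorial) (Real.exp (m * x)) := by
    rw [Real.exp_eq_exp_ℝ]
    exact NormedSpace.expSeries_div_hasSum_exp (m * x)
  have h3 := hsum.sub (hexp.mul_left c.toReal)
  rw [sub_self] at h3
  refine h3.congr_fun fun j => ?_
  rw [mul_pow]
  ring

end BlowUp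

end

noncomputable section

/-! ### Existence of a quantization -/

namespace BlowUp

theorem ratio_self {n : ℕ} {i : Fin n} {p : BlowUp n} (hi : p ∈ (chart i).source) :
    ratio i i p.1.2 = 1 := div_self hi

/-- The transition functions of the `m`-th power of the dual of the line bundle of the exceptional
divisor. -/
def quantCore (m n : ℕ) : VectorBundleCore ℂ (BlowUp n) ℂ (Fin n) where
  baseSet i := (chart i).source
  isOpen_baseSet i := (chart i).open_source
  indexAt := idx
  mem_baseSet_at := mem_affine_idx
  coordChange i j p := ratio j i p.1.2 ^ m • ContinuousLinearMap.id ℂ ℂ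
  coordChange_self i p hp v := by simp [ratio_self hp]
  continuousOn_coordChange i j := by
    have h : ContinuousOn (fun p : BlowUp n => ratio j i p.1.2)
        ((chart i).source ∩ (chart j).source) := fun p hp =>
      (contMDiffAt_ratio hp.2).continuousAt.continuousWithinAt
    exact (h.pow m).smul continuousOn_const
  coordChange_comp i j l p hp v := by
    have h1 := ratio_ne_zero hp.1.1 hp.1.2
    have h2 : ratio l i p.1.2 = ratio l j p.1.2 * ratio j i p.1.2 := by
      rw [ratio_eq_div (i := i) (j := l) (k := i) hp.1.1, ratio_eq_div (i := i) (j := l) (k := j) hp.1.1,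
        ratio_eq_div (i := i) (j := j) (k := i) hp.1.1]
      field_simp
    simp only [smul_apply, ContinuousLinearMap.id_apply, smul_eq_mul, h2, mul_pow, mul_assoc]

instance (m n : ℕ) : (quantCore m n).IsContMDiff 𝓘(ℂ, Fin n → ℂ) ω where
  contMDiffOn_coordChange i j := by
    intro p hp
    have h1 := ((contDiff_id (𝕜 := ℂ) (E := ℂ) (n := ω)).pow m).contMDiff.contMDiffAt.comp p
      (contMDiffAt_ratio (i := j) (j := i) hp.2)
    exact (h1.smul contMDiffAt_const).contMDiffWithinAt

/-- The line bundle that quantizes `m` times the generalized Simanca metric. -/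
def quantBundle (m n : ℕ) : HolomorphicLineBundle n (BlowUp n) where
  Fiber := (quantCore m n).Fiber

/-- The Hermitian metric that is `exp (-m φ)` in the `i`-th trivialization, for the potential `φ`
of the generalized Simanca metric in the `i`-th chart. -/
def quantForm (m n : ℕ) (x : BlowUp n) (a b : ℂ) : ℂ :=
  a * starRingEnd ℂ b * (Real.exp (-pot m (idx x) x) : ℝ)

theorem quantForm_add_left (m : ℕ) {n : ℕ} (x : BlowUp n) (a b c : ℂ) :
    quantForm m n x (a + b) c = quantForm m n x a c + quantForm m n x b c := by
  simp only [quantForm]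
  ring

theorem quantForm_smul_left (m : ℕ) {n : ℕ} (x : BlowUp n) (r a b : ℂ) :
    quantForm m n x (r • a) b = r * quantForm m n x a b := by
  simp only [quantForm, smul_eq_mul]
  ring

theorem quantForm_conj_symm (m : ℕ) {n : ℕ} (x : BlowUp n) (a b : ℂ) :
    quantForm m n x b a = starRingEnd ℂ (quantForm m n x a b) := by
  simp only [quantForm, map_mul, Complex.conj_conj, Complex.conj_ofReal]
  ring

theorem quantForm_pos (m : ℕ) {n : ℕ} (x : BlowUp n) (a : ℂ) (ha : a ≠ 0) :
    0 < (quantForm m n x a a).re := by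
  have ha' : 0 < ‖a‖ := norm_pos_iff.2 ha
  rw [quantForm, Complex.mul_conj', ← Complex.ofReal_pow, ← Complex.ofReal_mul, Complex.ofReal_re]
  positivity

theorem quantForm_symm_one (m : ℕ) {n : ℕ} (i : Fin n) {x : BlowUp n} (hx : x ∈ (chart i).source) :
    (quantForm m n x (ratio (idx x) i x.1.2 ^ m) (ratio (idx x) i x.1.2 ^ m)).re
      = Real.exp (-pot m i x) := by
  have hx' : x ∈ (chart (idx x)).source := mem_affine_idx x
  have h1 : 0 < ‖ratio (idx x) i x.1.2 ^ m‖ ^ 2 :=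
    pow_pos (norm_pos_iff.2 (pow_ne_zero _ (ratio_ne_zero hx' hx))) 2
  rw [quantForm, Complex.mul_conj', ← Complex.ofReal_pow, ← Complex.ofReal_mul, Complex.ofReal_re,
    pot_eq (idx x) i hx' hx, neg_sub, sub_eq_add_neg, Real.exp_add, Real.exp_log h1]

theorem quantForm_triv (m : ℕ) {n : ℕ} (e : Trivialization ℂ (π ℂ (quantBundle m n).Fiber))
    [he : MemTrivializationAtlas e] : ∃ i, e.baseSet = (chart i).source ∧
      ∀ x ∈ e.baseSet, (quantForm m n x (e.symm x 1) (e.symm x 1)).re = Real.exp (-pot m i x) := by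
  obtain ⟨i, hi⟩ : ∃ i, (quantCore m n).localTriv i = e := he.out
  have hb : e.baseSet = (chart i).source := by rw [← hi]; rfl
  refine ⟨i, hb, fun x hx => ?_⟩
  have h1 : e.symm x 1 = ratio (idx x) i x.1.2 ^ m := by
    subst hi
    have h2 : (ratio (idx x) i x.1.2 ^ m • ContinuousLinearMap.id ℂ ℂ) 1
        = ratio (idx x) i x.1.2 ^ m := by simp
    exact ((quantCore m n).localTriv_symm_apply i hx 1).trans h2
  rw [h1]
  exact quantForm_symm_one m i (hb ▸ hx)

/-- The Hermitian metric of the quantization. -/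
def quantMetric (m n : ℕ) : HermitianMetric (quantBundle m n) where
  form := quantForm m n
  add_left := quantForm_add_left m
  smul_left := quantForm_smul_left m
  conj_symm := quantForm_conj_symm m
  pos := quantForm_pos m
  smooth e he := by
    obtain ⟨i, hb, h⟩ := quantForm_triv m e
    refine ContMDiffOn.congr ?_ h
    rw [hb]
    have h1 : ContDiff ℝ ∞ fun w : Fin n → ℂ => Real.exp (-((m : ℝ) * localPotential i w)) :=
      ((contDiff_const.mul (contDiff_localPotential_infty i)).neg).exp
    exact h1.contMDiff.comp_contMDiffOn (contMDiffOn_coord_real i)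

/-- A quantization of `m` times the generalized Simanca metric. -/
def quantization (m n : ℕ) : GeometricQuantization ((m : ℂ) • simanca n) where
  L := quantBundle m n
  h := quantMetric m n
  curvature e he x hx := by
    obtain ⟨i, hb, h⟩ := quantForm_triv m e
    have h1 : (fun y => Real.log ((quantMetric m n).form y (e.symm y 1) (e.symm y 1)).re)
        =ᶠ[𝓝 x] fun y => (-m : ℝ) * localPotential i (coord i y) := by
      filter_upwards [e.open_baseSet.mem_nhds hx] with y hy
      change Real.log (quantForm m n y (e.symm y 1) (e.symm y 1)).re = _
      rw [h y hy, Real.log_exp, pot, neg_mul]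
    rw [ddbar_congr h1, ddbar_localPotential i (hb ▸ hx)]
    push_cast
    rw [neg_smul, neg_neg]
    rfl

/-! ### The orthonormal basis of monomials -/

theorem lintegral_monomial_ne_zero {m : ℕ} (hm : 1 ≤ m) (k : ℕ) (β : Fin (k + 1) → ℕ) :
    ∫⁻ w, ‖∏ i, w i ^ β i‖ₑ ^ 2 ∂quantMeasure m k ≠ 0 := by
  have hc := radialConst_pos hm k (β 0)
  rw [lintegral_monomial hm]
  refine mul_ne_zero ?_ (ne_of_gt ?_)
  · rw [ne_eq, ENNReal.ofReal_eq_zero, not_le]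
    positivity
  · have hcont : Continuous fun v : Fin k → ℂ => ENNReal.ofReal ((∏ i, ‖v i‖ ^ (2 * β i.succ)) /
        (1 + ∑ i, ‖v i‖ ^ 2) ^ (β 0 + m + k + 1)) := by
      refine ENNReal.continuous_ofReal.comp (Continuous.div (by fun_prop) (by fun_prop) fun v => ?_)
      positivity
    rw [lintegral_pos_iff_support hcont.measurable]
    refine hcont.isOpen_support.measure_pos _ ⟨1, ?_⟩
    rw [Function.mem_support, ne_eq, ENNReal.ofReal_eq_zero, not_le]
    simp only [Pi.one_apply, norm_one, one_pow, Finset.prod_const_one]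
    positivity

open HolomorphicLineBundle HermitianMetric in
theorem exists_orthonormalBasis {m : ℕ} (hm : 1 ≤ m) (k : ℕ)
    (Q : GeometricQuantization ((m : ℂ) • simanca (k + 1))) :
    ∃ (ι : Type) (s : ι → Q.Sections), Q.IsOrthonormalBasis (simancaVolume (k + 1)) s := by
  obtain ⟨σ, hσ, htr⟩ := exists_frames Q 0
  let ι : Type := {β : Fin (k + 1) → ℕ // ∑ i : Fin k, β i.succ ≤ β 0 + m}
  have hι : ∀ β : ι, ∑ i ∈ Finset.univ.erase 0, β.1 i ≤ β.1 0 + m := by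
    intro β
    have h1 := Finset.add_sum_erase Finset.univ β.1 (Finset.mem_univ 0)
    rw [Fin.sum_univ_succ] at h1
    have h2 := β.2
    omega
  choose T hT using fun β : ι => exists_section_monomial hσ htr 0 β.1 (hι β)
  have hmonc : ∀ β : Fin (k + 1) → ℕ, Continuous fun w : Fin (k + 1) → ℂ => ∏ i, w i ^ β i :=
    fun β => by fun_prop
  have hmon : ∀ β : ι, MemLp (fun w : Fin (k + 1) → ℂ => ∏ i, w i ^ β.1 i) 2 (quantMeasure m k) :=
    fun β => (memLp_two_iff (hmonc β.1)).2 (lintegral_monomial_ne_top hm k β.2)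
  let c : ι → ℂ := fun β => ((‖(hmon β).toLp _‖⁻¹ : ℝ) : ℂ)
  have hnorm : ∀ β : ι, ‖(hmon β).toLp _‖ ≠ 0 := by
    intro β h0
    refine lintegral_monomial_ne_zero hm k β.1 ?_
    rw [lintegral_enorm_sq_eq, ← Lp.enorm_toLp (hmon β), ← ofReal_norm, h0]
    simp
  have hc : ∀ β, c β ≠ 0 := fun β => by
    simpa [c] using hnorm β
  have hs : ∀ β, secMap 0 (σ 0) (c β • T β) = c β • fun w => ∏ i, w i ^ β.1 i := by
    intro β
    rw [map_smul]
    congr 1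
    exact funext (hT β)
  have hsp : ∀ β, MemLp (secMap 0 (σ 0) (c β • T β)) 2 (quantMeasure m k) := fun β => by
    rw [hs β]
    exact (hmon β).const_smul _
  have hse : ∀ β, (hsp β).toLp _ = c β • (hmon β).toLp _ := fun β =>
    (MemLp.toLp_congr _ ((hmon β).const_smul (c β)) (EventuallyEq.of_eq (hs β))).trans
      (MemLp.toLp_const_smul _ _)
  refine ⟨ι, fun β => c β • T β, (orthonormalBasis_iff (hσ 0) hsp).2 ⟨⟨fun β => ?_, fun β γ h => ?_⟩,
    fun S hS => ?_⟩⟩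
  · change ‖(hsp β).toLp _‖ = 1
    rw [hse, norm_smul, Complex.norm_real, norm_inv, norm_norm, inv_mul_cancel₀ (hnorm β)]
  · obtain ⟨i, hi⟩ := Function.ne_iff.1 fun h' => h (Subtype.ext h')
    change inner ℂ ((hsp β).toLp _) ((hsp γ).toLp _) = 0
    rw [hse, hse, inner_smul_left, inner_smul_right, inner_toLp,
      (rotationInvariant_quantMeasure m k).integral_eq_zero hi (isHomogeneousIn_monomial i β.1)
        (isHomogeneousIn_monomial i γ.1) (hmonc _) (hmonc _), mul_zero, mul_zero]
  · refine (rotationInvariant_quantMeasure m k).toLp_mem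
      (Submodule.isClosed_topologicalClosure _) (fun β hβ => ?_) (contDiff_secMap (hσ 0) S) hS
    have hβ' : ∑ i : Fin k, β i.succ ≤ β 0 + m := by
      by_contra hlt
      exact (memLp_two_iff (hmonc β)).1 hβ (lintegral_monomial_eq_top' hm (not_le.1 hlt))
    refine Submodule.le_topologicalClosure _ ?_
    have h1 : hβ.toLp _ = (c ⟨β, hβ'⟩)⁻¹ • (hsp ⟨β, hβ'⟩).toLp _ := by
      rw [hse, inv_smul_smul₀ (hc _)]
    rw [h1]
    exact Submodule.smul_mem _ _ (Submodule.subset_span (mem_range_self _))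

end BlowUp

end

theorem theorem3 (m : ℕ) (hm : 1 ≤ m) :
    (∀ n : ℕ, 2 ≤ n → ProjectivelyInduced ((m : ℂ) • BlowUp.simanca n)) ∧
    (∀ n : ℕ, 3 ≤ n →
      (∃ (Q : GeometricQuantization ((m : ℂ) • BlowUp.simanca n)) (ι : Type) (s : ι → Q.Sections),
        Q.IsOrthonormalBasis (BlowUp.simancaVolume n) s) ∧
      (∀ (Q : GeometricQuantization ((m : ℂ) • BlowUp.simanca n)) (ι : Type) (s : ι → Q.Sections),
        Q.IsOrthonormalBasis (BlowUp.simancaVolume n) s →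
          ¬ ∃ c : ℝ≥0∞, ∀ x, Q.epsilon s x = c)) := by
  refine ⟨fun n _ => BlowUp.projectivelyInduced_simanca m n, fun n hn => ?_⟩
  obtain ⟨k, rfl⟩ : ∃ k, n = k + 1 := ⟨n - 1, by omega⟩
  refine ⟨⟨BlowUp.quantization m (k + 1), BlowUp.exists_orthonormalBasis hm k _⟩, ?_⟩
  rintro Q ι s hs ⟨c, hc⟩
  exact BlowUp.not_epsilon_eq_const hm (by omega) hs c hc
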